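/- **Setting.** Let $d\in\mathbb N=\{1,2,\dots\}$, $\mathbb I^d=[-\frac12,\frac12]^d$, let $\gamma$ be the standard Gaussian measure on $\mathbb R^d$ with density $(2\pi)^{-d/2}e^{-|x|^2/2}$, and let all functions be real-valued. For $s>0$ write $s=\bar s+\tilde s$ with $\bar s=\lfloor s\rfloor$. For a measure $\mu$ on a set $U\subset\mathbb R^d$ and a kernel $\kappa$, let $W^{\bar s}_p(U,\mu)$ be the space of all $f\in L_p(\mu)$ with generalized derivatives $D^\alpha f\in L_p(\mu)$, $|\alpha|_1\le\bar s$, with norm $\big(\sum_{|\alpha|_1\le \bar s}\|D^\alpha f\|_{L_p(\mu)}^p\big)^{1/p}$. For $s\notin\mathbb N$ the space of order $s$ consists of all $f\in W^{\bar s}_p(U,\mu)$ with finite seminorm $$[f]=\sum_{|\alpha|_1=\bar s}\Big(\int_U\int_U|D^\alpha f(x)-D^\alpha f(y)|^p\,\kappa(x,y)\,d\mu(x)\,d\mu(y)\Big)^{1/p},$$ and its norm is $\|f\|_{W^{\bar s}_p(U,\mu)}+[f]$; for $s\in\mathbb N$ there is no seminorm. This gives * $W^s_p(U)$ for a cube $U$: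 $\mu$ Lebesgue measure on $U$, $\kappa(x,y)=|x-y|^{-d-\tilde sp}$; * $W^s_{p,G}(\mathbb R^d,\gamma)$: $U=\mathbb R^d$, $\mu=\gamma$, $\kappa(x,y)=|x-y|^{-d-\tilde sp}$; * $W^s_p(\mathbb R^d,\gamma)$: $U=\mathbb R^d$, $\mu=\gamma$, $\kappa=K_{p\tilde s}$, where $K_\sigma(x,y)=\int_0^\infty M_t(x,y)\,t^{-\sigma/2-1}\,dt$ and $M_t(x,y)=(1-e^{-2t})^{-d/2}\exp\Big(-\frac{e^{-2t}|x|^2-2e^{-t}x\cdot y+e^{-2t}|y|^2}{2(1-e^{-2t})}\Big)$ is the Mehler kernel. Let $\tilde L_q(\mathbb I^d)=L_q(\mathbb I^d)$, and let $\tilde W^s_p(\mathbb I^d)$ be the subspace, with the norm of $W^s_p(\mathbb I^d)$, of the functions whose $1$-periodic extension to $\mathbb R^d$ (periodic in each variable) belongs to $W^s_p$ on every cube. **Proposition.** Let $1\le q<p<\infty$, $a>0$, $b\ge0$, $s>0$ and $C>0$. There is a constant $C'>0$, depending only on $d,p,q,s,a,b,C$, with the following property. (i) *Linear operators.* Suppose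 that for every integer $m\ge2$ there is a linear operator $A_m$ on $\tilde L_q(\mathbb I^d)$ of rank at most $m$ with $$\|g-A_m(g)\|_{L_q(\mathbb I^d)}\le C\,m^{-a}(\log m)^b\,\|g\|_{\tilde W^s_p(\mathbb I^d)},\qquad g\in\tilde W^s_p(\mathbb I^d).$$ Then for every integer $n\ge2$ (and also for $n=1$ if $b=0$, with $(\log 1)^0=1$) there is a linear operator $A_n^\gamma$ on $L_q(\mathbb R^d,\gamma)$ of rank at most $n$ with $$\|f-A_n^\gamma(f)\|_{L_q(\mathbb R^d,\gamma)}\le C'\,n^{-a}(\log n)^b\,\|f\|_{W^s_p(\mathbb R^d,\gamma)},\qquad f\in W^s_p(\mathbb R^d,\gamma),$$ and, if $q<p/2$, the same $A_n^\gamma$ also satisfies $$\|f-A_n^\gamma(f)\|_{L_q(\mathbb R^d,\gamma)}\le C'\,n^{-a}(\log n)^b\,\|f\|_{W^s_{p,G}(\mathbb R^d,\gamma)},\qquad f\in W^s_{p,G}(\mathbb R^d,\gamma).$$ If all the given $A_m$ are bounded, then all $A_n^\gamma$ can be chosen bounded. (ii) *Sampling operators.* Let in addition $s>d/p$, and identify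 the elements of the Sobolev spaces with their continuous representatives. Suppose that for every integer $m\ge2$ there are points $x_1,\dots,x_m\in\mathbb I^d$ and functions $\varphi_1,\dots,\varphi_m\in\tilde L_q(\mathbb I^d)$ such that $A_m(g)=\sum_{i=1}^m g(x_i)\varphi_i$ satisfies the assumption of (i). Then for every $n$ as in (i) there are $y_1,\dots,y_n\in\mathbb R^d$ and $\psi_1,\dots,\psi_n\in L_q(\mathbb R^d,\gamma)$ such that $A_n^\gamma(f)=\sum_{i=1}^n f(y_i)\psi_i$ satisfies both conclusions of (i) (the second one if $q<p/2$). -/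

import Mathlib

open MeasureTheory Set
open scoped ENNReal

noncomputable section

namespace GaussSob

/-- `ℝ^d` with its Euclidean norm; `volume` is Lebesgue measure. -/
abbrev E (d : ℕ) : Type := EuclideanSpace ℝ (Fin d)

/-- The `i`-th coordinate vector. -/
def unitVec {d : ℕ} (i : Fin d) : E d := EuclideanSpace.single i (1 : ℝ)

/-- The closed cube `[-l/2, l/2]^d`. -/
def cube (d : ℕ) (l : ℝ) : Set (E d) := {x | ∀ i, |x i| ≤ l / 2}

/-- The unit cube `𝕀^d = [-1/2, 1/2]^d`. -/
abbrev unitCube (d : ℕ) : Set (E d) := cube d 1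

/-- The multi-indices `α ∈ ℕ₀^d` with `|α|₁ ≤ k`. -/
def multiLE (d k : ℕ) : Finset (Fin d → ℕ) :=
  (Fintype.piFinset fun _ => Finset.range (k + 1)).filter fun α => ∑ i, α i ≤ k

/-- The multi-indices `α ∈ ℕ₀^d` with `|α|₁ = k`. -/
def multiEQ (d k : ℕ) : Finset (Fin d → ℕ) :=
  (Fintype.piFinset fun _ => Finset.range (k + 1)).filter fun α => ∑ i, α i = k

/-- The classical partial derivative in the `i`-th coordinate. -/
def partialDeriv {d : ℕ} (i : Fin d) (φ : E d → ℝ) : E d → ℝ :=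
  fun x => fderiv ℝ φ x (unitVec i)

/-- The classical derivative `D^α φ = ∂₀^{α 0} ∂₁^{α 1} ⋯ φ` (used only for smooth `φ`). -/
def classicalDeriv {d : ℕ} (α : Fin d → ℕ) (φ : E d → ℝ) : E d → ℝ :=
  (List.finRange d).foldr (fun i h => (partialDeriv i)^[α i] h) φ

/-- `g` is a generalized derivative of order `α` of `f` in the open set `Ω`. -/
def IsWeakDeriv {d : ℕ} (Ω : Set (E d)) (α : Fin d → ℕ) (f g : E d → ℝ) : Prop :=
  LocallyIntegrableOn f Ω volume ∧ LocallyIntegrableOn g Ω volume ∧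
    ∀ φ : E d → ℝ, ContDiff ℝ (⊤ : ℕ∞) φ → HasCompactSupport φ → tsupport φ ⊆ Ω →
      ∫ x in Ω, f x * classicalDeriv α φ x = (-1) ^ (∑ i, α i) * ∫ x in Ω, g x * φ x

open Classical in
/-- A version of the generalized derivative `D^α f` in `Ω` (it is unique up to null sets);
the value is `0` if there is none. -/
def weakDeriv {d : ℕ} (Ω : Set (E d)) (α : Fin d → ℕ) (f : E d → ℝ) : E d → ℝ :=
  if h : ∃ g, IsWeakDeriv Ω α f g then h.choose else 0

/-- The norm of the Sobolev space of integer order `k` on `U` with respect to the measure `μ`: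
`(∑_{|α|₁ ≤ k} ‖D^α f‖_{L_p(μ)}^p)^{1/p}`; derivatives are taken in the interior of `U`. -/
def intNorm {d : ℕ} (U : Set (E d)) (μ : Measure (E d)) (k : ℕ) (p : ℝ) (f : E d → ℝ) : ℝ≥0∞ :=
  (∑ α ∈ multiLE d k, eLpNorm (weakDeriv (interior U) α f) (ENNReal.ofReal p) μ ^ p) ^ (1 / p)

/-- The seminorm
`∑_{|α|₁ = k} (∫ ∫ |D^α f(x) - D^α f(y)|^p κ(x,y) dμ(x) dμ(y))^{1/p}`. -/
def fracSeminorm {d : ℕ} (U : Set (E d)) (μ : Measure (E d)) (κ : E d → E d → ℝ≥0∞)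
    (k : ℕ) (p : ℝ) (f : E d → ℝ) : ℝ≥0∞ :=
  ∑ α ∈ multiEQ d k,
    (∫⁻ y, ∫⁻ x, ‖weakDeriv (interior U) α f x - weakDeriv (interior U) α f y‖ₑ ^ p * κ x y ∂μ ∂μ)
      ^ (1 / p)

/-- `s` is an integer (used for `s > 0`). -/
def IsIntegerOrder (s : ℝ) : Prop := Int.fract s = 0

open Classical in
/-- The norm of order `s > 0` on `U`, with respect to the measure `μ` and, for non-integer `s`,
the kernel `κ`: with `k = ⌊s⌋` it is the norm of order `k`, plus, for `s ∉ ℕ`, the seminorm. -/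
def sobNorm {d : ℕ} (U : Set (E d)) (μ : Measure (E d)) (κ : E d → E d → ℝ≥0∞)
    (s p : ℝ) (f : E d → ℝ) : ℝ≥0∞ :=
  intNorm U μ ⌊s⌋₊ p f + if IsIntegerOrder s then 0 else fracSeminorm U μ κ ⌊s⌋₊ p f

/-- Membership in the Sobolev space of order `s`: the generalized derivatives of order `α`,
`|α|₁ ≤ ⌊s⌋`, exist and belong to `L_p(μ)` and, for `s ∉ ℕ`, the seminorm is finite. -/
def MemSob {d : ℕ} (U : Set (E d)) (μ : Measure (E d)) (κ : E d → E d → ℝ≥0∞)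
    (s p : ℝ) (f : E d → ℝ) : Prop :=
  (∀ α ∈ multiLE d ⌊s⌋₊, (∃ g, IsWeakDeriv (interior U) α f g) ∧
      MemLp (weakDeriv (interior U) α f) (ENNReal.ofReal p) μ) ∧
    (¬ IsIntegerOrder s → fracSeminorm U μ κ ⌊s⌋₊ p f < ∞)

/-- The Gagliardo kernel `|x - y|^{-(d + σ)}`. -/
def gagliardoKernel (d : ℕ) (σ : ℝ) (x y : E d) : ℝ≥0∞ :=
  ENNReal.ofReal (‖x - y‖ ^ (-((d : ℝ) + σ)))

/-- The Mehler kernel `M_t(x, y)`. -/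
def mehlerKernel {d : ℕ} (t : ℝ) (x y : E d) : ℝ :=
  1 / (1 - Real.exp (-2 * t)) ^ ((d : ℝ) / 2) *
    Real.exp (-(Real.exp (-2 * t) * ‖x‖ ^ 2 - 2 * Real.exp (-t) * inner ℝ x y
      + Real.exp (-2 * t) * ‖y‖ ^ 2) / (2 * (1 - Real.exp (-2 * t))))

/-- `K_σ(x, y) = ∫₀^∞ M_t(x, y) t^{-(σ/2 + 1)} dt`, with values in `[0, ∞]`. -/
def ouKernel (d : ℕ) (σ : ℝ) (x y : E d) : ℝ≥0∞ :=
  ∫⁻ t in Ioi (0 : ℝ), ENNReal.ofReal (mehlerKernel t x y / t ^ (σ / 2 + 1))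

/-- The standard Gaussian measure on `ℝ^d`, with density `(2π)^{-d/2} exp(-|x|²/2)`. -/
def gaussMeasure (d : ℕ) : Measure (E d) :=
  volume.withDensity fun x =>
    ENNReal.ofReal ((2 * Real.pi) ^ (-(d : ℝ) / 2) * Real.exp (-‖x‖ ^ 2 / 2))

/-- Lebesgue measure on the cube `[-l/2, l/2]^d`. -/
abbrev cubeMeasure (d : ℕ) (l : ℝ) : Measure (E d) := volume.restrict (cube d l)

/-- The norm of `W^s_p([-l/2, l/2]^d)`. -/
def cubeSobNorm (d : ℕ) (l s p : ℝ) (f : E d → ℝ) : ℝ≥0∞ :=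
  sobNorm (cube d l) (cubeMeasure d l) (gagliardoKernel d (Int.fract s * p)) s p f

/-- Membership in `W^s_p([-l/2, l/2]^d)`. -/
def MemCubeSob (d : ℕ) (l s p : ℝ) (f : E d → ℝ) : Prop :=
  MemSob (cube d l) (cubeMeasure d l) (gagliardoKernel d (Int.fract s * p)) s p f

/-- `g` is `1`-periodic in each variable. -/
def IsPeriodic {d : ℕ} (g : E d → ℝ) : Prop := ∀ i x, g (x + unitVec i) = g x

/-- The periodic class: `g` is the `1`-periodic extension to `ℝ^d` of a function of
`W̃^s_p(𝕀^d)`, that is, `g` is `1`-periodic in each variable and belongs to `W^s_p` on every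
cube. Its norm is that of `W^s_p(𝕀^d)`, i.e. `cubeSobNorm d 1 s p g`. -/
def MemPerSob (d : ℕ) (s p : ℝ) (g : E d → ℝ) : Prop :=
  IsPeriodic g ∧ ∀ l : ℝ, 0 < l → MemCubeSob d l s p g

/-- The norm of the (fractional) Gaussian Sobolev space `W^s_p(ℝ^d, γ)`. -/
def gaussSobNorm (d : ℕ) (s p : ℝ) (f : E d → ℝ) : ℝ≥0∞ :=
  sobNorm univ (gaussMeasure d) (ouKernel d (p * Int.fract s)) s p f

/-- Membership in `W^s_p(ℝ^d, γ)`. -/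
def MemGaussSob (d : ℕ) (s p : ℝ) (f : E d → ℝ) : Prop :=
  MemSob univ (gaussMeasure d) (ouKernel d (p * Int.fract s)) s p f

/-- The norm of `W^s_{p,G}(ℝ^d, γ)` (equal to `W^s_p(ℝ^d, γ)` for `s ∈ ℕ`). -/
def gaussSobNormG (d : ℕ) (s p : ℝ) (f : E d → ℝ) : ℝ≥0∞ :=
  sobNorm univ (gaussMeasure d) (gagliardoKernel d (Int.fract s * p)) s p f

/-- Membership in `W^s_{p,G}(ℝ^d, γ)`. -/
def MemGaussSobG (d : ℕ) (s p : ℝ) (f : E d → ℝ) : Prop :=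
  MemSob univ (gaussMeasure d) (gagliardoKernel d (Int.fract s * p)) s p f

/-- The space `L_q(μ)` of (classes of) real functions, `1 ≤ q < ∞`. -/
abbrev LpSpace {d : ℕ} (q : ℝ) (μ : Measure (E d)) := Lp ℝ (ENNReal.ofReal q) μ

/-- A linear operator on `L_q(μ)` is bounded. -/
def IsBddOp {d : ℕ} {q : ℝ} {μ : Measure (E d)} (A : LpSpace q μ →ₗ[ℝ] LpSpace q μ) : Prop :=
  ∃ K : ℝ, ∀ u, ‖A u‖ ≤ K * ‖u‖

/-- The linear sampling algorithm `R(f) = ∑_i f(x_i) φ_i`. -/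
def sampleOp {d n : ℕ} (x : Fin n → E d) (φ : Fin n → E d → ℝ) (f : E d → ℝ) : E d → ℝ :=
  fun z => ∑ i, f (x i) * φ i z

/-- The quantity `C n^{-a} (log n)^b`. -/
def rate (C a b : ℝ) (n : ℕ) : ℝ≥0∞ :=
  ENNReal.ofReal (C * (n : ℝ) ^ (-a) * Real.log n ^ b)

end GaussSob

end

noncomputable section

namespace GaussSob

variable {d : ℕ}

/-! ### Smooth functions and their classical derivatives -/

/-! Cut `ℝ^d` into half-open cubes of side 1/2 with centers z = k/2. At each center, translate f to
the origin, multiply by a smooth cutoff χ that is 1 on the cube of side 1/2 and vanishes before the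
boundary of the unit cube, periodize, apply the given operator with m(n,k) degrees of freedom, and
transplant the result back to the tile. Tiles with m(n,k) < 2 are approximated by 0.

Convergence of the sum over tiles is a matter of Gaussian exponents. Passing from Lebesgue measure
near z to γ costs about exp(|z|²/2) in an L_p energy. The Gagliardo double integral pays this twice,
so local norms grow at most like exp(|z|²/p), while an L_q error on the tile carries the weight
exp(-|z|²/(2q)); decay remains if q < p/2. Near the diagonal `ouKernel` exceeds the Gagliardo kernel
by about exp(|z|²/2), because the Mehler kernel at small times t ≈ |x-y|² contains a factor close to
exp((|x|²+|y|²)/4) (`exists_gagliardoKernel_le_ouKernel`). This lowers the growth to about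
exp(|z|²/(2p)), and q < p suffices. The budget m(n,k) ≈ c n exp(-δ|z|²) has total at most n and
worsens the rate only by exp(aδ|z|²), which the spare decay absorbs for small δ (`exists_budget`).

The analytic core of the local bounds (`exists_local_bound`) is that multiplication by χ is bounded
in the fractional norm. The Leibniz rule produces derivatives of lower order, whose fractional
seminorms are not part of the norm; on a convex set they are controlled by first derivatives
(`gagliardo_le_of_weak_gradient`), through a weak fundamental theorem of calculus
(`ae_increment_eq`).

`exists_uniform_local_bound` fixes one growth exponent for all admissible kernels, so the budget,
and with it the operator, does not depend on the norm in which the error is measured.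
`exists_patching` then serves linear and sampling operators alike. -/

theorem contDiff_partialDeriv {φ : E d → ℝ} (h : ContDiff ℝ (⊤ : ℕ∞) φ) (i : Fin d) :
    ContDiff ℝ (⊤ : ℕ∞) (partialDeriv i φ) := by
  have h1 : ContDiff ℝ (⊤ : ℕ∞) (fderiv ℝ φ) := h.fderiv_right (by simp)
  exact h1.clm_apply contDiff_const

theorem tsupport_partialDeriv_subset (φ : E d → ℝ) (i : Fin d) :
    tsupport (partialDeriv i φ) ⊆ tsupport φ := by
  refine (closure_mono ?_).trans (closure_minimal (support_fderiv_subset ℝ (f := φ))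
    (isClosed_tsupport φ))
  intro x hx
  simp only [Function.mem_support, partialDeriv] at hx ⊢
  intro h
  exact hx (by simp [h])

theorem partialDeriv_comm {φ : E d → ℝ} (h : ContDiff ℝ (⊤ : ℕ∞) φ) (i j : Fin d) :
    partialDeriv i (partialDeriv j φ) = partialDeriv j (partialDeriv i φ) := by
  have h1 : ContDiff ℝ (⊤ : ℕ∞) (fderiv ℝ φ) := h.fderiv_right (by simp)
  have h2 : Differentiable ℝ (fderiv ℝ φ) := h1.differentiable (by simp)
  have key : ∀ (a b : Fin d) (x : E d), partialDeriv a (partialDeriv b φ) x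
      = fderiv ℝ (fderiv ℝ φ) x (unitVec a) (unitVec b) := by
    intro a b x
    unfold partialDeriv
    rw [fderiv_clm_apply (h2 x) (differentiableAt_const _)]
    simp
  funext x
  rw [key, key]
  have hs : IsSymmSndFDerivAt ℝ φ x :=
    (h.contDiffAt).isSymmSndFDerivAt (by
      simpa [minSmoothness] using WithTop.coe_le_coe.2 (le_top : (2 : ℕ∞) ≤ ⊤))
  exact hs _ _

/-- The algebra of smooth functions on `ℝ^d`. -/
def smoothFn (d : ℕ) : Subalgebra ℝ (E d → ℝ) where
  carrier := {φ | ContDiff ℝ (⊤ : ℕ∞) φ}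
  mul_mem' := fun {_ _} (ha : ContDiff ℝ (⊤ : ℕ∞) _) (hb : ContDiff ℝ (⊤ : ℕ∞) _) => ha.mul hb
  add_mem' := fun {_ _} (ha : ContDiff ℝ (⊤ : ℕ∞) _) (hb : ContDiff ℝ (⊤ : ℕ∞) _) => ha.add hb
  algebraMap_mem' := fun r => (contDiff_const : ContDiff ℝ (⊤ : ℕ∞) fun _ : E d => r)

theorem smoothFn_contDiff (φ : smoothFn d) : ContDiff ℝ (⊤ : ℕ∞) (φ : E d → ℝ) := φ.2

theorem smoothFn_continuous (φ : smoothFn d) : Continuous (φ : E d → ℝ) :=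
  (smoothFn_contDiff φ).continuous

theorem smoothFn_differentiable (φ : smoothFn d) : Differentiable ℝ (φ : E d → ℝ) :=
  (smoothFn_contDiff φ).differentiable (by simp)

/-- The partial derivative as a linear operator on smooth functions. -/
def pderivₗ (i : Fin d) : Module.End ℝ (smoothFn d) where
  toFun φ := ⟨partialDeriv i φ, contDiff_partialDeriv φ.2 i⟩
  map_add' φ ψ := by
    ext x
    simp [partialDeriv, fderiv_add (smoothFn_differentiable φ x) (smoothFn_differentiable ψ x)]
  map_smul' c φ := by
    ext x
    simp [partialDeriv, fderiv_const_smul (smoothFn_differentiable φ x) c]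

@[simp] theorem coe_pderivₗ (i : Fin d) (φ : smoothFn d) :
    (pderivₗ i φ : E d → ℝ) = partialDeriv i φ := rfl

theorem pderivₗ_mul (i : Fin d) (φ ψ : smoothFn d) :
    pderivₗ i (φ * ψ) = φ * pderivₗ i ψ + pderivₗ i φ * ψ := by
  ext x
  simp [partialDeriv, fderiv_mul (smoothFn_differentiable φ x) (smoothFn_differentiable ψ x), mul_comm]

theorem pderivₗ_commute (i j : Fin d) : Commute (pderivₗ i) (pderivₗ j) := by
  ext φ : 2
  exact partialDeriv_comm φ.2 i j

/-- The derivative of order `α` as a linear operator on smooth functions. -/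
def mderivₗ (α : Fin d → ℕ) : Module.End ℝ (smoothFn d) :=
  ((List.finRange d).map fun i => pderivₗ i ^ α i).prod

theorem coe_pderivₗ_pow (i : Fin d) (n : ℕ) (φ : smoothFn d) :
    (((pderivₗ i ^ n) φ : smoothFn d) : E d → ℝ) = (partialDeriv i)^[n] φ := by
  induction n with
  | zero => simp
  | succ n ih =>
    rw [pow_succ', Function.iterate_succ_apply', ← ih]
    rfl

theorem coe_mderivₗ (α : Fin d → ℕ) (φ : smoothFn d) :
    (mderivₗ α φ : E d → ℝ) = classicalDeriv α φ := by
  unfold mderivₗ classicalDeriv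
  induction List.finRange d with
  | nil => simp
  | cons i l ih =>
    simp only [List.map_cons, List.prod_cons, List.foldr_cons, Module.End.mul_apply]
    rw [coe_pderivₗ_pow, ih]

theorem mderivₗ_zero : mderivₗ (0 : Fin d → ℕ) = 1 := by
  simp [mderivₗ]

/-- Partial derivatives of smooth functions commute, so the additional factor can be moved to the
right end of the ordered product. With `multiIndex_induction` this reduces facts about D^α to facts
about a single partial derivative. -/
theorem mderivₗ_add_single (α : Fin d → ℕ) (i : Fin d) :
    mderivₗ (α + Pi.single i 1) = mderivₗ α * pderivₗ i := by
  unfold mderivₗ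
  have key : ∀ l : List (Fin d), l.Nodup →
      (l.map fun j => pderivₗ j ^ (α + Pi.single i 1 : Fin d → ℕ) j).prod
        = (l.map fun j => pderivₗ j ^ α j).prod * (if i ∈ l then pderivₗ i else 1) := by
    intro l
    induction l with
    | nil => simp
    | cons j l ih =>
      intro hl
      rw [List.nodup_cons] at hl
      simp only [List.map_cons, List.prod_cons, ih hl.2]
      by_cases hij : i = j
      · subst hij
        have hc : Commute (pderivₗ i) (l.map fun j => pderivₗ j ^ α j).prod := by
          apply Commute.list_prod_right
          intro x hx
          obtain ⟨j, -, rfl⟩ := List.mem_map.1 hx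
          exact (pderivₗ_commute i j).pow_right _
        simp only [hl.1, if_false, mul_one, Pi.add_apply, Pi.single_eq_same, pow_succ,
          List.mem_cons, true_or, if_true]
        rw [mul_assoc, hc.eq, mul_assoc]
      · have : j ≠ i := fun h => hij h.symm
        simp [hij, this, mul_assoc]
  rw [key _ (List.nodup_finRange d)]
  simp

theorem tsupport_pderivₗ_subset (i : Fin d) (φ : smoothFn d) :
    tsupport (pderivₗ i φ : E d → ℝ) ⊆ tsupport (φ : E d → ℝ) :=
  tsupport_partialDeriv_subset _ _

/-- Every nonzero multi-index has a predecessor. -/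
theorem multiIndex_induction {P : (Fin d → ℕ) → Prop} (h0 : P 0)
    (hs : ∀ α i, P α → P (α + Pi.single i 1)) (α : Fin d → ℕ) : P α := by
  induction hn : ∑ i, α i generalizing α with
  | zero =>
    have : α = 0 := by
      funext i
      simpa using (Finset.sum_eq_zero_iff.1 hn) i (Finset.mem_univ i)
    exact this ▸ h0
  | succ n ih =>
    have : ∃ i, α i ≠ 0 := by
      by_contra! h
      simp [h] at hn
    obtain ⟨i, hi⟩ := this
    have hα : α = (α - Pi.single i 1) + Pi.single i 1 := by
      funext j
      by_cases hj : j = i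
      · subst hj; simp; omega
      · simp [hj]
    rw [hα]
    apply hs
    apply ih
    rw [hα] at hn
    simp only [Pi.add_apply, Finset.sum_add_distrib, Finset.sum_pi_single', Finset.mem_univ,
      if_true] at hn
    simpa using hn

theorem tsupport_mderivₗ_subset (α : Fin d → ℕ) (φ : smoothFn d) :
    tsupport (mderivₗ α φ : E d → ℝ) ⊆ tsupport (φ : E d → ℝ) := by
  induction α using multiIndex_induction generalizing φ with
  | h0 => simp [mderivₗ_zero]
  | hs α i ih =>
    rw [mderivₗ_add_single]
    exact (ih _).trans (tsupport_pderivₗ_subset i φ)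

theorem sum_add_single (α : Fin d → ℕ) (i : Fin d) :
    ∑ j, (α + Pi.single i 1 : Fin d → ℕ) j = ∑ j, α j + 1 := by
  simp [Finset.sum_add_distrib]

/-- The Leibniz rule in divergence form: `χ D^α φ` is a finite sum of derivatives of products
`c φ`. -/
theorem exists_mul_mderivₗ_eq_sum (χ : smoothFn d) (α : Fin d → ℕ) :
    ∃ (ι : Type) (_ : Fintype ι) (β : ι → Fin d → ℕ) (c : ι → smoothFn d),
      (∀ j, ∑ i, β j i ≤ ∑ i, α i) ∧ (∀ j, tsupport (c j : E d → ℝ) ⊆ tsupport (χ : E d → ℝ)) ∧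
      ∀ φ : smoothFn d, χ * mderivₗ α φ = ∑ j, mderivₗ (β j) (c j * φ) := by
  induction α using multiIndex_induction with
  | h0 =>
    exact ⟨Unit, inferInstance, fun _ => 0, fun _ => χ, by simp, by simp, by simp [mderivₗ_zero]⟩
  | hs α i ih =>
    obtain ⟨ι, _, β, c, hβ, hc, h⟩ := ih
    -- The two summands come from c ∂ᵢφ = ∂ᵢ(c φ) - (∂ᵢ c) φ, applied to each term of the formula
    -- for α at ∂ᵢφ.
    refine ⟨ι ⊕ ι, inferInstance, Sum.elim (fun j => β j + Pi.single i 1) β,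
      Sum.elim c (fun j => - pderivₗ i (c j)), ?_, ?_, fun φ => ?_⟩
    · rintro (j | j)
      · simp only [Sum.elim_inl, sum_add_single]
        exact Nat.add_le_add_right (hβ j) 1
      · simp only [Sum.elim_inr, sum_add_single]
        exact (hβ j).trans (Nat.le_succ _)
    · rintro (j | j)
      · exact hc j
      · refine Subset.trans ?_ ((tsupport_pderivₗ_subset i (c j)).trans (hc j))
        simp only [Sum.elim_inr]
        apply closure_mono
        intro x hx
        simpa using hx
    · have hneg : ∀ ψ : smoothFn d, -ψ * φ = -(ψ * φ) := fun ψ => neg_mul ψ φ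
      rw [mderivₗ_add_single, Module.End.mul_apply, h]
      simp only [Fintype.sum_sum_type, Sum.elim_inl, Sum.elim_inr, mderivₗ_add_single,
        Module.End.mul_apply, pderivₗ_mul, map_add, Finset.sum_add_distrib, hneg,
        map_neg, Finset.sum_neg_distrib]
      abel

/-- The translate `φ(· + z)` of a smooth function. -/
def translateSmooth (z : E d) (φ : smoothFn d) : smoothFn d :=
  ⟨fun x => (φ : E d → ℝ) (x + z), (smoothFn_contDiff φ).comp (contDiff_id.add contDiff_const)⟩

@[simp] theorem translateSmooth_apply (z : E d) (φ : smoothFn d) (x : E d) :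
    (translateSmooth z φ : E d → ℝ) x = (φ : E d → ℝ) (x + z) := rfl

theorem pderivₗ_translate (i : Fin d) (z : E d) (φ : smoothFn d) :
    pderivₗ i (translateSmooth z φ) = translateSmooth z (pderivₗ i φ) := by
  ext x
  simp only [coe_pderivₗ, partialDeriv, translateSmooth_apply]
  exact congrArg (fun L => L (unitVec i)) (fderiv_comp_add_right (𝕜 := ℝ) (f := (φ : E d → ℝ)) (x := x) z)

theorem mderivₗ_translate (α : Fin d → ℕ) (z : E d) (φ : smoothFn d) :
    mderivₗ α (translateSmooth z φ) = translateSmooth z (mderivₗ α φ) := by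
  induction α using multiIndex_induction generalizing φ with
  | h0 => simp [mderivₗ_zero]
  | hs α i ih =>
    simp only [mderivₗ_add_single, Module.End.mul_apply, pderivₗ_translate, ih]

theorem hasCompactSupport_translate (z : E d) {φ : smoothFn d}
    (h : HasCompactSupport (φ : E d → ℝ)) : HasCompactSupport (translateSmooth z φ : E d → ℝ) :=
  h.comp_homeomorph (Homeomorph.addRight z)

/-! ### Cubes -/

theorem isClosed_cube (l : ℝ) : IsClosed (cube d l) := by
  have : cube d l = ⋂ i, {x : E d | |x i| ≤ l / 2} := by ext; simp [cube]
  rw [this]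
  exact isClosed_iInter fun i => isClosed_le (by fun_prop) continuous_const

theorem measurableSet_cube (l : ℝ) : MeasurableSet (cube d l) := (isClosed_cube l).measurableSet

theorem convex_cube (l : ℝ) : Convex ℝ (cube d l) := by
  intro x hx y hy a b ha hb hab i
  have h1 := hx i
  have h2 := hy i
  calc |(a • x + b • y) i| = |a * x i + b * y i| := by simp
    _ ≤ |a * x i| + |b * y i| := abs_add_le _ _
    _ = a * |x i| + b * |y i| := by rw [abs_mul, abs_mul, abs_of_nonneg ha, abs_of_nonneg hb]
    _ ≤ a * (l / 2) + b * (l / 2) := by gcongr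
    _ = l / 2 := by rw [← add_mul, hab, one_mul]

theorem norm_le_of_forall_abs_le {x : E d} {r : ℝ} (hr : 0 ≤ r) (h : ∀ i, |x i| ≤ r) :
    ‖x‖ ≤ d * r := by
  rw [EuclideanSpace.norm_eq]
  apply Real.sqrt_le_iff.2 ⟨by positivity, ?_⟩
  calc ∑ i, ‖x i‖ ^ 2 ≤ ∑ _i : Fin d, r ^ 2 := by
        gcongr with i; exact h i
    _ = d * r ^ 2 := by simp
    _ ≤ (d * r) ^ 2 := by
        rw [mul_pow]
        gcongr
        have : (d : ℝ) ^ 2 = ((d ^ 2 : ℕ) : ℝ) := by push_cast; ring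
        rw [this]
        exact_mod_cast Nat.le_self_pow (by norm_num) d

theorem norm_le_of_mem_cube {l : ℝ} (hl : 0 ≤ l) {x : E d} (hx : x ∈ cube d l) :
    ‖x‖ ≤ d * (l / 2) := norm_le_of_forall_abs_le (by positivity) hx

theorem abs_apply_le_norm (x : E d) (i : Fin d) : |x i| ≤ ‖x‖ := by
  simpa using PiLp.norm_apply_le x i

theorem isCompact_cube (l : ℝ) : IsCompact (cube d l) := by
  rcases le_or_gt 0 l with hl | hl
  · refine Metric.isCompact_of_isClosed_isBounded (isClosed_cube l) ?_
    exact (Metric.isBounded_closedBall (x := (0 : E d)) (r := d * (l / 2))).subset fun x hx => by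
      simpa using norm_le_of_mem_cube hl hx
  · rcases isEmpty_or_nonempty (Fin d) with h | ⟨⟨i⟩⟩
    · exact (Set.toFinite (cube d l)).isCompact
    · have : cube d l = ∅ := by
        ext x
        simp only [cube, mem_ofPred_eq, mem_empty_iff_false, iff_false]
        intro h
        have := (abs_nonneg _).trans (h i)
        linarith
      simp [this]

theorem volume_cube_lt_top (l : ℝ) : volume (cube d l) < ∞ := (isCompact_cube l).measure_lt_top

theorem cube_ae_eq_interior (l : ℝ) : interior (cube d l) =ᵐ[volume] cube d l :=
  interior_ae_eq_of_null_frontier ((convex_cube l).addHaar_frontier volume)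

theorem isOpen_openCube (l : ℝ) : IsOpen {x : E d | ∀ i, |x i| < l / 2} := by
  have : {x : E d | ∀ i, |x i| < l / 2} = ⋂ i, {x : E d | |x i| < l / 2} := by ext; simp
  rw [this]
  exact isOpen_iInter_of_finite fun i => isOpen_lt (by fun_prop) continuous_const

theorem restrict_interior_cube (l : ℝ) :
    (volume : Measure (E d)).restrict (interior (cube d l)) = cubeMeasure d l :=
  Measure.restrict_congr_set (cube_ae_eq_interior l)

/-! ### Weak derivatives -/

theorem isWeakDeriv_iff {Ω : Set (E d)} {α : Fin d → ℕ} {f g : E d → ℝ} :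
    IsWeakDeriv Ω α f g ↔ LocallyIntegrableOn f Ω volume ∧ LocallyIntegrableOn g Ω volume ∧
      ∀ φ : smoothFn d, HasCompactSupport (φ : E d → ℝ) → tsupport (φ : E d → ℝ) ⊆ Ω →
        ∫ x in Ω, f x * (mderivₗ α φ : E d → ℝ) x
          = (-1) ^ (∑ i, α i) * ∫ x in Ω, g x * (φ : E d → ℝ) x := by
  refine ⟨fun h => ⟨h.1, h.2.1, fun φ hc hs => ?_⟩, fun h => ⟨h.1, h.2.1, fun φ hφ hc hs => ?_⟩⟩
  · rw [coe_mderivₗ]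
    exact h.2.2 φ φ.2 hc hs
  · have := h.2.2 ⟨φ, hφ⟩ hc hs
    rwa [coe_mderivₗ] at this

theorem locallyIntegrableOn_congr_ae {Ω : Set (E d)} {f g : E d → ℝ}
    (hfg : f =ᵐ[volume.restrict Ω] g) (hf : LocallyIntegrableOn f Ω volume) :
    LocallyIntegrableOn g Ω volume := by
  intro x hx
  obtain ⟨t, ht, hI⟩ := hf x hx
  refine ⟨t ∩ Ω, Filter.inter_mem ht self_mem_nhdsWithin, ?_⟩
  exact (hI.mono_set inter_subset_left).congr (ae_mono (Measure.restrict_mono inter_subset_right le_rfl) hfg)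

/-- A compactly supported continuous function times a function that is locally integrable on a
neighbourhood of the support is integrable. -/
theorem integrableOn_mul_of_tsupport_subset {Ω : Set (E d)} {f φ : E d → ℝ}
    (hf : LocallyIntegrableOn f Ω volume) (hφ : Continuous φ) (hc : HasCompactSupport φ)
    (hs : tsupport φ ⊆ Ω) : Integrable (fun x => f x * φ x) volume := by
  have h1 : IntegrableOn f (tsupport φ) volume := hf.integrableOn_compact_subset hs hc
  have h2 : IntegrableOn (fun x => f x * φ x) (tsupport φ) volume :=
    h1.mul_continuousOn hφ.continuousOn hc
  rw [integrableOn_iff_integrable_of_support_subset] at h2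
  · exact h2
  · intro x hx
    apply subset_tsupport φ
    intro h0
    exact hx (by simp [h0])

theorem setIntegral_mul_eq {Ω : Set (E d)} {f φ : E d → ℝ} (hs : tsupport φ ⊆ Ω) :
    ∫ x in Ω, f x * φ x = ∫ x, f x * φ x := by
  apply setIntegral_eq_integral_of_forall_compl_eq_zero
  intro x hx
  rw [image_eq_zero_of_notMem_tsupport fun h => hx (hs h), mul_zero]

theorem IsWeakDeriv.mono {Ω Ω' : Set (E d)} {α : Fin d → ℕ} {f g : E d → ℝ}
    (h : IsWeakDeriv Ω α f g) (hΩ : Ω' ⊆ Ω) : IsWeakDeriv Ω' α f g := by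
  rw [isWeakDeriv_iff] at h ⊢
  refine ⟨h.1.mono_set hΩ, h.2.1.mono_set hΩ, fun φ hc hs => ?_⟩
  have := h.2.2 φ hc (hs.trans hΩ)
  have hs' := (tsupport_mderivₗ_subset α φ).trans hs
  rw [setIntegral_mul_eq hs, setIntegral_mul_eq hs']
  rwa [setIntegral_mul_eq (hs.trans hΩ), setIntegral_mul_eq (hs'.trans hΩ)] at this

theorem isWeakDeriv_zero {Ω : Set (E d)} {f : E d → ℝ} (hf : LocallyIntegrableOn f Ω volume) :
    IsWeakDeriv Ω 0 f f := by
  rw [isWeakDeriv_iff]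
  exact ⟨hf, hf, fun φ _ _ => by simp [mderivₗ_zero]⟩

/-- The fundamental lemma of the calculus of variations, applied to g - g'. Since `weakDeriv` is a
choice, this is what allows explicit derivatives to replace it inside norms. -/
theorem IsWeakDeriv.ae_eq {Ω : Set (E d)} (hΩ : IsOpen Ω) {α : Fin d → ℕ} {f g g' : E d → ℝ}
    (h : IsWeakDeriv Ω α f g) (h' : IsWeakDeriv Ω α f g') : g =ᵐ[volume.restrict Ω] g' := by
  rw [isWeakDeriv_iff] at h h'
  have key := hΩ.ae_eq_zero_of_integral_contDiff_smul_eq_zero (μ := volume)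
    (h.2.1.sub h'.2.1) (fun φ hφ hc hs => ?_)
  · rw [Filter.EventuallyEq, ae_restrict_iff' hΩ.measurableSet]
    filter_upwards [key] with x hx hxΩ
    simpa [sub_eq_zero] using hx hxΩ
  · have e := (h.2.2 ⟨φ, hφ⟩ hc hs).symm.trans (h'.2.2 ⟨φ, hφ⟩ hc hs)
    have e2 := mul_left_cancel₀ (pow_ne_zero _ (by norm_num)) e
    rw [setIntegral_mul_eq hs, setIntegral_mul_eq hs] at e2
    have i1 := integrableOn_mul_of_tsupport_subset h.2.1 hφ.continuous hc hs
    have i2 := integrableOn_mul_of_tsupport_subset h'.2.1 hφ.continuous hc hs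
    simp only [smul_eq_mul, Pi.sub_apply, mul_sub]
    rw [integral_sub (by simpa [mul_comm] using i1) (by simpa [mul_comm] using i2), sub_eq_zero]
    simpa [mul_comm] using e2

theorem IsWeakDeriv.weakDeriv_ae_eq {Ω : Set (E d)} (hΩ : IsOpen Ω) {α : Fin d → ℕ}
    {f g : E d → ℝ} (h : IsWeakDeriv Ω α f g) : weakDeriv Ω α f =ᵐ[volume.restrict Ω] g := by
  have hex : ∃ g, IsWeakDeriv Ω α f g := ⟨g, h⟩
  rw [weakDeriv, dif_pos hex]
  exact hex.choose_spec.ae_eq hΩ h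

theorem isWeakDeriv_weakDeriv {Ω : Set (E d)} {α : Fin d → ℕ} {f : E d → ℝ}
    (h : ∃ g, IsWeakDeriv Ω α f g) : IsWeakDeriv Ω α f (weakDeriv Ω α f) := by
  rw [weakDeriv, dif_pos h]
  exact h.choose_spec

theorem IsWeakDeriv.congr {Ω : Set (E d)} {α : Fin d → ℕ}
    {f f' g g' : E d → ℝ} (h : IsWeakDeriv Ω α f g) (hf : f =ᵐ[volume.restrict Ω] f')
    (hg : g =ᵐ[volume.restrict Ω] g') : IsWeakDeriv Ω α f' g' := by
  rw [isWeakDeriv_iff] at h ⊢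
  refine ⟨locallyIntegrableOn_congr_ae hf h.1, locallyIntegrableOn_congr_ae hg h.2.1,
    fun φ hc hs => ?_⟩
  have e1 := integral_congr_ae (hf.mul (Filter.EventuallyEq.refl _ (mderivₗ α φ : E d → ℝ)))
  have e2 := integral_congr_ae (hg.mul (Filter.EventuallyEq.refl _ (φ : E d → ℝ)))
  simp only [Pi.mul_apply] at e1 e2
  rw [← e1, ← e2]
  exact h.2.2 φ hc hs

theorem IsWeakDeriv.finset_sum {Ω : Set (E d)} {α : Fin d → ℕ} {ι : Type*} (s : Finset ι)
    {f g : ι → E d → ℝ} (h : ∀ j ∈ s, IsWeakDeriv Ω α (f j) (g j)) :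
    IsWeakDeriv Ω α (fun x => ∑ j ∈ s, f j x) (fun x => ∑ j ∈ s, g j x) := by
  classical
  have hl : ∀ u : ι → E d → ℝ, (∀ j ∈ s, LocallyIntegrableOn (u j) Ω volume) →
      LocallyIntegrableOn (fun x => ∑ j ∈ s, u j x) Ω volume := by
    intro u hu
    clear h
    induction s using Finset.induction_on with
    | empty => simpa using (locallyIntegrable_const (0 : ℝ)).locallyIntegrableOn Ω
    | insert j s hj ih =>
      simp only [Finset.sum_insert hj]
      exact (hu j (by simp)).add (ih fun i hi => hu i (by simp [hi]))
  simp only [isWeakDeriv_iff] at h ⊢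
  refine ⟨hl f fun j hj => (h j hj).1, hl g fun j hj => (h j hj).2.1, fun φ hc hs => ?_⟩
  have hs' := (tsupport_mderivₗ_subset α φ).trans hs
  have hc' : HasCompactSupport (mderivₗ α φ : E d → ℝ) :=
    hc.of_isClosed_subset (isClosed_tsupport _) (tsupport_mderivₗ_subset α φ)
  simp only [Finset.sum_mul]
  rw [integral_finsetSum, integral_finsetSum, Finset.mul_sum]
  · exact Finset.sum_congr rfl fun j hj => (h j hj).2.2 φ hc hs
  · exact fun j hj => (integrableOn_mul_of_tsupport_subset (h j hj).2.1 (smoothFn_continuous φ)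
      hc hs).integrableOn
  · exact fun j hj => (integrableOn_mul_of_tsupport_subset (h j hj).1
      (smoothFn_continuous _) hc' hs').integrableOn

theorem locallyIntegrable_comp_add_right {f : E d → ℝ} (hf : LocallyIntegrable f volume)
    (z : E d) : LocallyIntegrable (fun x => f (x + z)) volume := by
  rw [locallyIntegrable_iff] at hf ⊢
  intro K hK
  have hK' : IsCompact ((fun x => x + z) '' K) := hK.image (by fun_prop)
  have h1 := (measurePreserving_add_right (volume : Measure (E d)) z).integrableOn_comp_preimage
    (Homeomorph.addRight z).measurableEmbedding (f := f) (s := (fun x => x + z) '' K)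
  have h2 := h1.2 (hf _ hK')
  rwa [preimage_image_eq _ (add_left_injective z)] at h2

theorem IsWeakDeriv.translate {α : Fin d → ℕ} {f g : E d → ℝ} (h : IsWeakDeriv univ α f g)
    (z : E d) : IsWeakDeriv univ α (fun x => f (x + z)) (fun x => g (x + z)) := by
  simp only [isWeakDeriv_iff, locallyIntegrableOn_univ, Measure.restrict_univ] at h ⊢
  refine ⟨locallyIntegrable_comp_add_right h.1 z, locallyIntegrable_comp_add_right h.2.1 z,
    fun φ hc _ => ?_⟩
  have := h.2.2 (translateSmooth (-z) φ) (hasCompactSupport_translate _ hc) (subset_univ _)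
  rw [mderivₗ_translate] at this
  rw [← integral_add_right_eq_self _ z, ← integral_add_right_eq_self (fun x => g x * _) z] at this
  simpa using this

theorem locallyIntegrable_mul_smooth {f : E d → ℝ} (hf : LocallyIntegrable f volume)
    {c : E d → ℝ} (hc : Continuous c) : LocallyIntegrable (fun x => c x * f x) volume := by
  rw [locallyIntegrable_iff] at hf ⊢
  intro K hK
  exact (hf K hK).continuousOn_mul hc.continuousOn hK

/-- The Leibniz rule for weak derivatives. -/
theorem exists_isWeakDeriv_mul (χ : smoothFn d) (α : Fin d → ℕ) :
    ∃ (ι : Type) (_ : Fintype ι) (β : ι → Fin d → ℕ) (c : ι → smoothFn d),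
      (∀ j, ∑ i, β j i ≤ ∑ i, α i) ∧ (∀ j, tsupport (c j : E d → ℝ) ⊆ tsupport (χ : E d → ℝ)) ∧
      ∀ (h : E d → ℝ) (v : (Fin d → ℕ) → E d → ℝ),
        (∀ β : Fin d → ℕ, ∑ i, β i ≤ ∑ i, α i → IsWeakDeriv univ β h (v β)) →
        IsWeakDeriv univ α (fun x => (χ : E d → ℝ) x * h x)
          (fun x => ∑ j, (c j : E d → ℝ) x * v (β j) x) := by
  obtain ⟨ι, _, β, c, hβ, hc, hχ⟩ := exists_mul_mderivₗ_eq_sum χ α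
  -- Integration by parts produces (-1)^{|β j|} in each term, whereas the definition asks for
  -- (-1)^{|α|}; the quotient of the two signs goes into the coefficient.
  let ε : ι → ℝ := fun j => (-1) ^ (∑ i, α i) * (-1) ^ (∑ i, β j i)
  refine ⟨ι, inferInstance, β, fun j => ε j • c j, hβ, fun j => ?_, fun h v hv => ?_⟩
  · refine Subset.trans (closure_mono ?_) (hc j)
    intro x hx hx0
    exact hx (by simp [hx0])
  simp only [isWeakDeriv_iff, locallyIntegrableOn_univ, Measure.restrict_univ] at hv ⊢
  have hh : LocallyIntegrable h volume := (hv α le_rfl).1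
  refine ⟨locallyIntegrable_mul_smooth hh (smoothFn_continuous χ), ?_, fun φ hφ _ => ?_⟩
  · have : ∀ j ∈ Finset.univ, LocallyIntegrable
        (fun x => ((ε j • c j : smoothFn d) : E d → ℝ) x * v (β j) x) volume := fun j _ =>
      locallyIntegrable_mul_smooth (hv (β j) (hβ j)).2.1 (smoothFn_continuous _)
    exact locallyIntegrable_finsetSum _ this
  have hint : ∀ j, Integrable (fun x => v (β j) x * ((c j * φ : smoothFn d) : E d → ℝ) x) := by
    intro j
    have hcs : HasCompactSupport ((c j * φ : smoothFn d) : E d → ℝ) := hφ.mul_left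
    exact integrableOn_mul_of_tsupport_subset (locallyIntegrableOn_univ.2 (hv (β j) (hβ j)).2.1)
      (smoothFn_continuous _) hcs (subset_univ _)
  have hsum : ∀ x, (χ : E d → ℝ) x * (mderivₗ α φ : E d → ℝ) x
      = ∑ j, (mderivₗ (β j) (c j * φ) : E d → ℝ) x := by
    intro x
    have := congrFun (congrArg Subtype.val (hχ φ)) x
    simpa using this
  calc ∫ x, (χ : E d → ℝ) x * h x * (mderivₗ α φ : E d → ℝ) x
      = ∫ x, ∑ j, h x * (mderivₗ (β j) (c j * φ) : E d → ℝ) x := by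
        congr 1
        ext x
        rw [← Finset.mul_sum, ← hsum]
        ring
    _ = ∑ j, ∫ x, h x * (mderivₗ (β j) (c j * φ) : E d → ℝ) x := by
        refine integral_finsetSum _ fun j _ => ?_
        have hcs : HasCompactSupport ((c j * φ : smoothFn d) : E d → ℝ) := hφ.mul_left
        exact integrableOn_mul_of_tsupport_subset (locallyIntegrableOn_univ.2 hh)
          (smoothFn_continuous _) (hcs.of_isClosed_subset (isClosed_tsupport _)
            (tsupport_mderivₗ_subset _ _)) (subset_univ _)
    _ = ∑ j, (-1) ^ (∑ i, β j i) * ∫ x, v (β j) x * ((c j * φ : smoothFn d) : E d → ℝ) x := by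
        refine Finset.sum_congr rfl fun j _ => ?_
        have hcs : HasCompactSupport ((c j * φ : smoothFn d) : E d → ℝ) := hφ.mul_left
        exact (hv (β j) (hβ j)).2.2 (c j * φ) hcs (subset_univ _)
    _ = (-1) ^ (∑ i, α i) * ∑ j, ε j * ∫ x, v (β j) x * ((c j * φ : smoothFn d) : E d → ℝ) x := by
        rw [Finset.mul_sum]
        refine Finset.sum_congr rfl fun j _ => ?_
        have : ((-1 : ℝ) ^ (∑ i, α i)) * (-1) ^ (∑ i, α i) = 1 := by
          rw [← mul_pow]; norm_num
        simp only [ε]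
        linear_combination (-(-1 : ℝ) ^ (∑ i, β j i) *
          ∫ x, v (β j) x * ((c j * φ : smoothFn d) : E d → ℝ) x) * this
    _ = _ := by
        simp only [← integral_const_mul]
        rw [← integral_finsetSum _ fun j _ => (hint j).const_mul _]
        simp only [integral_const_mul]
        congr 2
        ext x
        rw [Finset.sum_mul]
        refine Finset.sum_congr rfl fun j _ => ?_
        simp only [MulMemClass.coe_mul, Pi.mul_apply, SetLike.val_smul, Pi.smul_apply, smul_eq_mul]
        ring

/-- Testing v against ∂ᵢφ and w against φ both lead to the integral of f D^{β+eᵢ}φ, with signs that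
differ by one factor -1. So consecutive members of a family of derivatives of f are first
derivatives of each other. -/
theorem IsWeakDeriv.integral_mul_pderivₗ {f v w : E d → ℝ} {β : Fin d → ℕ} {i : Fin d}
    (hv : IsWeakDeriv univ β f v) (hw : IsWeakDeriv univ (β + Pi.single i 1) f w)
    {φ : smoothFn d} (hφ : HasCompactSupport (φ : E d → ℝ)) :
    ∫ x, v x * (pderivₗ i φ : E d → ℝ) x = -∫ x, w x * (φ : E d → ℝ) x := by
  simp only [isWeakDeriv_iff, Measure.restrict_univ] at hv hw
  have h1 := hv.2.2 (pderivₗ i φ) (hφ.of_isClosed_subset (isClosed_tsupport _)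
    (tsupport_pderivₗ_subset i φ)) (subset_univ _)
  have h2 := hw.2.2 φ hφ (subset_univ _)
  rw [mderivₗ_add_single, sum_add_single, Module.End.mul_apply] at h2
  have h3 := h1.symm.trans h2
  rw [pow_succ, mul_assoc] at h3
  have := mul_left_cancel₀ (pow_ne_zero _ (by norm_num)) h3
  simpa using this

/-! ### Increments of weakly differentiable functions -/

/-- Lebesgue measure on `(0, 1]`. -/
abbrev unitIocMeasure : Measure ℝ := volume.restrict (Ioc (0 : ℝ) 1)

/-- A Fubini hypothesis: the integrand lives on a ball in y, where v is integrable, and the measure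
in t is finite. -/
theorem integrable_mul_of_bounded_of_ball {v : E d → ℝ} (hv : LocallyIntegrable v volume)
    {G : E d × ℝ → ℝ} (hG : Measurable G) (hvm : Measurable v) {M R : ℝ} (hM : ∀ z, |G z| ≤ M)
    (hR : ∀ y : E d, ∀ t ∈ Ioc (0 : ℝ) 1, R < ‖y‖ → G (y, t) = 0) :
    Integrable (fun z : E d × ℝ => v z.1 * G z) (volume.prod unitIocMeasure) := by
  have h1 : Integrable ((Metric.closedBall (0 : E d) R).indicator fun y => |v y| * M) volume := by
    rw [integrable_indicator_iff measurableSet_closedBall]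
    exact ((hv.integrableOn_isCompact (isCompact_closedBall _ _)).abs).mul_const M
  have h2 := h1.comp_fst unitIocMeasure
  refine h2.mono' ((hvm.comp measurable_fst).mul hG).aestronglyMeasurable ?_
  have h3 : ∀ᵐ z ∂((volume : Measure (E d)).prod unitIocMeasure), z.2 ∈ Ioc (0 : ℝ) 1 := by
    have : ∀ᵐ t ∂unitIocMeasure, t ∈ Ioc (0 : ℝ) 1 := ae_restrict_mem measurableSet_Ioc
    exact Measure.quasiMeasurePreserving_snd.ae this
  filter_upwards [h3] with z hz
  by_cases hzR : R < ‖z.1‖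
  · have : G z = 0 := hR z.1 z.2 hz hzR
    simp [this, indicator, not_le.2 hzR]
  · rw [indicator_of_mem (by simpa using hzR), norm_mul, Real.norm_eq_abs, Real.norm_eq_abs]
    exact mul_le_mul_of_nonneg_left (hM z) (abs_nonneg _)

theorem lt_norm_sub_smul {R t : ℝ} {y h : E d} (ht : t ∈ Ioc (0 : ℝ) 1) (hy : R + ‖h‖ < ‖y‖) :
    R < ‖y - t • h‖ := by
  have h1 : ‖t • h‖ ≤ ‖h‖ := by
    rw [norm_smul, Real.norm_eq_abs, abs_of_pos ht.1]
    exact mul_le_of_le_one_left (norm_nonneg _) ht.2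
  have h2 := norm_sub_norm_le y (t • h)
  linarith

/-- For fixed t the substitution x ↦ x - t h moves the shift from w to the bounded factor g, whose
shifts by t h all live in the ball of radius R + ‖h‖; this is the situation of
`integrable_mul_of_bounded_of_ball`. -/
theorem integrable_mul_comp_add_smul {w : E d → ℝ} (hw : LocallyIntegrable w volume)
    (hwm : Measurable w) {g : E d → ℝ} (hg : Measurable g) {M R : ℝ} (hM : ∀ x, |g x| ≤ M)
    (hR : ∀ x, R < ‖x‖ → g x = 0) (h : E d) :
    Integrable (fun z : E d × ℝ => g z.1 * w (z.1 + z.2 • h)) (volume.prod unitIocMeasure) := by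
  have hB' : Integrable (fun z : E d × ℝ => w z.1 * g (z.1 - z.2 • h))
      (volume.prod unitIocMeasure) :=
    integrable_mul_of_bounded_of_ball (G := fun z => g (z.1 - z.2 • h)) hw
      (hg.comp (by fun_prop)) hwm (M := M) (R := R + ‖h‖)
      (fun z => hM _) (fun y t ht hy => hR _ (lt_norm_sub_smul ht hy))
  have hm : Measurable (fun z : E d × ℝ => g z.1 * w (z.1 + z.2 • h)) :=
    (hg.comp measurable_fst).mul (hwm.comp (by fun_prop))
  rw [integrable_prod_iff' hB'.aestronglyMeasurable] at hB'
  rw [integrable_prod_iff' hm.aestronglyMeasurable]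
  constructor
  · filter_upwards [hB'.1] with t ht
    have := ht.comp_add_right (t • h)
    simpa [mul_comm] using this
  · refine hB'.2.congr (Filter.Eventually.of_forall fun t => ?_)
    simp only
    rw [← integral_add_right_eq_self (fun x => ‖w x * g (x - t • h)‖) (t • h)]
    simp [mul_comm]

/-- A weakly differentiable function is the integral of its derivative along segments. -/
theorem ae_increment_eq {v w : E d → ℝ} (hv : LocallyIntegrable v volume)
    (hw : LocallyIntegrable w volume) (hvm : Measurable v) (hwm : Measurable w) (h : E d)
    (hvw : ∀ φ : smoothFn d, HasCompactSupport (φ : E d → ℝ) →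
      ∫ x, v x * fderiv ℝ (φ : E d → ℝ) x h = -∫ x, w x * (φ : E d → ℝ) x) :
    ∀ᵐ x ∂(volume : Measure (E d)), v (x + h) - v x = ∫ t in Ioc (0 : ℝ) 1, w (x + t • h) := by
  refine ae_eq_of_integral_contDiff_smul_eq
    ((locallyIntegrable_comp_add_right hv h).sub hv) ?_ ?_
  · rw [locallyIntegrable_iff]
    intro K hK
    obtain ⟨R, hR⟩ := hK.isBounded.exists_norm_le
    have := (integrable_mul_comp_add_smul hw hwm (g := K.indicator 1) (M := 1) (R := R)
      (measurable_one.indicator hK.measurableSet) (fun x => ?_) (fun x hx => ?_) h).integral_prod_left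
    · rw [← integrable_indicator_iff hK.measurableSet]
      refine this.congr (Filter.Eventually.of_forall fun x => ?_)
      by_cases hx : x ∈ K <;> simp [hx]
    · by_cases hx : x ∈ K <;> simp [hx]
    · exact indicator_of_notMem (fun hxK => absurd (hR x hxK) (not_le.2 hx)) _
  · intro g hg hgc
    obtain ⟨R, hR⟩ := (show IsCompact (tsupport g) from hgc).isBounded.exists_norm_le
    have hgR : ∀ x, R < ‖x‖ → g x = 0 := fun x hx =>
      image_eq_zero_of_notMem_tsupport fun hxK => absurd (hR x hxK) (not_le.2 hx)
    have hg'R : ∀ x, R < ‖x‖ → fderiv ℝ g x h = 0 := fun x hx => by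
      have : fderiv ℝ g x = 0 := by
        by_contra h0
        exact absurd (hR x (support_fderiv_subset ℝ h0)) (not_le.2 hx)
      simp [this]
    have hg'c : Continuous (fun x => fderiv ℝ g x h) :=
      (hg.continuous_fderiv (by simp)).clm_apply continuous_const
    obtain ⟨M, hM⟩ := hgc.exists_bound_of_continuous hg.continuous
    obtain ⟨M', hM'⟩ := (hgc.fderiv_apply (𝕜 := ℝ) h).exists_bound_of_continuous hg'c
    have hgi : ∀ {u : E d → ℝ}, LocallyIntegrable u volume → ∀ z : E d,
        Integrable fun x => u x * g (x - z) := by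
      intro u hu z
      have := integrableOn_mul_of_tsupport_subset (locallyIntegrableOn_univ.2 hu)
        (φ := fun x => g (x - z)) (hg.continuous.comp (by fun_prop))
        (hgc.comp_homeomorph (Homeomorph.subRight z)) (subset_univ _)
      exact this
    have hftc : ∀ y, g (y - h) - g y = ∫ t in Ioc (0 : ℝ) 1, -(fderiv ℝ g (y - t • h) h) := by
      intro y
      have hd : ∀ t ∈ uIcc (0 : ℝ) 1, HasDerivAt (fun t : ℝ => g (y - t • h))
          (-(fderiv ℝ g (y - t • h) h)) t := by
        intro t _
        have h1 : HasDerivAt (fun t : ℝ => y - t • h) (-h) t := by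
          simpa using ((hasDerivAt_id t).smul_const h).const_sub y
        have h2 := ((hg.differentiable (by simp)) (y - t • h)).hasFDerivAt.comp_hasDerivAt t h1
        rw [map_neg] at h2
        exact h2
      have hcont : Continuous fun t : ℝ => -(fderiv ℝ g (y - t • h) h) :=
        (hg'c.comp (by fun_prop)).neg
      have := intervalIntegral.integral_eq_sub_of_hasDerivAt hd (hcont.intervalIntegrable _ _)
      rw [intervalIntegral.integral_of_le zero_le_one] at this
      simpa using this.symm
    -- Duality: the increment is moved onto the test function, the classical fundamental theorem is
    -- applied to g along the segment, the integrals are exchanged, the weak derivative is used for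
    -- each t, and the shift is undone.
    calc ∫ x, g x • (v (x + h) - v x)
        = (∫ x, g x * v (x + h)) - ∫ x, g x * v x := by
          simp only [smul_eq_mul, mul_sub]
          refine integral_sub ?_ ?_
          · have := (hgi hv h).comp_add_right h
            simpa [mul_comm] using this
          · simpa [mul_comm] using hgi hv 0
      _ = (∫ y, v y * g (y - h)) - ∫ y, v y * g y := by
          rw [← integral_add_right_eq_self (fun y => v y * g (y - h)) h]
          simp [mul_comm]
      _ = ∫ y, v y * (g (y - h) - g y) := by
          simp only [mul_sub]
          exact (integral_sub (hgi hv h) (by simpa using hgi hv 0)).symm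
      _ = ∫ y, ∫ t in Ioc (0 : ℝ) 1, v y * (-(fderiv ℝ g (y - t • h) h)) := by
          congr 1
          ext y
          rw [hftc, integral_const_mul]
      _ = ∫ t in Ioc (0 : ℝ) 1, ∫ y, v y * (-(fderiv ℝ g (y - t • h) h)) := by
          refine integral_integral_swap (f := fun y t => v y * (-(fderiv ℝ g (y - t • h) h))) ?_
          exact integrable_mul_of_bounded_of_ball
            (G := fun z => -(fderiv ℝ g (z.1 - z.2 • h) h)) hv
            ((hg'c.comp (by fun_prop)).measurable.neg) hvm (M := M') (R := R + ‖h‖)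
            (fun z => by simpa using hM' _)
            (fun y t ht hy => by simp [hg'R _ (lt_norm_sub_smul ht hy)])
      _ = ∫ t in Ioc (0 : ℝ) 1, ∫ x, g x * w (x + t • h) := by
          congr 1
          ext t
          have h1 := hvw (translateSmooth (-(t • h)) ⟨g, hg⟩) (hasCompactSupport_translate _ hgc)
          have h2 : ∀ y, fderiv ℝ (translateSmooth (-(t • h)) ⟨g, hg⟩ : E d → ℝ) y h
              = fderiv ℝ g (y - t • h) h := by
            intro y
            have := fderiv_comp_add_right (𝕜 := ℝ) (f := g) (x := y) (-(t • h))
            rw [sub_eq_add_neg, ← this]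
            rfl
          simp only [h2] at h1
          simp only [mul_neg, integral_neg, h1, neg_neg, translateSmooth_apply]
          rw [← integral_add_right_eq_self (fun y => w y * g (y + -(t • h))) (t • h)]
          simp [mul_comm]
      _ = ∫ x, ∫ t in Ioc (0 : ℝ) 1, g x * w (x + t • h) := by
          refine (integral_integral_swap (f := fun x t => g x * w (x + t • h)) ?_).symm
          exact integrable_mul_comp_add_smul hw hwm hg.continuous.measurable hM hgR h
      _ = ∫ x, g x • ∫ t in Ioc (0 : ℝ) 1, w (x + t • h) := by
          simp only [integral_const_mul, smul_eq_mul]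

/-! ### The Gagliardo energy -/

/-- The `p`-energy `∫_Q |v|^p`. -/
def lpEnergy (Q : Set (E d)) (p : ℝ) (v : E d → ℝ) : ℝ≥0∞ := ∫⁻ x in Q, ‖v x‖ₑ ^ p

/-- The Gagliardo energy `∫_Q ∫_Q |v(x) - v(y)|^p |x - y|^{-(d + σ)} dx dy`. -/
def gagliardo (Q : Set (E d)) (σ p : ℝ) (v : E d → ℝ) : ℝ≥0∞ :=
  ∫⁻ y in Q, ∫⁻ x in Q, ‖v x - v y‖ₑ ^ p * gagliardoKernel d σ x y

theorem measurable_gagliardo_integrand {v : E d → ℝ} (hv : Measurable v) {σ p : ℝ} :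
    Measurable fun z : E d × E d => ‖v z.2 - v z.1‖ₑ ^ p * gagliardoKernel d σ z.2 z.1 := by
  have h1 : Measurable fun z : E d × E d => v z.2 - v z.1 :=
    (hv.comp measurable_snd).sub (hv.comp measurable_fst)
  have h2 : Measurable fun z : E d × E d => gagliardoKernel d σ z.2 z.1 := by
    unfold gagliardoKernel
    fun_prop
  exact (h1.enorm.pow_const p).mul h2

theorem lpEnergy_congr {Q : Set (E d)} {p : ℝ} {v v' : E d → ℝ}
    (h : v =ᵐ[volume.restrict Q] v') : lpEnergy Q p v = lpEnergy Q p v' := by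
  refine lintegral_congr_ae ?_
  filter_upwards [h] with x hx
  rw [hx]

theorem gagliardo_congr {Q : Set (E d)} {σ p : ℝ} {v v' : E d → ℝ}
    (h : v =ᵐ[volume.restrict Q] v') : gagliardo Q σ p v = gagliardo Q σ p v' := by
  refine lintegral_congr_ae ?_
  filter_upwards [h] with y hy
  refine lintegral_congr_ae ?_
  filter_upwards [h] with x hx
  rw [hx, hy]

theorem rpow_enorm_sum_le {ι : Type*} (s : Finset ι) (f : ι → ℝ) {p : ℝ} (hp : 1 ≤ p) :
    ‖∑ i ∈ s, f i‖ₑ ^ p ≤ (s.card : ℝ≥0∞) ^ (p - 1) * ∑ i ∈ s, ‖f i‖ₑ ^ p :=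
  (ENNReal.rpow_le_rpow (enorm_sum_le _ _) (by linarith)).trans
    (ENNReal.rpow_sum_le_const_mul_sum_rpow s _ hp)

theorem lpEnergy_sum_le {ι : Type*} (s : Finset ι) (Q : Set (E d)) {p : ℝ} (hp : 1 ≤ p)
    {v : ι → E d → ℝ} (hv : ∀ i ∈ s, Measurable (v i)) :
    lpEnergy Q p (fun x => ∑ i ∈ s, v i x)
      ≤ (s.card : ℝ≥0∞) ^ (p - 1) * ∑ i ∈ s, lpEnergy Q p (v i) := by
  unfold lpEnergy
  rw [← lintegral_finsetSum' _ fun i hi => ((hv i hi).enorm.pow_const p).aemeasurable,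
    ← lintegral_const_mul' _ _ (by finiteness)]
  exact lintegral_mono fun x => rpow_enorm_sum_le s _ hp

theorem gagliardo_sum_le {ι : Type*} (s : Finset ι) (Q : Set (E d)) {σ p : ℝ} (hp : 1 ≤ p)
    {v : ι → E d → ℝ} (hv : ∀ i ∈ s, Measurable (v i)) :
    gagliardo Q σ p (fun x => ∑ i ∈ s, v i x)
      ≤ (s.card : ℝ≥0∞) ^ (p - 1) * ∑ i ∈ s, gagliardo Q σ p (v i) := by
  have hm : ∀ i ∈ s, Measurable fun z : E d × E d =>
      ‖v i z.2 - v i z.1‖ₑ ^ p * gagliardoKernel d σ z.2 z.1 := fun i hi =>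
    measurable_gagliardo_integrand (hv i hi)
  have hN : (s.card : ℝ≥0∞) ^ (p - 1) ≠ ∞ :=
    ENNReal.rpow_ne_top_of_nonneg (by linarith) (ENNReal.natCast_ne_top _)
  have hinner : ∀ y, ∫⁻ x in Q, ‖∑ i ∈ s, v i x - ∑ i ∈ s, v i y‖ₑ ^ p * gagliardoKernel d σ x y
      ≤ (s.card : ℝ≥0∞) ^ (p - 1) *
        ∑ i ∈ s, ∫⁻ x in Q, ‖v i x - v i y‖ₑ ^ p * gagliardoKernel d σ x y := by
    intro y
    have hmy : ∀ i ∈ s, AEMeasurable (fun x => ‖v i x - v i y‖ₑ ^ p * gagliardoKernel d σ x y)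
        (volume.restrict Q) := fun i hi =>
      ((hm i hi).comp (measurable_const (a := y).prodMk measurable_id)).aemeasurable
    rw [← lintegral_finsetSum' s hmy, ← lintegral_const_mul' _ _ hN]
    refine lintegral_mono fun x => ?_
    rw [← Finset.sum_mul, ← mul_assoc, ← Finset.sum_sub_distrib]
    exact mul_le_mul_left (rpow_enorm_sum_le s _ hp) _
  have hmo : ∀ i ∈ s, AEMeasurable (fun y => ∫⁻ x in Q, ‖v i x - v i y‖ₑ ^ p *
      gagliardoKernel d σ x y) (volume.restrict Q) := fun i hi =>
    ((hm i hi).lintegral_prod_right').aemeasurable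
  refine (lintegral_mono hinner).trans (le_of_eq ?_)
  rw [lintegral_const_mul' _ _ hN, lintegral_finsetSum' s hmo]
  rfl

/-- The integral of `|h|^p |h|^{-(d + σ)}` over a ball is finite for `σ < p`. -/
theorem lintegral_ball_rpow_lt_top (hd : 1 ≤ d) {σ p : ℝ} (hp : 0 < p) (hσ : σ < p) (R : ℝ) :
    ∫⁻ h in Metric.ball (0 : E d) R, ENNReal.ofReal (‖h‖ ^ p) *
      ENNReal.ofReal (‖h‖ ^ (-((d : ℝ) + σ))) < ∞ := by
  have : Nonempty (Fin d) := ⟨⟨0, hd⟩⟩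
  rcases le_or_gt R 0 with hR | hR
  · simp [Metric.ball_eq_empty.2 hR]
  have h1 : IntegrableOn (fun x : E d => ‖x‖ ^ (p - d - σ)) (Metric.ball 0 R) volume := by
    rw [integrableOn_fun_norm_addHaar volume (f := fun y : ℝ => y ^ (p - d - σ))]
    have h2 : IntegrableOn (fun y : ℝ => y ^ (p - 1 - σ)) (Ioo 0 R) :=
      (intervalIntegral.integrableOn_Ioo_rpow_iff hR).2 (by linarith)
    refine h2.congr_fun (fun y hy => ?_) measurableSet_Ioo
    simp only [finrank_euclideanSpace, Fintype.card_fin, smul_eq_mul]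
    rw [← Real.rpow_natCast, ← Real.rpow_add hy.1]
    congr 1
    push_cast [hd]
    ring
  have h3 := h1.lintegral_lt_top
  refine lt_of_le_of_lt (lintegral_mono fun x => ?_) h3
  rw [← ENNReal.ofReal_mul (by positivity)]
  apply ENNReal.ofReal_le_ofReal
  rcases (norm_nonneg x).eq_or_lt with hx | hx
  · rw [← hx, Real.zero_rpow hp.ne', zero_mul]
    positivity
  · rw [← Real.rpow_add hx]
    apply le_of_eq
    congr 1
    ring

theorem setLIntegral_comp_add_le {Q Q' : Set (E d)} (hQ : MeasurableSet Q)
    (hQ' : MeasurableSet Q') {z : E d} (h : ∀ x ∈ Q, x + z ∈ Q') (F : E d → ℝ≥0∞) :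
    ∫⁻ x in Q, F (x + z) ≤ ∫⁻ x in Q', F x := by
  rw [← lintegral_indicator hQ, ← lintegral_indicator hQ',
    ← lintegral_add_right_eq_self (fun x => Q'.indicator F x) z]
  refine lintegral_mono fun x => ?_
  by_cases hx : x ∈ Q
  · rw [indicator_of_mem hx, indicator_of_mem (h x hx)]
  · simp [indicator_of_notMem hx]

theorem lintegral_comp_sub_le {Q : Set (E d)} (hQ : MeasurableSet Q) {D : ℝ} {y : E d}
    (hD : ∀ x ∈ Q, ‖x - y‖ < D) (F : E d → ℝ≥0∞) :
    ∫⁻ x in Q, F (x - y) ≤ ∫⁻ h in Metric.ball (0 : E d) D, F h := by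
  simpa only [sub_eq_add_neg] using setLIntegral_comp_add_le hQ measurableSet_ball (z := -y)
    (fun x hx => by simpa [← sub_eq_add_neg] using hD x hx) F

theorem lpEnergy_translate_le {Q Q' : Set (E d)} (hQ : MeasurableSet Q)
    (hQ' : MeasurableSet Q') {z : E d} (h : ∀ x ∈ Q, x + z ∈ Q') (p : ℝ) (v : E d → ℝ) :
    lpEnergy Q p (fun x => v (x + z)) ≤ lpEnergy Q' p v :=
  setLIntegral_comp_add_le hQ hQ' h fun x => ‖v x‖ₑ ^ p

theorem gagliardo_translate_le {Q Q' : Set (E d)} (hQ : MeasurableSet Q)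
    (hQ' : MeasurableSet Q') {z : E d} (h : ∀ x ∈ Q, x + z ∈ Q') (σ p : ℝ) (v : E d → ℝ) :
    gagliardo Q σ p (fun x => v (x + z)) ≤ gagliardo Q' σ p v := by
  refine le_trans (lintegral_mono fun y => ?_) (setLIntegral_comp_add_le hQ hQ' h
    fun y => ∫⁻ x in Q', ‖v x - v y‖ₑ ^ p * gagliardoKernel d σ x y)
  have := setLIntegral_comp_add_le hQ hQ' h
    fun x => ‖v x - v (y + z)‖ₑ ^ p * gagliardoKernel d σ x (y + z)
  simpa [gagliardoKernel] using this

/-- Multiplication by a bounded Lipschitz function. -/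
theorem gagliardo_mul_le {σ p : ℝ} (hp : 1 ≤ p) {Q : Set (E d)}
    (hQ : MeasurableSet Q) {D : ℝ} (hD : ∀ y ∈ Q, ∀ x ∈ Q, ‖x - y‖ < D) {c : E d → ℝ}
    {M : ℝ} (hM : ∀ x, |c x| ≤ M) (hL : ∀ x y, |c x - c y| ≤ M * ‖x - y‖)
    {v : E d → ℝ} (hv : Measurable v) :
    gagliardo Q σ p (fun x => c x * v x) ≤ 2 ^ (p - 1) * ENNReal.ofReal M ^ p *
      (gagliardo Q σ p v + (∫⁻ h in Metric.ball (0 : E d) D, ENNReal.ofReal (‖h‖ ^ p) *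
        ENNReal.ofReal (‖h‖ ^ (-((d : ℝ) + σ)))) * lpEnergy Q p v) := by
  have hM0 : 0 ≤ M := (abs_nonneg _).trans (hM 0)
  set K := ∫⁻ h in Metric.ball (0 : E d) D, ENNReal.ofReal (‖h‖ ^ p) *
        ENNReal.ofReal (‖h‖ ^ (-((d : ℝ) + σ))) with hK
  -- The Lipschitz bound supplies the factor |x-y|^p that tames the kernel: after integration in x,
  -- the term with v y costs only the ball integral K times the L_p energy.
  have hpt : ∀ x y, ‖c x * v x - c y * v y‖ₑ ^ p ≤ 2 ^ (p - 1) * ENNReal.ofReal M ^ p *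
      (‖v x - v y‖ₑ ^ p + ENNReal.ofReal (‖x - y‖ ^ p) * ‖v y‖ₑ ^ p) := by
    intro x y
    have e : c x * v x - c y * v y = c x * (v x - v y) + (c x - c y) * v y := by ring
    have h1 : ‖c x‖ₑ ≤ ENNReal.ofReal M := by
      rw [Real.enorm_eq_ofReal_abs]; exact ENNReal.ofReal_le_ofReal (hM x)
    have h2 : ‖c x - c y‖ₑ ≤ ENNReal.ofReal M * ENNReal.ofReal ‖x - y‖ := by
      rw [Real.enorm_eq_ofReal_abs, ← ENNReal.ofReal_mul hM0]
      exact ENNReal.ofReal_le_ofReal (hL x y)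
    calc ‖c x * v x - c y * v y‖ₑ ^ p
        ≤ (ENNReal.ofReal M * ‖v x - v y‖ₑ + ENNReal.ofReal M * ENNReal.ofReal ‖x - y‖ * ‖v y‖ₑ) ^ p := by
          refine ENNReal.rpow_le_rpow ?_ (by linarith)
          rw [e]
          refine (enorm_add_le _ _).trans ?_
          rw [enorm_mul, enorm_mul]
          gcongr
      _ ≤ 2 ^ (p - 1) * ((ENNReal.ofReal M * ‖v x - v y‖ₑ) ^ p +
            (ENNReal.ofReal M * ENNReal.ofReal ‖x - y‖ * ‖v y‖ₑ) ^ p) :=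
          ENNReal.rpow_add_le_mul_rpow_add_rpow _ _ hp
      _ = _ := by
          have hp0 : 0 ≤ p := by linarith
          rw [ENNReal.mul_rpow_of_nonneg _ _ hp0, ENNReal.mul_rpow_of_nonneg _ _ hp0,
            ENNReal.mul_rpow_of_nonneg _ _ hp0, ENNReal.ofReal_rpow_of_nonneg (norm_nonneg _) hp0]
          ring
  have hA : (2 : ℝ≥0∞) ^ (p - 1) * ENNReal.ofReal M ^ p ≠ ∞ :=
    ENNReal.mul_ne_top (ENNReal.rpow_ne_top_of_nonneg (by linarith) ENNReal.ofNat_ne_top)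
      (ENNReal.rpow_ne_top_of_nonneg (by linarith) ENNReal.ofReal_ne_top)
  have hm1 := measurable_gagliardo_integrand (d := d) hv (σ := σ) (p := p)
  have hinner : ∀ y ∈ Q, ∫⁻ x in Q, ‖c x * v x - c y * v y‖ₑ ^ p * gagliardoKernel d σ x y
      ≤ 2 ^ (p - 1) * ENNReal.ofReal M ^ p *
        ((∫⁻ x in Q, ‖v x - v y‖ₑ ^ p * gagliardoKernel d σ x y) + K * ‖v y‖ₑ ^ p) := by
    intro y hy
    have hv_ne : ‖v y‖ₑ ^ p ≠ ∞ := ENNReal.rpow_ne_top_of_nonneg (by linarith) enorm_ne_top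
    have hmy : Measurable fun x => ‖v x - v y‖ₑ ^ p * gagliardoKernel d σ x y :=
      hm1.comp (measurable_const (a := y).prodMk measurable_id)
    have hK' : ∫⁻ x in Q, ENNReal.ofReal (‖x - y‖ ^ p) * gagliardoKernel d σ x y ≤ K :=
      lintegral_comp_sub_le hQ (fun x hx => hD y hy x hx)
          (fun h => ENNReal.ofReal (‖h‖ ^ p) * ENNReal.ofReal (‖h‖ ^ (-((d : ℝ) + σ))))
    calc _ ≤ ∫⁻ x in Q, 2 ^ (p - 1) * ENNReal.ofReal M ^ p *
        (‖v x - v y‖ₑ ^ p * gagliardoKernel d σ x y +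
          ENNReal.ofReal (‖x - y‖ ^ p) * gagliardoKernel d σ x y * ‖v y‖ₑ ^ p) := by
          refine lintegral_mono fun x => ?_
          refine (mul_le_mul_left (hpt x y) _).trans (le_of_eq ?_)
          ring
      _ = 2 ^ (p - 1) * ENNReal.ofReal M ^ p *
        ((∫⁻ x in Q, ‖v x - v y‖ₑ ^ p * gagliardoKernel d σ x y) +
          (∫⁻ x in Q, ENNReal.ofReal (‖x - y‖ ^ p) * gagliardoKernel d σ x y) * ‖v y‖ₑ ^ p) := by
          rw [lintegral_const_mul' _ _ hA, lintegral_add_left hmy, lintegral_mul_const' _ _ hv_ne]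
      _ ≤ _ := by gcongr
  have hmo : Measurable fun y => ∫⁻ x in Q, ‖v x - v y‖ₑ ^ p * gagliardoKernel d σ x y :=
    hm1.lintegral_prod_right'
  refine (setLIntegral_mono' hQ hinner).trans (le_of_eq ?_)
  rw [lintegral_const_mul' _ _ hA, lintegral_add_left hmo,
    lintegral_const_mul _ (hv.enorm.pow_const p)]
  rfl

theorem lpEnergy_mul_le {p : ℝ} (hp : 0 ≤ p) {Q : Set (E d)} {c : E d → ℝ}
    {M : ℝ} (hM : ∀ x, |c x| ≤ M) (v : E d → ℝ) :
    lpEnergy Q p (fun x => c x * v x) ≤ ENNReal.ofReal M ^ p * lpEnergy Q p v := by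
  unfold lpEnergy
  rw [← lintegral_const_mul' _ _ (by finiteness)]
  refine lintegral_mono fun x => ?_
  rw [enorm_mul, ENNReal.mul_rpow_of_nonneg _ _ hp, Real.enorm_eq_ofReal_abs (c x)]
  gcongr
  exact hM x

theorem lintegral_unitIoc_rpow_le {p : ℝ} (hp : 1 < p) {F : ℝ → ℝ≥0∞}
    (hF : AEMeasurable F unitIocMeasure) :
    (∫⁻ t, F t ∂unitIocMeasure) ^ p ≤ ∫⁻ t, F t ^ p ∂unitIocMeasure := by
  have h := ENNReal.lintegral_mul_le_Lp_mul_Lq unitIocMeasure (Real.HolderConjugate.conjExponent hp)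
    hF (aemeasurable_const (b := (1 : ℝ≥0∞)))
  have hp0 : 0 < p := by linarith
  simp only [Pi.mul_apply, mul_one, ENNReal.one_rpow, lintegral_const,
    Measure.restrict_apply_univ, Real.volume_Ioc, sub_zero, ENNReal.ofReal_one] at h
  calc _ ≤ ((∫⁻ t, F t ^ p ∂unitIocMeasure) ^ (1 / p)) ^ p :=
        ENNReal.rpow_le_rpow h hp0.le
    _ = _ := by rw [← ENNReal.rpow_mul, one_div_mul_cancel hp0.ne', ENNReal.rpow_one]

/-- On a bounded convex set the Gagliardo energy is controlled by the first derivatives. -/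
theorem gagliardo_le_of_weak_gradient {σ p : ℝ} (hp : 1 < p) {Q : Set (E d)}
    (hQ : MeasurableSet Q) (hQc : Convex ℝ Q) {D : ℝ} (hD : ∀ y ∈ Q, ∀ x ∈ Q, ‖x - y‖ < D)
    {v : E d → ℝ} {w : Fin d → E d → ℝ}
    (hv : LocallyIntegrable v volume) (hw : ∀ i, LocallyIntegrable (w i) volume)
    (hvm : Measurable v) (hwm : ∀ i, Measurable (w i))
    (hvw : ∀ i, ∀ φ : smoothFn d, HasCompactSupport (φ : E d → ℝ) →
      ∫ x, v x * (pderivₗ i φ : E d → ℝ) x = -∫ x, w i x * (φ : E d → ℝ) x) :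
    gagliardo Q σ p v ≤ (∫⁻ h in Metric.ball (0 : E d) D, ENNReal.ofReal (‖h‖ ^ p) *
        ENNReal.ofReal (‖h‖ ^ (-((d : ℝ) + σ)))) * (d : ℝ≥0∞) ^ (p - 1) *
        ∑ i, lpEnergy Q p (w i) := by
  have hp0 : 0 < p := by linarith
  set W : E d → ℝ≥0∞ := fun x => ∑ i, ‖w i x‖ₑ with hWdef
  have hWm : Measurable W := Finset.measurable_sum _ fun i _ => (hwm i).enorm
  -- the pointwise increment bound
  have hinc : ∀ h : E d, ∀ᵐ x ∂(volume : Measure (E d)),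
      ‖v (x + h) - v x‖ₑ ^ p ≤ ENNReal.ofReal (‖h‖ ^ p) *
        ∫⁻ t, W (x + t • h) ^ p ∂unitIocMeasure := by
    intro h
    have hwh : LocallyIntegrable (fun x => ∑ i, h i * w i x) volume :=
      locallyIntegrable_finsetSum (f := fun i x => h i * w i x) _ fun i _ =>
        locallyIntegrable_mul_smooth (hw i) continuous_const
    have hwhm : Measurable (fun x => ∑ i, h i * w i x) :=
      Finset.measurable_sum _ fun i _ => (hwm i).const_mul _
    have hae := ae_increment_eq hv hwh hvm hwhm h (fun φ hφ => ?_)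
    · filter_upwards [hae] with x hx
      rw [hx]
      calc ‖∫ t in Ioc (0 : ℝ) 1, ∑ i, h i * w i (x + t • h)‖ₑ ^ p
          ≤ (∫⁻ t, ENNReal.ofReal ‖h‖ * W (x + t • h) ∂unitIocMeasure) ^ p := by
            refine ENNReal.rpow_le_rpow ?_ hp0.le
            refine (enorm_integral_le_lintegral_enorm _).trans (lintegral_mono fun t => ?_)
            refine (enorm_sum_le _ _).trans ?_
            simp only [hWdef]
            rw [Finset.mul_sum]
            refine Finset.sum_le_sum fun i _ => ?_
            rw [enorm_mul]
            gcongr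
            rw [Real.enorm_eq_ofReal_abs]
            exact ENNReal.ofReal_le_ofReal (abs_apply_le_norm h i)
        _ = ENNReal.ofReal (‖h‖ ^ p) * (∫⁻ t, W (x + t • h) ∂unitIocMeasure) ^ p := by
            rw [lintegral_const_mul' _ _ (by finiteness), ENNReal.mul_rpow_of_nonneg _ _ hp0.le,
              ENNReal.ofReal_rpow_of_nonneg (norm_nonneg _) hp0.le]
        _ ≤ _ := by
            gcongr
            exact lintegral_unitIoc_rpow_le hp (hWm.comp (by fun_prop)).aemeasurable
    · have e1 : ∀ x, fderiv ℝ (φ : E d → ℝ) x h = ∑ i, h i * (pderivₗ i φ : E d → ℝ) x := by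
        intro x
        have : h = ∑ i, h i • unitVec i := by
          ext j
          simp [unitVec, Pi.single_apply]
        conv_lhs => rw [this]
        simp [partialDeriv]
      have hi1 : ∀ {u ψ : E d → ℝ}, LocallyIntegrable u volume → Continuous ψ →
          HasCompactSupport ψ → Integrable fun x => u x * ψ x := fun hu h1 h2 =>
        integrableOn_mul_of_tsupport_subset (locallyIntegrableOn_univ.2 hu) h1 h2 (subset_univ _)
      have hcs : ∀ i, HasCompactSupport (pderivₗ i φ : E d → ℝ) := fun i =>
        hφ.of_isClosed_subset (isClosed_tsupport _) (tsupport_pderivₗ_subset i φ)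
      calc ∫ x, v x * fderiv ℝ (φ : E d → ℝ) x h
          = ∫ x, ∑ i, h i * (v x * (pderivₗ i φ : E d → ℝ) x) := by
            congr 1
            ext x
            rw [e1, Finset.mul_sum]
            exact Finset.sum_congr rfl fun i _ => by ring
        _ = ∑ i, h i * ∫ x, v x * (pderivₗ i φ : E d → ℝ) x := by
            rw [integral_finsetSum _ fun i _ =>
              (hi1 hv (smoothFn_continuous _) (hcs i)).const_mul _]
            simp only [integral_const_mul]
        _ = -∑ i, h i * ∫ x, w i x * (φ : E d → ℝ) x := by
            simp only [hvw _ φ hφ, mul_neg, Finset.sum_neg_distrib]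
        _ = _ := by
            simp only [← integral_const_mul]
            rw [← integral_finsetSum _ fun i _ =>
              (hi1 (hw i) (smoothFn_continuous φ) hφ).const_mul _]
            congr 2
            ext x
            rw [Finset.sum_mul]
            exact Finset.sum_congr rfl fun i _ => by ring
  set κ : E d → ℝ≥0∞ := fun h => ENNReal.ofReal (‖h‖ ^ (-((d : ℝ) + σ))) with hκ
  have hκm : Measurable κ := by simp only [hκ]; fun_prop
  -- change of variables
  have hfirst : gagliardo Q σ p v = ∫⁻ h in Metric.ball (0 : E d) D, κ h *
      ∫⁻ y, Q.indicator (fun _ => Q.indicator (fun _ => ‖v (y + h) - v y‖ₑ ^ p) (y + h)) y := by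
    have hjm : Measurable fun z : E d × E d => Q.indicator (fun _ =>
        Q.indicator (fun _ => ‖v (z.1 + z.2) - v z.1‖ₑ ^ p * κ z.2) (z.1 + z.2)) z.1 := by
      have hbase : Measurable fun z : E d × E d => ‖v (z.1 + z.2) - v z.1‖ₑ ^ p * κ z.2 :=
        ((((hvm.comp (by fun_prop)).sub (hvm.comp measurable_fst)).enorm).pow_const p).mul
          (hκm.comp measurable_snd)
      have hs1 : MeasurableSet {z : E d × E d | z.1 ∈ Q} := measurable_fst hQ
      have hs2 : MeasurableSet {z : E d × E d | z.1 + z.2 ∈ Q} :=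
        (measurable_fst.add measurable_snd) hQ
      exact (hbase.indicator hs2).indicator hs1
    calc gagliardo Q σ p v
        = ∫⁻ y, ∫⁻ h, Q.indicator (fun _ =>
            Q.indicator (fun _ => ‖v (y + h) - v y‖ₑ ^ p * κ h) (y + h)) y := by
          unfold gagliardo
          rw [← lintegral_indicator hQ]
          refine lintegral_congr fun y => ?_
          by_cases hy : y ∈ Q
          · simp only [indicator_of_mem hy]
            rw [← lintegral_indicator hQ, ← lintegral_add_left_eq_self _ y]
            refine lintegral_congr fun h => ?_
            by_cases hyh : y + h ∈ Q
            · simp [indicator_of_mem hyh, gagliardoKernel, hκ]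
            · simp [indicator_of_notMem hyh]
          · simp [indicator_of_notMem hy]
      _ = ∫⁻ h, ∫⁻ y, Q.indicator (fun _ =>
            Q.indicator (fun _ => ‖v (y + h) - v y‖ₑ ^ p * κ h) (y + h)) y :=
          lintegral_lintegral_swap hjm.aemeasurable
      _ = _ := by
          rw [← lintegral_indicator measurableSet_ball]
          refine lintegral_congr fun h => ?_
          by_cases hh : h ∈ Metric.ball (0 : E d) D
          · rw [indicator_of_mem hh, ← lintegral_const_mul' _ _ (by simp [hκ])]
            refine lintegral_congr fun y => ?_
            by_cases hy : y ∈ Q <;> by_cases hyh : y + h ∈ Q <;> simp [hy, hyh, mul_comm]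
          · rw [indicator_of_notMem hh]
            refine (lintegral_congr fun y => ?_).trans lintegral_zero
            by_cases hy : y ∈ Q <;> by_cases hyh : y + h ∈ Q <;> simp [hy, hyh]
            have := hD y hy _ hyh
            rw [add_sub_cancel_left] at this
            exact absurd (by simpa using this) hh
  have hWp : ∫⁻ x in Q, W x ^ p ≤ (d : ℝ≥0∞) ^ (p - 1) * ∑ i, lpEnergy Q p (w i) := by
    unfold lpEnergy
    rw [← lintegral_finsetSum' _ fun i _ => ((hwm i).enorm.pow_const p).aemeasurable,
      ← lintegral_const_mul' _ _ (by finiteness)]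
    refine lintegral_mono fun x => ?_
    have := ENNReal.rpow_sum_le_const_mul_sum_rpow Finset.univ (fun i => ‖w i x‖ₑ) hp.le
    simpa using this
  -- By convexity the segment from y to y + h stays in Q, so W can be cut off outside Q; integrating
  -- first in y then removes the shift t h by translation invariance.
  have hinner : ∀ h : E d, ∫⁻ y, Q.indicator (fun _ => Q.indicator
      (fun _ => ‖v (y + h) - v y‖ₑ ^ p) (y + h)) y
        ≤ ENNReal.ofReal (‖h‖ ^ p) * ∫⁻ x in Q, W x ^ p := by
    intro h
    have hm2 : Measurable fun z : E d × ℝ => Q.indicator (fun x => W x ^ p) (z.1 + z.2 • h) :=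
      ((hWm.pow_const p).indicator hQ).comp (by fun_prop)
    calc _ ≤ ∫⁻ y, ENNReal.ofReal (‖h‖ ^ p) *
          ∫⁻ t, Q.indicator (fun x => W x ^ p) (y + t • h) ∂unitIocMeasure := by
          refine lintegral_mono_ae ?_
          filter_upwards [hinc h] with y hy
          by_cases hyQ : y ∈ Q <;> by_cases hyh : y + h ∈ Q
          · simp only [indicator_of_mem hyQ, indicator_of_mem hyh]
            refine hy.trans ?_
            gcongr ENNReal.ofReal _ * ?_
            refine setLIntegral_mono' measurableSet_Ioc fun t ht => ?_
            have hmem : y + t • h ∈ Q := by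
              have := hQc hyQ hyh (sub_nonneg.2 ht.2) ht.1.le (by ring)
              have e : (1 - t) • y + t • (y + h) = y + t • h := by
                rw [smul_add, sub_smul, one_smul]; abel
              rwa [e] at this
            rw [indicator_of_mem hmem]
          · simp [hyQ, hyh]
          · simp [hyQ]
          · simp [hyQ]
      _ = ENNReal.ofReal (‖h‖ ^ p) * ∫⁻ t, (∫⁻ y, Q.indicator (fun x => W x ^ p)
            (y + t • h)) ∂unitIocMeasure := by
          rw [lintegral_const_mul' _ _ (by finiteness), lintegral_lintegral_swap hm2.aemeasurable]
      _ = _ := by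
          congr 1
          simp only [lintegral_add_right_eq_self (Q.indicator (fun x => W x ^ p)),
            lintegral_indicator hQ]
          simp
  rw [hfirst]
  calc _ ≤ ∫⁻ h in Metric.ball (0 : E d) D, ENNReal.ofReal (‖h‖ ^ p) * κ h *
        ∫⁻ x in Q, W x ^ p := by
        refine lintegral_mono fun h => ?_
        refine (mul_le_mul_right (hinner h) _).trans (le_of_eq ?_)
        ring
    _ = (∫⁻ h in Metric.ball (0 : E d) D, ENNReal.ofReal (‖h‖ ^ p) * κ h) *
        ∫⁻ x in Q, W x ^ p := lintegral_mul_const _ (by simp only [hκ]; fun_prop)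
    _ ≤ _ := by
        rw [mul_assoc]
        gcongr

/-! ### Local Sobolev energies -/

theorem mem_multiLE {k : ℕ} {α : Fin d → ℕ} : α ∈ multiLE d k ↔ ∑ i, α i ≤ k := by
  simp only [multiLE, Finset.mem_filter, Fintype.mem_piFinset, Finset.mem_range,
    and_iff_right_iff_imp]
  intro h i
  have := Finset.single_le_sum (f := α) (fun j _ => Nat.zero_le _) (Finset.mem_univ i)
  omega

theorem mem_multiEQ {k : ℕ} {α : Fin d → ℕ} : α ∈ multiEQ d k ↔ ∑ i, α i = k := by
  simp only [multiEQ, Finset.mem_filter, Fintype.mem_piFinset, Finset.mem_range,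
    and_iff_right_iff_imp]
  intro h i
  have := Finset.single_le_sum (f := α) (fun j _ => Nat.zero_le _) (Finset.mem_univ i)
  omega

theorem eLpNorm_ofReal_rpow {p : ℝ} (hp : 0 < p) (f : E d → ℝ) (μ : Measure (E d)) :
    eLpNorm f (ENNReal.ofReal p) μ ^ p = ∫⁻ x, ‖f x‖ₑ ^ p ∂μ := by
  rw [eLpNorm_eq_lintegral_rpow_enorm_toReal (by simpa using hp) ENNReal.ofReal_ne_top,
    ENNReal.toReal_ofReal hp.le, ← ENNReal.rpow_mul, one_div_mul_cancel hp.ne', ENNReal.rpow_one]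

theorem eLpNorm_ofReal_eq {p : ℝ} (hp : 0 < p) (f : E d → ℝ) (μ : Measure (E d)) :
    eLpNorm f (ENNReal.ofReal p) μ = (∫⁻ x, ‖f x‖ₑ ^ p ∂μ) ^ (1 / p) := by
  rw [eLpNorm_eq_lintegral_rpow_enorm_toReal (by simpa using hp) ENNReal.ofReal_ne_top,
    ENNReal.toReal_ofReal hp.le]

open Classical in
/-- The Sobolev energy of order `s` on `Q` of a family `v` of derivatives. -/
def sobEnergy (Q : Set (E d)) (s p : ℝ) (v : (Fin d → ℕ) → E d → ℝ) : ℝ≥0∞ :=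
  ∑ β ∈ multiLE d ⌊s⌋₊, lpEnergy Q p (v β) +
    if IsIntegerOrder s then 0
    else ∑ β ∈ multiEQ d ⌊s⌋₊, gagliardo Q (Int.fract s * p) p (v β)

theorem lpEnergy_le_sobEnergy {Q : Set (E d)} {s p : ℝ} {v : (Fin d → ℕ) → E d → ℝ}
    {β : Fin d → ℕ} (hβ : ∑ i, β i ≤ ⌊s⌋₊) : lpEnergy Q p (v β) ≤ sobEnergy Q s p v :=
  (Finset.single_le_sum (f := fun β => lpEnergy Q p (v β)) (fun _ _ => zero_le)
    (mem_multiLE.2 hβ)).trans le_self_add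

theorem gagliardo_le_sobEnergy {Q : Set (E d)} {s p : ℝ} (hs : ¬ IsIntegerOrder s)
    {v : (Fin d → ℕ) → E d → ℝ} {β : Fin d → ℕ} (hβ : ∑ i, β i = ⌊s⌋₊) :
    gagliardo Q (Int.fract s * p) p (v β) ≤ sobEnergy Q s p v := by
  rw [sobEnergy, if_neg hs]
  exact (Finset.single_le_sum (f := fun β => gagliardo Q (Int.fract s * p) p (v β))
    (fun _ _ => zero_le) (mem_multiEQ.2 hβ)).trans le_add_self

theorem sobEnergy_lt_top {Q : Set (E d)} {s p : ℝ} {v : (Fin d → ℕ) → E d → ℝ}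
    (h1 : ∀ β : Fin d → ℕ, ∑ i, β i ≤ ⌊s⌋₊ → lpEnergy Q p (v β) < ∞)
    (h2 : ¬ IsIntegerOrder s → ∀ β : Fin d → ℕ, ∑ i, β i = ⌊s⌋₊ →
      gagliardo Q (Int.fract s * p) p (v β) < ∞) : sobEnergy Q s p v < ∞ := by
  rw [sobEnergy, ENNReal.add_lt_top]
  refine ⟨ENNReal.sum_lt_top.2 fun β hβ => h1 β (mem_multiLE.1 hβ), ?_⟩
  split_ifs with hi
  · exact ENNReal.zero_lt_top
  · exact ENNReal.sum_lt_top.2 fun β hβ => h2 hi β (mem_multiEQ.1 hβ)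

theorem sobEnergy_le_of_forall {Q : Set (E d)} {s p : ℝ} {w : (Fin d → ℕ) → E d → ℝ}
    {A : (Fin d → ℕ) → ℝ≥0∞} {S : ℝ≥0∞}
    (h1 : ∀ β : Fin d → ℕ, ∑ i, β i ≤ ⌊s⌋₊ → lpEnergy Q p (w β) ≤ A β * S)
    (h2 : ¬ IsIntegerOrder s → ∀ β : Fin d → ℕ, ∑ i, β i = ⌊s⌋₊ →
      gagliardo Q (Int.fract s * p) p (w β) ≤ A β * S) :
    sobEnergy Q s p w ≤ (∑ β ∈ multiLE d ⌊s⌋₊, A β + ∑ β ∈ multiEQ d ⌊s⌋₊, A β) * S := by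
  rw [sobEnergy, add_mul, Finset.sum_mul, Finset.sum_mul]
  refine add_le_add (Finset.sum_le_sum fun β hβ => h1 β (mem_multiLE.1 hβ)) ?_
  split_ifs with hi
  · exact zero_le
  · exact Finset.sum_le_sum fun β hβ => h2 hi β (mem_multiEQ.1 hβ)

theorem weakDeriv_cube_ae_eq {l : ℝ} {α : Fin d → ℕ} {u w : E d → ℝ}
    (h : IsWeakDeriv (interior (cube d l)) α u w) :
    weakDeriv (interior (cube d l)) α u =ᵐ[cubeMeasure d l] w := by
  have := h.weakDeriv_ae_eq isOpen_interior
  rwa [restrict_interior_cube] at this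

theorem memCubeSob_of_sobEnergy {l s p : ℝ} (hp : 0 < p) {u : E d → ℝ}
    {w : (Fin d → ℕ) → E d → ℝ}
    (hw : ∀ α : Fin d → ℕ, ∑ i, α i ≤ ⌊s⌋₊ → IsWeakDeriv (interior (cube d l)) α u (w α))
    (hm : ∀ α, Measurable (w α)) (hE : sobEnergy (cube d l) s p w < ∞) : MemCubeSob d l s p u := by
  refine ⟨fun α hα => ?_, fun hi => ?_⟩
  · rw [mem_multiLE] at hα
    refine ⟨⟨_, hw α hα⟩, (memLp_congr_ae (weakDeriv_cube_ae_eq (hw α hα))).2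
      ⟨(hm α).aestronglyMeasurable, ?_⟩⟩
    rw [eLpNorm_ofReal_eq hp]
    exact ENNReal.rpow_lt_top_of_nonneg (by positivity)
      ((lpEnergy_le_sobEnergy hα).trans_lt hE).ne
  · refine ENNReal.sum_lt_top.2 fun α hα => ?_
    rw [mem_multiEQ] at hα
    refine ENNReal.rpow_lt_top_of_nonneg (by positivity) (ne_of_lt ?_)
    refine lt_of_eq_of_lt ?_ ((gagliardo_le_sobEnergy hi hα).trans_lt hE)
    exact gagliardo_congr (weakDeriv_cube_ae_eq (hw α hα.le))

theorem cubeSobNorm_le_sobEnergy {l s p : ℝ} (hp : 0 < p) {u : E d → ℝ}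
    {w : (Fin d → ℕ) → E d → ℝ}
    (hw : ∀ α : Fin d → ℕ, ∑ i, α i ≤ ⌊s⌋₊ → IsWeakDeriv (interior (cube d l)) α u (w α)) :
    cubeSobNorm d l s p u
      ≤ (1 + ((multiEQ d ⌊s⌋₊).card : ℝ≥0∞)) * sobEnergy (cube d l) s p w ^ (1 / p) := by
  have hp' : 0 ≤ 1 / p := by positivity
  rw [cubeSobNorm, sobNorm, add_mul, one_mul]
  refine add_le_add ?_ ?_
  · refine ENNReal.rpow_le_rpow ?_ hp'
    refine le_trans (le_of_eq ?_) le_self_add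
    refine Finset.sum_congr rfl fun α hα => ?_
    rw [eLpNorm_ofReal_rpow hp]
    exact lpEnergy_congr (weakDeriv_cube_ae_eq (hw α (mem_multiLE.1 hα)))
  · split_ifs with hi
    · exact zero_le
    · rw [fracSeminorm, ← nsmul_eq_mul]
      refine Finset.sum_le_card_nsmul _ _ _ fun α hα => ?_
      rw [mem_multiEQ] at hα
      refine ENNReal.rpow_le_rpow ?_ hp'
      refine le_trans (le_of_eq ?_) (gagliardo_le_sobEnergy hi hα)
      exact gagliardo_congr (weakDeriv_cube_ae_eq (hw α hα.le))

/-! ### Products with smooth cutoffs -/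

theorem exists_bound_lipschitz {c : smoothFn d} (hc : HasCompactSupport (c : E d → ℝ)) :
    ∃ M : ℝ, (∀ x, |(c : E d → ℝ) x| ≤ M) ∧
      ∀ x y, |(c : E d → ℝ) x - (c : E d → ℝ) y| ≤ M * ‖x - y‖ := by
  obtain ⟨M, hM⟩ := hc.exists_bound_of_continuous (smoothFn_continuous c)
  obtain ⟨L, hL⟩ := ContDiff.lipschitzWith_of_hasCompactSupport hc (smoothFn_contDiff c) (by simp)
  refine ⟨max M L, fun x => (hM x).trans (le_max_left _ _), fun x y => ?_⟩
  refine (hL.norm_sub_le x y).trans ?_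
  gcongr
  exact le_max_right _ _

theorem fract_mul_lt {s p : ℝ} (hp : 0 < p) : Int.fract s * p < p := by
  have := Int.fract_lt_one s
  nlinarith

theorem norm_sub_lt_of_mem_cube {l : ℝ} (hl : 0 < l) {x y : E d} (hx : x ∈ cube d l)
    (hy : y ∈ cube d l) : ‖x - y‖ < d * l + 1 := by
  have h1 := norm_le_of_mem_cube hl.le hx
  have h2 := norm_le_of_mem_cube hl.le hy
  have := norm_sub_le x y
  linarith

/-- A compatible family of measurable generalized derivatives of order at most `k` on `ℝ^d`. -/
structure IsWeakDerivFamily (k : ℕ) (h : E d → ℝ) (v : (Fin d → ℕ) → E d → ℝ) : Prop where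
  isWeakDeriv : ∀ β : Fin d → ℕ, ∑ i, β i ≤ k → IsWeakDeriv univ β h (v β)
  measurable : ∀ β, Measurable (v β)

/-- Every derivative of order at most `⌊s⌋` has its fractional energy controlled. -/
theorem exists_gagliardo_le_sobEnergy (hd : 1 ≤ d) {s p l : ℝ} (hp : 1 < p) (hl : 0 < l)
    (hs : ¬ IsIntegerOrder s) : ∃ C : ℝ≥0∞, C < ∞ ∧
      ∀ (h : E d → ℝ) (v : (Fin d → ℕ) → E d → ℝ), IsWeakDerivFamily ⌊s⌋₊ h v →
        ∀ β : Fin d → ℕ, ∑ i, β i ≤ ⌊s⌋₊ →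
          gagliardo (cube d l) (Int.fract s * p) p (v β) ≤ C * sobEnergy (cube d l) s p v := by
  have hp0 : 0 < p := by linarith
  set K := ∫⁻ h in Metric.ball (0 : E d) (d * l + 1), ENNReal.ofReal (‖h‖ ^ p) *
        ENNReal.ofReal (‖h‖ ^ (-((d : ℝ) + Int.fract s * p))) with hK
  have hKt : K < ∞ := lintegral_ball_rpow_lt_top hd hp0 (fract_mul_lt hp0) _
  have hdp : (d : ℝ≥0∞) ^ (p - 1) < ∞ :=
    ENNReal.rpow_lt_top_of_nonneg (by linarith) (ENNReal.natCast_ne_top _)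
  refine ⟨1 + K * (d : ℝ≥0∞) ^ (p - 1) * d, ?_, fun h v hv β hβ => ?_⟩
  · exact ENNReal.add_lt_top.2 ⟨ENNReal.one_lt_top, ENNReal.mul_lt_top (ENNReal.mul_lt_top hKt hdp)
      (ENNReal.natCast_lt_top _)⟩
  -- At top order the fractional energy is a summand of the Sobolev energy. At lower order all β +
  -- eᵢ still have order at most ⌊s⌋, so the gradient bound applies.
  rcases hβ.eq_or_lt with hβ' | hβ'
  · refine (gagliardo_le_sobEnergy hs hβ').trans ?_
    rw [add_mul, one_mul]
    exact le_self_add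
  · have hβi : ∀ i, ∑ j, (β + Pi.single i 1 : Fin d → ℕ) j ≤ ⌊s⌋₊ := fun i => by
      rw [sum_add_single]; omega
    have hloc : ∀ α : Fin d → ℕ, ∑ i, α i ≤ ⌊s⌋₊ → LocallyIntegrable (v α) volume := fun α hα =>
      locallyIntegrableOn_univ.1 (hv.isWeakDeriv α hα).2.1
    have key := gagliardo_le_of_weak_gradient (σ := Int.fract s * p) hp (measurableSet_cube l)
      (convex_cube l) (D := d * l + 1)
      (fun y hy x hx => norm_sub_lt_of_mem_cube hl hx hy)
      (hloc β hβ) (w := fun i => v (β + Pi.single i 1)) (fun i => hloc _ (hβi i))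
      (hv.measurable β) (fun i => hv.measurable _)
      (fun i φ hφ => (hv.isWeakDeriv β hβ).integral_mul_pderivₗ (hv.isWeakDeriv _ (hβi i)) hφ)
    refine key.trans ?_
    calc _ ≤ K * (d : ℝ≥0∞) ^ (p - 1) * ∑ _i : Fin d, sobEnergy (cube d l) s p v := by
          refine mul_le_mul_right ?_ _
          exact Finset.sum_le_sum fun i _ => lpEnergy_le_sobEnergy (hβi i)
      _ = K * (d : ℝ≥0∞) ^ (p - 1) * d * sobEnergy (cube d l) s p v := by
          simp [mul_assoc]
      _ ≤ _ := by
          rw [add_mul]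
          exact le_add_self

theorem lpEnergy_sum_mul_le {ι : Type*} [Fintype ι] {p : ℝ} (hp : 1 ≤ p)
    {c : ι → smoothFn d} (hc : ∀ j, HasCompactSupport (c j : E d → ℝ)) :
    ∃ C : ℝ≥0∞, C < ∞ ∧ ∀ (Q : Set (E d)) (u : ι → E d → ℝ) (S : ℝ≥0∞),
      (∀ j, Measurable (u j)) → (∀ j, lpEnergy Q p (u j) ≤ S) →
      lpEnergy Q p (fun x => ∑ j, (c j : E d → ℝ) x * u j x) ≤ C * S := by
  choose M hM hL using fun j => exists_bound_lipschitz (hc j)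
  refine ⟨((Finset.univ : Finset ι).card : ℝ≥0∞) ^ (p - 1) * ∑ j, ENNReal.ofReal (M j) ^ p, ?_,
    fun Q u S hm hS => ?_⟩
  · refine ENNReal.mul_lt_top (ENNReal.rpow_lt_top_of_nonneg (by linarith)
      (ENNReal.natCast_ne_top _)) (ENNReal.sum_lt_top.2 fun j _ => ?_)
    exact ENNReal.rpow_lt_top_of_nonneg (by linarith) ENNReal.ofReal_ne_top
  · refine (lpEnergy_sum_le (v := fun j x => (c j : E d → ℝ) x * u j x) _ Q hp fun j _ =>
      (smoothFn_continuous (c j)).measurable.mul (hm j)).trans ?_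
    rw [mul_assoc, Finset.sum_mul]
    gcongr with j
    exact (lpEnergy_mul_le (by linarith) (hM j) _).trans (mul_le_mul_right (hS j) _)

theorem gagliardo_sum_mul_le {ι : Type*} [Fintype ι] (hd : 1 ≤ d) {σ p l : ℝ} (hp : 1 ≤ p)
    (hσ : σ < p) (hl : 0 < l)
    {c : ι → smoothFn d} (hc : ∀ j, HasCompactSupport (c j : E d → ℝ)) :
    ∃ C : ℝ≥0∞, C < ∞ ∧ ∀ (u : ι → E d → ℝ) (S : ℝ≥0∞),
      (∀ j, Measurable (u j)) → (∀ j, lpEnergy (cube d l) p (u j) ≤ S) →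
      (∀ j, gagliardo (cube d l) σ p (u j) ≤ S) →
      gagliardo (cube d l) σ p (fun x => ∑ j, (c j : E d → ℝ) x * u j x) ≤ C * S := by
  choose M hM hL using fun j => exists_bound_lipschitz (hc j)
  set K := ∫⁻ h in Metric.ball (0 : E d) (d * l + 1), ENNReal.ofReal (‖h‖ ^ p) *
        ENNReal.ofReal (‖h‖ ^ (-((d : ℝ) + σ))) with hK
  have hKt : K < ∞ := lintegral_ball_rpow_lt_top hd (by linarith) hσ _
  refine ⟨((Finset.univ : Finset ι).card : ℝ≥0∞) ^ (p - 1) *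
    ∑ j, 2 ^ (p - 1) * ENNReal.ofReal (M j) ^ p * (1 + K), ?_, fun u S hm h1 h2 => ?_⟩
  · refine ENNReal.mul_lt_top (ENNReal.rpow_lt_top_of_nonneg (by linarith)
      (ENNReal.natCast_ne_top _)) (ENNReal.sum_lt_top.2 fun j _ => ?_)
    refine ENNReal.mul_lt_top (ENNReal.mul_lt_top ?_ ?_)
      (ENNReal.add_lt_top.2 ⟨ENNReal.one_lt_top, hKt⟩)
    · exact ENNReal.rpow_lt_top_of_nonneg (by linarith) ENNReal.ofNat_ne_top
    · exact ENNReal.rpow_lt_top_of_nonneg (by linarith) ENNReal.ofReal_ne_top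
  · refine (gagliardo_sum_le (v := fun j x => (c j : E d → ℝ) x * u j x) _ _ hp fun j _ =>
      (smoothFn_continuous (c j)).measurable.mul (hm j)).trans ?_
    rw [mul_assoc, Finset.sum_mul]
    gcongr with j
    refine (gagliardo_mul_le hp (measurableSet_cube l)
      (fun y hy x hx => norm_sub_lt_of_mem_cube hl hx hy) (hM j) (hL j) (hm j)).trans ?_
    rw [mul_assoc _ (1 + K), add_mul, one_mul]
    gcongr
    · exact h2 j
    · exact h1 j

/-- Multiplication by a smooth cutoff on the level of families of derivatives. -/
theorem exists_cutoff_family (hd : 1 ≤ d) {s p : ℝ} (hp : 1 < p) (χ : smoothFn d)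
    (hχ : HasCompactSupport (χ : E d → ℝ)) :
    ∃ C : ℝ → ℝ≥0∞, (∀ l, C l < ∞) ∧
      ∀ (h : E d → ℝ) (v : (Fin d → ℕ) → E d → ℝ), IsWeakDerivFamily ⌊s⌋₊ h v →
        ∃ w : (Fin d → ℕ) → E d → ℝ,
          IsWeakDerivFamily ⌊s⌋₊ (fun x => (χ : E d → ℝ) x * h x) w ∧
          ∀ l, 0 < l → sobEnergy (cube d l) s p w ≤ C l * sobEnergy (cube d l) s p v := by
  choose ι hι β c hβ hc hχw using fun α : Fin d → ℕ => exists_isWeakDeriv_mul χ α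
  -- The Leibniz coefficients are supported in the support of χ, hence bounded and Lipschitz; this
  -- is all that the product estimates need.
  have hcc : ∀ α j, HasCompactSupport (c α j : E d → ℝ) := fun α j =>
    hχ.of_isClosed_subset (isClosed_tsupport _) (hc α j)
  choose C₁ hC₁ hlp using fun α => lpEnergy_sum_mul_le hp.le (hcc α)
  have hgag : ∀ (α : Fin d → ℕ) (l : ℝ), ∃ C : ℝ≥0∞, C < ∞ ∧ (0 < l → ¬ IsIntegerOrder s →
      ∀ (h : E d → ℝ) (v : (Fin d → ℕ) → E d → ℝ), IsWeakDerivFamily ⌊s⌋₊ h v →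
        ∑ i, α i ≤ ⌊s⌋₊ → gagliardo (cube d l) (Int.fract s * p) p
          (fun x => ∑ j, (c α j : E d → ℝ) x * v (β α j) x) ≤ C * sobEnergy (cube d l) s p v) := by
    intro α l
    -- The constant is needed only for positive l and non-integer s; the value 0 elsewhere makes it
    -- a total function of α and l.
    by_cases hl : 0 < l
    · by_cases hs : IsIntegerOrder s
      · exact ⟨0, ENNReal.zero_lt_top, fun _ h => absurd hs h⟩
      · obtain ⟨A, hA, hA'⟩ := exists_gagliardo_le_sobEnergy hd hp hl hs
        obtain ⟨B, hB, hB'⟩ := gagliardo_sum_mul_le hd hp.le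
          (fract_mul_lt (s := s) (by linarith : 0 < p)) hl (hcc α)
        refine ⟨B * (1 + A), ENNReal.mul_lt_top hB
          (ENNReal.add_lt_top.2 ⟨ENNReal.one_lt_top, hA⟩), fun _ _ h v hv hα => ?_⟩
        rw [mul_assoc]
        refine hB' (fun j => v (β α j)) _ (fun j => hv.measurable _) (fun j => ?_) (fun j => ?_)
        · refine (lpEnergy_le_sobEnergy ((hβ α j).trans hα)).trans ?_
          rw [add_mul, one_mul]
          exact le_self_add
        · refine (hA' h v hv _ ((hβ α j).trans hα)).trans ?_
          rw [add_mul]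
          exact le_add_self
    · exact ⟨0, ENNReal.zero_lt_top, fun h => absurd h hl⟩
  choose C₂ hC₂ hg using hgag
  refine ⟨fun l => ∑ α ∈ multiLE d ⌊s⌋₊, (C₁ α + C₂ α l) + ∑ α ∈ multiEQ d ⌊s⌋₊, (C₁ α + C₂ α l),
    fun l => ?_, fun h v hv => ⟨fun α x => ∑ j, (c α j : E d → ℝ) x * v (β α j) x,
      ⟨fun α hα => ?_, fun α => ?_⟩, fun l hl => ?_⟩⟩
  · have : ∀ α, C₁ α + C₂ α l < ∞ := fun α => ENNReal.add_lt_top.2 ⟨hC₁ α, hC₂ α l⟩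
    exact ENNReal.add_lt_top.2 ⟨ENNReal.sum_lt_top.2 fun α _ => this α,
      ENNReal.sum_lt_top.2 fun α _ => this α⟩
  · exact hχw α h v fun β' hβ' => hv.isWeakDeriv β' (hβ'.trans hα)
  · exact Finset.measurable_sum _ fun j _ =>
      (smoothFn_continuous (c α j)).measurable.mul (hv.measurable _)
  · refine sobEnergy_le_of_forall (fun α hα => ?_) (fun hi α hα => ?_)
    · refine (hlp α (cube d l) (fun j => v (β α j)) (sobEnergy (cube d l) s p v)
        (fun j => hv.measurable _) fun j => lpEnergy_le_sobEnergy ((hβ α j).trans hα)).trans ?_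
      rw [add_mul]
      exact le_self_add
    · refine (hg α l hl hi h v hv hα.le).trans ?_
      rw [add_mul]
      exact le_add_self

/-! ### Periodization -/

/-- The point of `ℝ^d` with integer coordinates `j`. -/
def intVec (j : Fin d → ℤ) : E d := WithLp.toLp 2 fun i => (j i : ℝ)

@[simp] theorem intVec_apply (j : Fin d → ℤ) (i : Fin d) : intVec j i = j i := rfl

/-- The coordinatewise nearest integer point. -/
def roundIdx (x : E d) : Fin d → ℤ := fun i => round (x i)

/-- The `1`-periodic extension of the restriction of `u` to the unit cube. -/
def periodize (u : E d → ℝ) (x : E d) : ℝ := u (x - intVec (roundIdx x))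

/-- The functions vanishing outside of a smaller cube. -/
def VanishesOutside (u : E d → ℝ) : Prop := ∀ x, (∃ i, 3 / 8 ≤ |x i|) → u x = 0

theorem isPeriodic_periodize (u : E d → ℝ) : IsPeriodic (periodize u) := by
  intro i x
  unfold periodize
  congr 1
  ext j
  simp only [PiLp.sub_apply, PiLp.add_apply, intVec_apply, roundIdx, unitVec]
  by_cases h : j = i
  · subst h
    simp
  · simp [h]

/-- If u does not vanish at x + j, then each |xᵢ + jᵢ| is below 3/8, while xᵢ is within 1/2 of its
rounding. The integer jᵢ + round xᵢ is therefore smaller than 1 in modulus. So at most one integer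
translate of u is nonzero at a given point. -/
theorem VanishesOutside.eq_neg_roundIdx {u : E d → ℝ} (hu : VanishesOutside u) {x : E d}
    {j : Fin d → ℤ} (h : u (x + intVec j) ≠ 0) : j = -roundIdx x := by
  funext i
  have h1 : |x i + j i| < 3 / 8 := by
    by_contra hc
    exact h (hu _ ⟨i, by simpa using hc⟩)
  have h2 := abs_sub_round (x i)
  have h3 : |((j i + round (x i) : ℤ) : ℝ)| < 1 := by
    have : ((j i + round (x i) : ℤ) : ℝ) = (x i + j i) - (x i - round (x i)) := by
      push_cast; ring
    rw [this]
    refine (abs_sub _ _).trans_lt ?_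
    linarith
  have h4 : |j i + round (x i)| < 1 := by exact_mod_cast h3
  have h5 := Int.abs_lt_one_iff.1 h4
  simp only [roundIdx, Pi.neg_apply]
  omega

/-- On the faces of the closed cube rounding may move the point, but u vanishes both there and at
the moved point, so no exceptional null set is needed. Sample points on the boundary are thereby
covered. -/
theorem periodize_eq_self {u : E d → ℝ} (hu : VanishesOutside u) {x : E d}
    (hx : x ∈ unitCube d) : periodize u x = u x := by
  have h0 : ∀ z : E d, x + intVec (-roundIdx x) = z ↔ x - intVec (roundIdx x) = z := by
    intro z
    have : intVec (-roundIdx x) = -intVec (roundIdx x) := by ext i; simp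
    rw [this, sub_eq_add_neg]
  by_cases h : periodize u x = 0
  · by_contra hne
    have h1 : u (x + intVec 0) ≠ 0 := by
      have : (intVec 0 : E d) = 0 := by ext i; simp
      rw [this, add_zero]
      exact fun h' => hne (h.trans h'.symm)
    have h2 := hu.eq_neg_roundIdx h1
    have h3 : roundIdx x = 0 := neg_eq_zero.1 h2.symm
    apply hne
    unfold periodize
    rw [h3]
    congr 1
    ext i
    simp
  · have h1 : ∀ i, |x i - round (x i)| < 3 / 8 := by
      intro i
      by_contra hc
      exact h (hu _ ⟨i, by simpa [roundIdx] using hc⟩)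
    have h3 : roundIdx x = 0 := by
      funext i
      have h4 : |((round (x i) : ℤ) : ℝ)| < 1 := by
        have : ((round (x i) : ℤ) : ℝ) = x i - (x i - round (x i)) := by ring
        rw [this]
        refine (abs_sub _ _).trans_lt ?_
        have := hx i
        have := h1 i
        linarith
      exact Int.abs_lt_one_iff.1 (by exact_mod_cast h4)
    unfold periodize
    rw [h3]
    congr 1
    ext i
    simp

/-- Integer points of sup norm at most `N`. -/
def intBox (d N : ℕ) : Finset (Fin d → ℤ) := Fintype.piFinset fun _ => Finset.Icc (-(N : ℤ)) N

/-- Rounding a coordinate of modulus at most l/2 gives an integer of modulus at most ⌈l⌉ + 1, so a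
fixed finite set of translates represents the periodization on the whole cube. Weak derivatives and
energies can then be treated termwise. -/
theorem periodize_eq_sum {u : E d → ℝ} (hu : VanishesOutside u) {l : ℝ} {x : E d}
    (hx : x ∈ cube d l) : periodize u x = ∑ j ∈ intBox d (⌈l⌉₊ + 1), u (x + intVec j) := by
  have hmem : -roundIdx x ∈ intBox d (⌈l⌉₊ + 1) := by
    simp only [intBox, Fintype.mem_piFinset, Finset.mem_Icc, Pi.neg_apply, roundIdx]
    intro i
    have h1 := abs_sub_round (x i)
    have h2 := hx i
    have h3 := Nat.le_ceil l
    have h5 : (0 : ℝ) ≤ ⌈l⌉₊ := Nat.cast_nonneg _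
    have h4 : |(round (x i) : ℝ)| ≤ ((⌈l⌉₊ + 1 : ℕ) : ℝ) := by
      have : (round (x i) : ℝ) = x i - (x i - round (x i)) := by ring
      rw [this]
      refine (abs_sub _ _).trans ?_
      push_cast
      linarith
    have h6 : |round (x i)| ≤ ((⌈l⌉₊ + 1 : ℕ) : ℤ) := by exact_mod_cast h4
    rw [abs_le] at h6
    omega
  rw [Finset.sum_eq_single_of_mem _ hmem]
  · unfold periodize
    congr 1
    ext i
    simp [sub_eq_add_neg]
  · intro j _ hj
    by_contra hne
    exact hj (hu.eq_neg_roundIdx hne)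

theorem add_intVec_mem_cube {l : ℝ} {N : ℕ} {j : Fin d → ℤ} (hj : j ∈ intBox d N) {x : E d}
    (hx : x ∈ cube d l) : x + intVec j ∈ cube d (l + 2 * N) := by
  intro i
  have h1 := hx i
  simp only [intBox, Fintype.mem_piFinset, Finset.mem_Icc] at hj
  have h2 : |j i| ≤ (N : ℤ) := abs_le.2 (hj i)
  have h3 : |(j i : ℝ)| ≤ N := by exact_mod_cast h2
  simp only [PiLp.add_apply, intVec_apply]
  refine (abs_add_le _ _).trans ?_
  linarith

theorem continuous_periodize {u : E d → ℝ} (hu : VanishesOutside u) (hc : Continuous u) :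
    Continuous (periodize u) := by
  rw [continuous_iff_continuousAt]
  intro x
  have hx : x ∈ {y : E d | ∀ i, |y i| < (2 * ‖x‖ + 2) / 2} := fun i => by
    have := abs_apply_le_norm x i
    linarith
  have hnhds := (isOpen_openCube (2 * ‖x‖ + 2)).mem_nhds hx
  have hs : Continuous fun y => ∑ j ∈ intBox d (⌈2 * ‖x‖ + 2⌉₊ + 1), u (y + intVec j) :=
    continuous_finsetSum _ fun j _ => hc.comp (by fun_prop)
  refine hs.continuousAt.congr ?_
  filter_upwards [hnhds] with y hy
  exact (periodize_eq_sum hu fun i => (hy i).le).symm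

theorem isWeakDeriv_periodize {u w : E d → ℝ} (hu : VanishesOutside u) {α : Fin d → ℕ}
    (h : IsWeakDeriv univ α u w) (l : ℝ) :
    IsWeakDeriv (interior (cube d l)) α (periodize u)
      (fun x => ∑ j ∈ intBox d (⌈l⌉₊ + 1), w (x + intVec j)) := by
  have h1 := IsWeakDeriv.finset_sum (intBox d (⌈l⌉₊ + 1)) fun j _ =>
    (h.translate (intVec j)).mono (subset_univ (interior (cube d l)))
  refine h1.congr ?_ (Filter.EventuallyEq.refl _ _)
  refine ae_restrict_of_forall_mem isOpen_interior.measurableSet fun x hx => ?_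
  exact (periodize_eq_sum hu (interior_subset hx)).symm

/-- On the unit cube only the untranslated copy is visible, so the norm estimate uses w itself. The
finite sum of translates serves only for membership on larger cubes, where finiteness is enough. -/
theorem isWeakDeriv_periodize_unitCube {u w : E d → ℝ} (hu : VanishesOutside u) {α : Fin d → ℕ}
    (h : IsWeakDeriv univ α u w) :
    IsWeakDeriv (interior (cube d 1)) α (periodize u) w := by
  refine (h.mono (subset_univ (interior (cube d 1)))).congr ?_ (Filter.EventuallyEq.refl _ _)
  refine ae_restrict_of_forall_mem isOpen_interior.measurableSet fun x hx => ?_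
  exact (periodize_eq_self hu (interior_subset hx)).symm

theorem memPerSob_periodize {s p : ℝ} (hp : 1 < p) {u : E d → ℝ} (hu : VanishesOutside u)
    {w : (Fin d → ℕ) → E d → ℝ} (hw : IsWeakDerivFamily ⌊s⌋₊ u w)
    (hE : ∀ l, 0 < l → sobEnergy (cube d l) s p w < ∞) : MemPerSob d s p (periodize u) := by
  have hp0 : 0 < p := by linarith
  refine ⟨isPeriodic_periodize u, fun l hl => ?_⟩
  set N := ⌈l⌉₊ + 1 with hN
  have hL : 0 < l + 2 * N := by positivity
  have hm : ∀ α j, Measurable fun x => w α (x + intVec j) := fun α j =>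
    (hw.measurable α).comp (by fun_prop)
  have hcard : ((intBox d N).card : ℝ≥0∞) ^ (p - 1) < ∞ :=
    ENNReal.rpow_lt_top_of_nonneg (by linarith) (ENNReal.natCast_ne_top _)
  refine memCubeSob_of_sobEnergy hp0 (w := fun α x => ∑ j ∈ intBox d N, w α (x + intVec j))
    (fun α hα => isWeakDeriv_periodize hu (hw.isWeakDeriv α hα) l)
    (fun α => Finset.measurable_sum _ fun j _ => hm α j)
    (sobEnergy_lt_top (fun α hα => ?_) fun hi α hα => ?_)
  · refine (lpEnergy_sum_le (v := fun j x => w α (x + intVec j)) _ _ hp.le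
      fun j _ => hm α j).trans_lt (ENNReal.mul_lt_top hcard (ENNReal.sum_lt_top.2 fun j hj => ?_))
    refine (lpEnergy_translate_le (measurableSet_cube l) (measurableSet_cube (l + 2 * N))
      (fun x hx => add_intVec_mem_cube hj hx) p (w α)).trans_lt ?_
    exact (lpEnergy_le_sobEnergy hα).trans_lt (hE _ hL)
  · refine (gagliardo_sum_le (v := fun j x => w α (x + intVec j)) _ _ hp.le
      fun j _ => hm α j).trans_lt (ENNReal.mul_lt_top hcard (ENNReal.sum_lt_top.2 fun j hj => ?_))
    refine (gagliardo_translate_le (measurableSet_cube l) (measurableSet_cube (l + 2 * N))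
      (fun x hx => add_intVec_mem_cube hj hx) _ p (w α)).trans_lt ?_
    exact (gagliardo_le_sobEnergy hi hα).trans_lt (hE _ hL)

/-- The cut off and periodized function belongs to the periodic class, with a norm bound. -/
theorem exists_periodize_cutoff (hd : 1 ≤ d) {s p : ℝ} (hp : 1 < p) (χ : smoothFn d)
    (hχ : HasCompactSupport (χ : E d → ℝ)) (hχ0 : VanishesOutside (χ : E d → ℝ)) :
    ∃ C : ℝ≥0∞, C < ∞ ∧ ∀ (h : E d → ℝ) (v : (Fin d → ℕ) → E d → ℝ),
      IsWeakDerivFamily ⌊s⌋₊ h v → (∀ l, 0 < l → sobEnergy (cube d l) s p v < ∞) →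
        MemPerSob d s p (periodize fun x => (χ : E d → ℝ) x * h x) ∧
        cubeSobNorm d 1 s p (periodize fun x => (χ : E d → ℝ) x * h x)
          ≤ C * sobEnergy (cube d 1) s p v ^ (1 / p) := by
  have hp0 : 0 < p := by linarith
  have hp1 : 0 ≤ 1 / p := by positivity
  obtain ⟨C, hC, hχw⟩ := exists_cutoff_family hd (s := s) hp χ hχ
  refine ⟨(1 + ((multiEQ d ⌊s⌋₊).card : ℝ≥0∞)) * C 1 ^ (1 / p),
    ENNReal.mul_lt_top (ENNReal.add_lt_top.2 ⟨ENNReal.one_lt_top, ENNReal.natCast_lt_top _⟩)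
      (ENNReal.rpow_lt_top_of_nonneg hp1 (hC 1).ne), fun h v hv hE => ?_⟩
  obtain ⟨w, hw, hwE⟩ := hχw h v hv
  have hu : VanishesOutside fun x => (χ : E d → ℝ) x * h x := fun x hx => by
    simp [hχ0 x hx]
  refine ⟨memPerSob_periodize hp hu hw fun l hl =>
    (hwE l hl).trans_lt (ENNReal.mul_lt_top (hC l) (hE l hl)), ?_⟩
  refine (cubeSobNorm_le_sobEnergy hp0 fun α hα =>
    isWeakDeriv_periodize_unitCube hu (hw.isWeakDeriv α hα)).trans ?_
  rw [mul_assoc, ← ENNReal.mul_rpow_of_nonneg _ _ hp1]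
  gcongr
  exact hwE 1 one_pos

/-- A smooth cutoff that equals `1` on the cube of side `1/2`. -/
theorem exists_cutoff (d : ℕ) : ∃ χ : smoothFn d, HasCompactSupport (χ : E d → ℝ) ∧
    VanishesOutside (χ : E d → ℝ) ∧ ∀ x ∈ cube d (1 / 2), (χ : E d → ℝ) x = 1 := by
  obtain ⟨f, hf, -, hsupp, h1⟩ := exists_contMDiff_support_eq_eq_one_iff
    (n := (⊤ : ℕ∞)) (modelWithCornersSelf ℝ (E d)) (isOpen_openCube (d := d) (3 / 4))
    (isClosed_cube (d := d) (1 / 2)) (fun x hx i => by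
      have := hx i
      linarith)
  have h0 : VanishesOutside f := by
    rintro x ⟨i, hi⟩
    by_contra hne
    have : x ∈ Function.support f := hne
    rw [hsupp] at this
    have := this i
    linarith
  refine ⟨⟨f, hf.contDiff⟩, ?_, h0, fun x hx => (h1 x).1 hx⟩
  refine HasCompactSupport.intro (isCompact_cube (d := d) 1) fun x hx => ?_
  by_contra hne
  have hx' : x ∈ Function.support f := hne
  rw [hsupp] at hx'
  exact hx fun i => by
    have := hx' i
    linarith

/-! ### Comparison with the Gaussian measure -/

/-- Young's inequality for the cross term. On a cube around z the Gaussian exponent |x|²/2 is thus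
|z|²/2 up to a factor 1 ± η and an additive constant, uniformly in z. -/
theorem norm_add_sq_ge {η ρ : ℝ} (hη : 0 < η) {y z : E d} (hy : ‖y‖ ≤ ρ) :
    (1 - η) * ‖z‖ ^ 2 - ρ ^ 2 / η ≤ ‖y + z‖ ^ 2 := by
  have h1 := norm_sub_norm_le (y + z) y
  have h2 := norm_sub_norm_le z (-y)
  rw [norm_neg, sub_neg_eq_add, add_comm z y] at h2
  have hz := norm_nonneg z
  have hyz := norm_nonneg (y + z)
  have hy0 := norm_nonneg y
  have h3 : ‖z‖ ≤ ‖y + z‖ + ρ := by linarith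
  have h4 : η * (ρ ^ 2 / η) = ρ ^ 2 := by field_simp
  have h6 : 0 ≤ ρ ^ 2 / η := by positivity
  -- If |z| ≤ ρ, the left side is nonpositive; otherwise |z| - ρ ≤ |y + z| may be squared.
  rcases le_or_gt ‖z‖ ρ with hle | hlt
  · have h7 : ‖z‖ ^ 2 ≤ ρ ^ 2 := by nlinarith
    rcases le_or_gt η 1 with h | h
    · have h8 : ρ ^ 2 ≤ ρ ^ 2 / η := by
        rw [le_div_iff₀ hη]; nlinarith [sq_nonneg ρ]
      nlinarith [sq_nonneg ‖y + z‖, sq_nonneg ‖z‖]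
    · nlinarith [sq_nonneg ‖y + z‖, sq_nonneg ‖z‖]
  · have h5 : (‖z‖ - ρ) ^ 2 ≤ ‖y + z‖ ^ 2 := by
      apply pow_le_pow_left₀ <;> linarith
    have h7 : 2 * ‖z‖ * ρ ≤ η * ‖z‖ ^ 2 + ρ ^ 2 / η := by
      have : 0 ≤ (η * ‖z‖ - ρ) ^ 2 / η := by positivity
      have e : (η * ‖z‖ - ρ) ^ 2 / η = η * ‖z‖ ^ 2 - 2 * ‖z‖ * ρ + ρ ^ 2 / η := by
        field_simp
        ring
      linarith
    nlinarith [sq_nonneg ρ]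

theorem norm_add_sq_le {η ρ : ℝ} (hη : 0 < η) {y z : E d} (hy : ‖y‖ ≤ ρ) :
    ‖y + z‖ ^ 2 ≤ (1 + η) * ‖z‖ ^ 2 + (1 + 1 / η) * ρ ^ 2 := by
  have hz := norm_nonneg z
  have hy0 := norm_nonneg y
  have h1 : ‖y + z‖ ≤ ρ + ‖z‖ := (norm_add_le y z).trans (by linarith)
  have h2 : ‖y + z‖ ^ 2 ≤ (ρ + ‖z‖) ^ 2 := pow_le_pow_left₀ (norm_nonneg _) h1 2
  have : 0 ≤ (η * ‖z‖ - ρ) ^ 2 / η := by positivity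
  have e : (η * ‖z‖ - ρ) ^ 2 / η = η * ‖z‖ ^ 2 - 2 * ‖z‖ * ρ + 1 / η * ρ ^ 2 := by
    field_simp
    ring
  nlinarith

/-- The density of the standard Gaussian measure. -/
def gaussDensity (d : ℕ) (x : E d) : ℝ :=
  (2 * Real.pi) ^ (-(d : ℝ) / 2) * Real.exp (-‖x‖ ^ 2 / 2)

theorem gaussMeasure_eq : gaussMeasure d =
    volume.withDensity fun x => ENNReal.ofReal (gaussDensity d x) := rfl

theorem measurable_gaussDensity : Measurable (gaussDensity d) := by
  unfold gaussDensity
  fun_prop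

theorem restrict_le_smul_withDensity {S : Set (E d)} (hS : MeasurableSet S) {ρ : E d → ℝ≥0∞}
    {c : ℝ≥0∞} (h : ∀ x ∈ S, 1 ≤ c * ρ x) (hρ : Measurable ρ) :
    (volume : Measure (E d)).restrict S ≤ c • volume.withDensity ρ := by
  refine Measure.le_iff.2 fun A hA => ?_
  rw [Measure.restrict_apply hA, Measure.smul_apply, withDensity_apply _ hA, smul_eq_mul,
    ← lintegral_const_mul c hρ, ← setLIntegral_one]
  refine (setLIntegral_mono' (hA.inter hS) fun x hx => h x hx.2).trans ?_
  exact lintegral_mono_set inter_subset_left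

/-- The Gaussian measure dominates Lebesgue measure on translated cubes. -/
theorem exists_setLIntegral_cube_le (η l : ℝ) (hη : 0 < η) (hl : 0 < l) :
    ∃ C : ℝ, 0 < C ∧ ∀ (z : E d) (F : E d → ℝ≥0∞),
      ∫⁻ y in cube d l, F (y + z)
        ≤ ENNReal.ofReal (C * Real.exp ((1 + η) / 2 * ‖z‖ ^ 2)) * ∫⁻ x, F x ∂gaussMeasure d := by
  set B := (1 + 1 / η) * (d * (l / 2)) ^ 2 with hB
  set A := (2 * Real.pi) ^ (-(d : ℝ) / 2) with hA
  have hA0 : 0 < A := by positivity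
  refine ⟨A⁻¹ * Real.exp (B / 2), by positivity, fun z F => ?_⟩
  set S : Set (E d) := (fun x => x - z) ⁻¹' cube d l with hS
  have hSm : MeasurableSet S := (measurable_id.sub_const z) (measurableSet_cube l)
  refine (setLIntegral_comp_add_le (measurableSet_cube l) hSm (z := z)
    (fun x hx => by simpa [hS] using hx) F).trans ?_
  have hle := restrict_le_smul_withDensity hSm (ρ := fun x => ENNReal.ofReal (gaussDensity d x))
    (c := ENNReal.ofReal (A⁻¹ * Real.exp (B / 2) * Real.exp ((1 + η) / 2 * ‖z‖ ^ 2)))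
    (fun x hx => ?_) measurable_gaussDensity.ennreal_ofReal
  · refine (lintegral_mono' hle le_rfl).trans (le_of_eq ?_)
    rw [lintegral_smul_measure]
    rfl
  · rw [← ENNReal.ofReal_mul (by positivity), ENNReal.one_le_ofReal]
    have h1 := norm_add_sq_le (z := z) hη (norm_le_of_mem_cube hl.le hx)
    rw [sub_add_cancel] at h1
    have : A⁻¹ * Real.exp (B / 2) * Real.exp ((1 + η) / 2 * ‖z‖ ^ 2) * gaussDensity d x
        = Real.exp (B / 2 + (1 + η) / 2 * ‖z‖ ^ 2 + -‖x‖ ^ 2 / 2) := by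
      rw [gaussDensity, ← hA, Real.exp_add, Real.exp_add]
      field_simp
    rw [this, Real.one_le_exp_iff]
    linarith

/-- The Gaussian measure is dominated by Lebesgue measure on translated cubes. -/
theorem exists_gauss_setLIntegral_le (η l : ℝ) (hη : 0 < η) (hl : 0 < l) :
    ∃ C : ℝ, 0 < C ∧ ∀ (z : E d) (S : Set (E d)) (_ : MeasurableSet S)
      (_ : ∀ x ∈ S, x - z ∈ cube d l) (F : E d → ℝ≥0∞),
      ∫⁻ x in S, F x ∂gaussMeasure d
        ≤ ENNReal.ofReal (C * Real.exp (-((1 - η) / 2 * ‖z‖ ^ 2))) *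
          ∫⁻ y in cube d l, F (y + z) := by
  set B := (d * (l / 2)) ^ 2 / η with hB
  set A := (2 * Real.pi) ^ (-(d : ℝ) / 2) with hA
  have hA0 : 0 < A := by positivity
  refine ⟨A * Real.exp (B / 2), by positivity, fun z S hS hSl F => ?_⟩
  set c := ENNReal.ofReal (A * Real.exp (B / 2) * Real.exp (-((1 - η) / 2 * ‖z‖ ^ 2))) with hc
  have hle : (gaussMeasure d).restrict S ≤ c • volume.restrict S := by
    rw [gaussMeasure_eq, restrict_withDensity hS, ← withDensity_const]
    refine withDensity_mono ?_
    refine ae_restrict_of_forall_mem hS fun x hx => ?_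
    apply ENNReal.ofReal_le_ofReal
    have h1 := norm_add_sq_ge (z := z) hη (norm_le_of_mem_cube hl.le (hSl x hx))
    rw [sub_add_cancel] at h1
    rw [gaussDensity, ← hA, mul_assoc, ← Real.exp_add]
    gcongr
    linarith
  refine (lintegral_mono' hle le_rfl).trans ?_
  rw [lintegral_smul_measure, smul_eq_mul]
  refine mul_le_mul_right ?_ _
  have := setLIntegral_comp_add_le hS (measurableSet_cube l) (z := -z)
    (fun x hx => by simpa [sub_eq_add_neg] using hSl x hx) (fun y => F (y + z))
  simpa using this

/-- With r = e^{-t}, polarization gives r²|x|² - 2r x·y + r²|y|² = r|x-y|² - r(1-r)(|x|²+|y|²), and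
1 - r² = (1-r)(1+r). This separates a heat-kernel factor from a growing factor, whose exponent tends
to (|x|²+|y|²)/4 as t → 0. -/
theorem mehlerKernel_eq {t : ℝ} (ht : 0 < t) (x y : E d) :
    mehlerKernel t x y = 1 / (1 - Real.exp (-2 * t)) ^ ((d : ℝ) / 2) *
      Real.exp (-(Real.exp (-t) * ‖x - y‖ ^ 2 / (2 * (1 - Real.exp (-2 * t))))
        + Real.exp (-t) / (2 * (1 + Real.exp (-t))) * (‖x‖ ^ 2 + ‖y‖ ^ 2)) := by
  have hr : Real.exp (-2 * t) = Real.exp (-t) ^ 2 := by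
    rw [← Real.exp_nat_mul]; congr 1; push_cast; ring
  have hr1 : Real.exp (-t) < 1 := Real.exp_lt_one_iff.2 (by linarith)
  have hr0 := Real.exp_pos (-t)
  rw [mehlerKernel, hr, norm_sub_sq_real]
  congr 2
  have h1 : 1 - Real.exp (-t) ≠ 0 := by linarith
  have h2 : 1 + Real.exp (-t) ≠ 0 := by linarith
  have h3 : 1 - Real.exp (-t) ^ 2 = (1 - Real.exp (-t)) * (1 + Real.exp (-t)) := by ring
  rw [h3]
  field_simp
  ring

/-- For times comparable to h² = |x-y|² the heat-kernel exponent is bounded by 1/(2τ) and the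
prefactor is of order h^{-d}. Since t ≤ η, also e^{-t} ≥ 1 - η, so the coefficient of the growing
exponent stays above (1-η)/4. -/
theorem mehlerKernel_ge {η τ h t S : ℝ} (hη : 0 < η) (hη1 : η ≤ 1 / 2) (hτ : 0 < τ) (hh : 0 < h)
    (hτh : 2 * τ * h ^ 2 ≤ η) (ht : t ∈ Ioo (τ * h ^ 2) (2 * τ * h ^ 2)) {x y : E d}
    (hxy : ‖x - y‖ = h) (hS : S ≤ ‖x‖ ^ 2 + ‖y‖ ^ 2) (hS' : 0 ≤ ‖x‖ ^ 2 + ‖y‖ ^ 2) :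
    (4 * τ * h ^ 2) ^ (-((d : ℝ) / 2)) * Real.exp (-(1 / (2 * τ)) + (1 - η) / 4 * S)
      ≤ mehlerKernel t x y := by
  have ht0 : 0 < t := lt_trans (by positivity) ht.1
  have htη : t ≤ η := ht.2.le.trans hτh
  have hr1 : Real.exp (-t) ≤ 1 := Real.exp_le_one_iff.2 (by linarith)
  have hr0 := Real.exp_pos (-t)
  have hrη : 1 - η ≤ Real.exp (-t) := by
    have := Real.add_one_le_exp (-t)
    linarith
  have h2t : 1 - Real.exp (-2 * t) ≤ 2 * t := by
    have := Real.add_one_le_exp (-2 * t)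
    linarith
  have ht2 : t ≤ 1 - Real.exp (-2 * t) := by
    have h1 : Real.exp (-2 * t) ≤ 1 / (1 + 2 * t) := by
      rw [show -2 * t = -(2 * t) by ring, Real.exp_neg, ← one_div]
      apply one_div_le_one_div_of_le (by positivity)
      have := Real.add_one_le_exp (2 * t)
      linarith
    -- This needs t ≤ 1/2, which follows from t ≤ η.
    have h2 : 1 / (1 + 2 * t) ≤ 1 - t := by
      rw [div_le_iff₀ (by positivity)]
      nlinarith
    linarith
  have hpos : 0 < 1 - Real.exp (-2 * t) := by linarith
  rw [mehlerKernel_eq ht0, hxy, one_div (_ ^ _), ← Real.rpow_neg hpos.le]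
  refine mul_le_mul ?_ (Real.exp_le_exp.2 (add_le_add (neg_le_neg ?_) ?_)) (Real.exp_pos _).le
    (by positivity)
  · refine Real.rpow_le_rpow_of_nonpos hpos ?_ (neg_nonpos.2 (by positivity))
    have := ht.2
    linarith
  · rw [div_le_div_iff₀ (by positivity) (by positivity)]
    have h1 : τ * h ^ 2 ≤ 1 - Real.exp (-2 * t) := ht.1.le.trans ht2
    have h2 : Real.exp (-t) * h ^ 2 ≤ h ^ 2 := mul_le_of_le_one_left (by positivity) hr1
    nlinarith
  · refine (mul_le_mul_of_nonneg_left hS (by linarith)).trans ?_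
    refine mul_le_mul_of_nonneg_right ?_ hS'
    rw [div_le_div_iff₀ (by positivity) (by positivity)]
    nlinarith

/-- Near the diagonal the Ornstein-Uhlenbeck kernel dominates the Gagliardo kernel, and it grows
like `exp (|z|² / 2)`. -/
theorem exists_gagliardoKernel_le_ouKernel (hd : 1 ≤ d) {σ η l : ℝ} (hσ : 0 ≤ σ) (hη : 0 < η)
    (hη1 : η ≤ 1 / 2) (hl : 0 < l) :
    ∃ C : ℝ, 0 < C ∧ ∀ z : E d, ∀ x ∈ cube d l, ∀ y ∈ cube d l, gagliardoKernel d σ x y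
      ≤ ENNReal.ofReal (C * Real.exp (-((1 / 2 - η) * ‖z‖ ^ 2))) *
        ouKernel d σ (x + z) (y + z) := by
  have hd0 : (0 : ℝ) < d := by exact_mod_cast hd
  set D : ℝ := d * l + 1 with hD
  have hD0 : 0 < D := by positivity
  -- Chosen so that 2τ|x-y|² ≤ η for all pairs of points in the cube.
  set τ : ℝ := η / (2 * D ^ 2) with hτ
  have hτ0 : 0 < τ := by positivity
  set ρ : ℝ := d * (l / 2) with hρ
  set c₁ : ℝ := (4 * τ) ^ (-((d : ℝ) / 2)) with hc₁
  set c₂ : ℝ := (2 * τ) ^ (-(σ / 2 + 1)) with hc₂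
  have hc₁0 : 0 < c₁ := by positivity
  have hc₂0 : 0 < c₂ := by positivity
  set c₃ : ℝ := Real.exp (-(1 / (2 * τ)) - ρ ^ 2 / (2 * η)) with hc₃
  have hc₃0 : 0 < c₃ := Real.exp_pos _
  refine ⟨(c₁ * c₂ * c₃ * τ)⁻¹, by positivity, fun z x hx y hy => ?_⟩
  have hzero : -((d : ℝ) + σ) ≠ 0 := by linarith
  -- On the diagonal `gagliardoKernel` is 0, because `Real.rpow` sends 0 to 0 for a nonzero
  -- exponent.
  rcases (norm_nonneg (x - y)).eq_or_lt with h0 | h0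
  · rw [gagliardoKernel, ← h0, Real.zero_rpow hzero]
    simp
  set h := ‖x - y‖ with hh
  have hhD : h < D := norm_sub_lt_of_mem_cube hl hx hy
  have hτh : 2 * τ * h ^ 2 ≤ η := by
    have : h ^ 2 ≤ D ^ 2 := pow_le_pow_left₀ h0.le hhD.le 2
    calc 2 * τ * h ^ 2 ≤ 2 * τ * D ^ 2 := by gcongr
      _ = η := by rw [hτ]; field_simp
  set S : ℝ := 2 * ((1 - η) * ‖z‖ ^ 2 - ρ ^ 2 / η) with hS
  have hSle : S ≤ ‖x + z‖ ^ 2 + ‖y + z‖ ^ 2 := by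
    have h1 := norm_add_sq_ge (z := z) hη (norm_le_of_mem_cube hl.le hx)
    have h2 := norm_add_sq_ge (z := z) hη (norm_le_of_mem_cube hl.le hy)
    linarith
  set L : ℝ := (4 * τ * h ^ 2) ^ (-((d : ℝ) / 2)) *
    Real.exp (-(1 / (2 * τ)) + (1 - η) / 4 * S) * (2 * τ * h ^ 2) ^ (-(σ / 2 + 1)) with hL
  have hL0 : 0 ≤ L := by positivity
  -- Only times between τh² and 2τh² are kept. The window has length τh², and (h²)^{-d/2}
  -- (h²)^{-σ/2-1} h² = h^{-d-σ} is the Gagliardo power.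
  have hou : ENNReal.ofReal (L * (τ * h ^ 2)) ≤ ouKernel d σ (x + z) (y + z) := by
    calc ENNReal.ofReal (L * (τ * h ^ 2))
        = ∫⁻ _t in Ioo (τ * h ^ 2) (2 * τ * h ^ 2), ENNReal.ofReal L := by
          rw [setLIntegral_const, Real.volume_Ioo, ← ENNReal.ofReal_mul hL0]
          congr 2
          ring
      _ ≤ ∫⁻ t in Ioo (τ * h ^ 2) (2 * τ * h ^ 2),
            ENNReal.ofReal (mehlerKernel t (x + z) (y + z) / t ^ (σ / 2 + 1)) := by
          refine setLIntegral_mono' measurableSet_Ioo fun t ht => ?_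
          apply ENNReal.ofReal_le_ofReal
          have ht0 : 0 < t := lt_trans (by positivity) ht.1
          rw [div_eq_mul_inv, ← Real.rpow_neg ht0.le, hL]
          have hm := mehlerKernel_ge (d := d) (x := x + z) (y := y + z) hη hη1 hτ0 h0 hτh ht
            (by rw [add_sub_add_right_eq_sub]) hSle (by positivity)
          refine mul_le_mul hm ?_ (by positivity) (le_trans (by positivity) hm)
          exact Real.rpow_le_rpow_of_nonpos ht0 ht.2.le (by linarith)
      _ ≤ _ := by
          refine lintegral_mono_set fun t ht => ?_
          exact lt_trans (by positivity) ht.1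
  refine le_trans ?_ (mul_le_mul_right hou _)
  rw [← ENNReal.ofReal_mul (by positivity), gagliardoKernel]
  apply ENNReal.ofReal_le_ofReal
  have e1 : (4 * τ * h ^ 2) ^ (-((d : ℝ) / 2)) = c₁ * h ^ (-(d : ℝ)) := by
    rw [Real.mul_rpow (by positivity) (by positivity), ← Real.rpow_natCast h 2,
      ← Real.rpow_mul h0.le]
    congr 2
    push_cast
    ring
  have e2 : (2 * τ * h ^ 2) ^ (-(σ / 2 + 1)) = c₂ * h ^ (-σ - 2) := by
    rw [Real.mul_rpow (by positivity) (by positivity), ← Real.rpow_natCast h 2,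
      ← Real.rpow_mul h0.le]
    congr 2
    push_cast
    ring
  have e3 : h ^ (-((d : ℝ) + σ)) = h ^ (-(d : ℝ)) * h ^ (-σ - 2) * h ^ 2 := by
    rw [← Real.rpow_natCast h 2, ← Real.rpow_add h0, ← Real.rpow_add h0]
    congr 1
    push_cast
    ring
  have e4 : c₃ * Real.exp ((1 / 2 - η) * ‖z‖ ^ 2)
      ≤ Real.exp (-(1 / (2 * τ)) + (1 - η) / 4 * S) := by
    rw [hc₃, ← Real.exp_add]
    apply Real.exp_le_exp.2
    have h1 : (1 - η) / 4 * S = (1 - η) ^ 2 / 2 * ‖z‖ ^ 2 - (1 - η) * (ρ ^ 2 / (2 * η)) := by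
      rw [hS]; field_simp; ring
    have h2 : (1 / 2 - η) * ‖z‖ ^ 2 ≤ (1 - η) ^ 2 / 2 * ‖z‖ ^ 2 := by
      gcongr
      nlinarith
    have h3 : 0 ≤ η * (ρ ^ 2 / (2 * η)) := by positivity
    linarith
  rw [hL, e1, e2, e3, Real.exp_neg]
  have hE := Real.exp_pos ((1 / 2 - η) * ‖z‖ ^ 2)
  set P := h ^ (-(d : ℝ)) with hP
  set R := h ^ (-σ - 2) with hR
  have hP0 : 0 ≤ P := by positivity
  have hR0 : 0 ≤ R := by positivity
  calc P * R * h ^ 2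
      = (c₁ * c₂ * c₃ * τ)⁻¹ * (Real.exp ((1 / 2 - η) * ‖z‖ ^ 2))⁻¹ *
        (c₁ * P * (c₃ * Real.exp ((1 / 2 - η) * ‖z‖ ^ 2)) * (c₂ * R) * (τ * h ^ 2)) := by
        field_simp
    _ ≤ _ := by gcongr

/-! ### Local bounds for functions of Gaussian Sobolev spaces -/

/-- On translated cubes the kernel `κ` dominates the Gagliardo kernel, with a gain
`exp (θ |z|²)`. -/
def KernelDominates (κ : E d → E d → ℝ≥0∞) (σ θ : ℝ) : Prop :=
  ∀ l : ℝ, 0 < l → ∃ C : ℝ, 0 < C ∧ ∀ z : E d, ∀ x ∈ cube d l, ∀ y ∈ cube d l,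
    gagliardoKernel d σ x y
      ≤ ENNReal.ofReal (C * Real.exp (-(θ * ‖z‖ ^ 2))) * κ (x + z) (y + z)

theorem kernelDominates_gagliardoKernel (σ : ℝ) :
    KernelDominates (gagliardoKernel d σ) σ 0 := fun l _ =>
  ⟨1, one_pos, fun z x _ y _ => by simp [gagliardoKernel]⟩

theorem kernelDominates_ouKernel (hd : 1 ≤ d) {σ η : ℝ} (hσ : 0 ≤ σ) (hη : 0 < η)
    (hη1 : η ≤ 1 / 2) : KernelDominates (ouKernel d σ) σ (1 / 2 - η) := fun _ hl =>
  exists_gagliardoKernel_le_ouKernel hd hσ hη hη1 hl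

theorem gaussMeasure_absolutelyContinuous : gaussMeasure d ≪ volume :=
  withDensity_absolutelyContinuous _ _

/-- The versions chosen by `weakDeriv` are only almost everywhere measurable; measurable
representatives make Fubini and the product estimates directly applicable. Orders above ⌊s⌋ get the
value 0. -/
theorem exists_isWeakDerivFamily {μ : Measure (E d)} {κ : E d → E d → ℝ≥0∞} {s p : ℝ}
    {f : E d → ℝ} (hf : MemSob univ μ κ s p f) :
    ∃ v : (Fin d → ℕ) → E d → ℝ, IsWeakDerivFamily ⌊s⌋₊ f v ∧
      ∀ β : Fin d → ℕ, ∑ i, β i ≤ ⌊s⌋₊ →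
        v β =ᵐ[volume] weakDeriv (interior univ) β f := by
  have h : ∀ β : Fin d → ℕ, ∃ u : E d → ℝ, Measurable u ∧ (∑ i, β i ≤ ⌊s⌋₊ →
      IsWeakDeriv univ β f u ∧ u =ᵐ[volume] weakDeriv (interior univ) β f) := by
    intro β
    by_cases hβ : ∑ i, β i ≤ ⌊s⌋₊
    · have h1 := isWeakDeriv_weakDeriv (hf.1 β (mem_multiLE.2 hβ)).1
      have hm : AEMeasurable (weakDeriv (interior univ) β f) volume := by
        have h2 := h1.2.1
        rw [interior_univ, locallyIntegrableOn_univ] at h2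
        rw [interior_univ]
        exact h2.aestronglyMeasurable.aemeasurable
      refine ⟨hm.mk, hm.measurable_mk, fun _ => ⟨?_, hm.ae_eq_mk.symm⟩⟩
      rw [interior_univ] at h1
      refine h1.congr (Filter.EventuallyEq.refl _ _) ?_
      rw [Measure.restrict_univ]
      have := hm.ae_eq_mk
      simpa only [interior_univ] using this
    · exact ⟨0, measurable_zero, fun h => absurd h hβ⟩
  choose v hvm hv using h
  exact ⟨v, ⟨fun β hβ => (hv β hβ).1, hvm⟩, fun β hβ => (hv β hβ).2⟩

theorem IsWeakDerivFamily.translate {k : ℕ} {f : E d → ℝ} {v : (Fin d → ℕ) → E d → ℝ}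
    (h : IsWeakDerivFamily k f v) (z : E d) :
    IsWeakDerivFamily k (fun x => f (x + z)) fun β x => v β (x + z) :=
  ⟨fun β hβ => (h.isWeakDeriv β hβ).translate z,
    fun β => (h.measurable β).comp (measurable_id.add_const z)⟩

theorem sobNorm_lt_top {U : Set (E d)} {μ : Measure (E d)} {κ : E d → E d → ℝ≥0∞} {s p : ℝ}
    (hp : 0 < p) {f : E d → ℝ} (hf : MemSob U μ κ s p f) : sobNorm U μ κ s p f < ∞ := by
  rw [sobNorm, ENNReal.add_lt_top]
  constructor
  · refine ENNReal.rpow_lt_top_of_nonneg (by positivity) (ENNReal.sum_lt_top.2 fun α hα => ?_).ne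
    exact ENNReal.rpow_lt_top_of_nonneg hp.le (hf.1 α hα).2.2.ne
  · split_ifs with hi
    · exact ENNReal.zero_lt_top
    · exact hf.2 hi

theorem lintegral_weakDeriv_le_sobNorm {U : Set (E d)} {μ : Measure (E d)}
    {κ : E d → E d → ℝ≥0∞} {s p : ℝ} (hp : 0 < p) {f : E d → ℝ} {β : Fin d → ℕ}
    (hβ : ∑ i, β i ≤ ⌊s⌋₊) :
    ∫⁻ x, ‖weakDeriv (interior U) β f x‖ₑ ^ p ∂μ ≤ sobNorm U μ κ s p f ^ p := by
  have hp' : p ≠ 0 := hp.ne'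
  calc _ ≤ intNorm U μ ⌊s⌋₊ p f ^ p := by
        rw [intNorm, ← ENNReal.rpow_mul, one_div_mul_cancel hp', ENNReal.rpow_one,
          ← eLpNorm_ofReal_rpow hp]
        exact Finset.single_le_sum
          (f := fun α => eLpNorm (weakDeriv (interior U) α f) (ENNReal.ofReal p) μ ^ p)
          (fun _ _ => zero_le) (mem_multiLE.2 hβ)
    _ ≤ _ := ENNReal.rpow_le_rpow le_self_add hp.le

theorem lintegral_weakDeriv_sub_le_sobNorm {U : Set (E d)} {μ : Measure (E d)}
    {κ : E d → E d → ℝ≥0∞} {s p : ℝ} (hp : 0 < p) (hi : ¬ IsIntegerOrder s) {f : E d → ℝ}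
    {β : Fin d → ℕ} (hβ : ∑ i, β i = ⌊s⌋₊) :
    ∫⁻ y, ∫⁻ x, ‖weakDeriv (interior U) β f x - weakDeriv (interior U) β f y‖ₑ ^ p * κ x y ∂μ ∂μ
      ≤ sobNorm U μ κ s p f ^ p := by
  have hp' : p ≠ 0 := hp.ne'
  set I := ∫⁻ y, ∫⁻ x, ‖weakDeriv (interior U) β f x - weakDeriv (interior U) β f y‖ₑ ^ p *
    κ x y ∂μ ∂μ with hI
  calc I = (I ^ (1 / p)) ^ p := by
        rw [← ENNReal.rpow_mul, one_div_mul_cancel hp', ENNReal.rpow_one]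
    _ ≤ fracSeminorm U μ κ ⌊s⌋₊ p f ^ p := by
        refine ENNReal.rpow_le_rpow ?_ hp.le
        exact Finset.single_le_sum (f := fun α => (∫⁻ y, ∫⁻ x, ‖weakDeriv (interior U) α f x -
          weakDeriv (interior U) α f y‖ₑ ^ p * κ x y ∂μ ∂μ) ^ (1 / p))
          (fun _ _ => zero_le) (mem_multiEQ.2 hβ)
    _ ≤ _ := by
        refine ENNReal.rpow_le_rpow ?_ hp.le
        rw [sobNorm, if_neg hi]
        exact le_add_self

/-- The local energies of a translate are controlled by the Gaussian Sobolev norm. -/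
theorem exists_sobEnergy_translate_le {s p η θ l : ℝ} (hp : 0 < p) (hη : 0 < η) (hθ : θ ≤ 1 / 2)
    (hl : 0 < l) {κ : E d → E d → ℝ≥0∞}
    (hκ : ¬ IsIntegerOrder s → KernelDominates κ (Int.fract s * p) θ) :
    ∃ C : ℝ≥0∞, C < ∞ ∧ ∀ (f : E d → ℝ) (v : (Fin d → ℕ) → E d → ℝ),
      (∀ β : Fin d → ℕ, ∑ i, β i ≤ ⌊s⌋₊ → v β =ᵐ[volume] weakDeriv (interior univ) β f) →
      ∀ z : E d, sobEnergy (cube d l) s p (fun β x => v β (x + z))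
        ≤ C * (ENNReal.ofReal (Real.exp ((1 + η - θ) * ‖z‖ ^ 2)) *
          sobNorm univ (gaussMeasure d) κ s p f ^ p) := by
  obtain ⟨A, hA, hA'⟩ := exists_setLIntegral_cube_le (d := d) η l hη hl
  obtain ⟨B, hB, hB'⟩ : ∃ B : ℝ, 0 < B ∧ (¬ IsIntegerOrder s →
      ∀ z : E d, ∀ x ∈ cube d l, ∀ y ∈ cube d l, gagliardoKernel d (Int.fract s * p) x y
        ≤ ENNReal.ofReal (B * Real.exp (-(θ * ‖z‖ ^ 2))) * κ (x + z) (y + z)) := by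
    by_cases hi : IsIntegerOrder s
    · exact ⟨1, one_pos, fun h => absurd hi h⟩
    · obtain ⟨B, hB, hB'⟩ := hκ hi l hl
      exact ⟨B, hB, fun _ => hB'⟩
  refine ⟨∑ _β ∈ multiLE d ⌊s⌋₊, ENNReal.ofReal (A + B * A * A) +
      ∑ _β ∈ multiEQ d ⌊s⌋₊, ENNReal.ofReal (A + B * A * A),
    ENNReal.add_lt_top.2 ⟨ENNReal.sum_lt_top.2 fun _ _ => ENNReal.ofReal_lt_top,
      ENNReal.sum_lt_top.2 fun _ _ => ENNReal.ofReal_lt_top⟩, fun f v hv z => ?_⟩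
  set N := sobNorm univ (gaussMeasure d) κ s p f with hN
  have hvγ : ∀ β : Fin d → ℕ, ∑ i, β i ≤ ⌊s⌋₊ →
      v β =ᵐ[gaussMeasure d] weakDeriv (interior univ) β f := fun β hβ =>
    gaussMeasure_absolutelyContinuous.ae_eq (hv β hβ)
  refine sobEnergy_le_of_forall (fun β hβ => ?_) (fun hi β hβ => ?_)
  · have h1 := hA' z fun x => ‖v β x‖ₑ ^ p
    have h2 : ∫⁻ x, ‖v β x‖ₑ ^ p ∂gaussMeasure d ≤ N ^ p := by
      refine le_trans (le_of_eq (lintegral_congr_ae ?_)) (lintegral_weakDeriv_le_sobNorm hp hβ)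
      filter_upwards [hvγ β hβ] with x hx
      rw [hx]
    refine h1.trans ((mul_le_mul_right h2 _).trans ?_)
    rw [← mul_assoc, ← ENNReal.ofReal_mul (by positivity)]
    refine mul_le_mul_left (ENNReal.ofReal_le_ofReal ?_) _
    refine mul_le_mul ?_ ?_ (Real.exp_pos _).le (by positivity)
    · have : 0 < B * A * A := by positivity
      linarith
    -- The L_p terms cost only the exponent (1+η)/2, which is at most 1 + η - θ because θ ≤ 1/2.
    · apply Real.exp_le_exp.2
      refine mul_le_mul_of_nonneg_right ?_ (by positivity)
      linarith
  · set k₁ := ENNReal.ofReal (B * Real.exp (-(θ * ‖z‖ ^ 2))) with hk₁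
    set k₂ := ENNReal.ofReal (A * Real.exp ((1 + η) / 2 * ‖z‖ ^ 2)) with hk₂
    have hk₂t : k₂ ≠ ∞ := ENNReal.ofReal_ne_top
    have hk₁t : k₁ ≠ ∞ := ENNReal.ofReal_ne_top
    have h2 : ∫⁻ y, ∫⁻ x, ‖v β x - v β y‖ₑ ^ p * κ x y ∂gaussMeasure d ∂gaussMeasure d
        ≤ N ^ p := by
      refine le_trans (le_of_eq (lintegral_congr_ae ?_))
        (lintegral_weakDeriv_sub_le_sobNorm hp hi hβ)
      filter_upwards [hvγ β hβ.le] with y hy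
      refine lintegral_congr_ae ?_
      filter_upwards [hvγ β hβ.le] with x hx
      rw [hx, hy]
    -- Each of the two changes from Lebesgue to Gaussian measure costs exp((1+η)/2·|z|²), and the
    -- kernel comparison gives back exp(-θ|z|²).
    calc gagliardo (cube d l) (Int.fract s * p) p (fun x => v β (x + z))
        ≤ ∫⁻ y in cube d l, ∫⁻ x in cube d l,
            k₁ * (‖v β (x + z) - v β (y + z)‖ₑ ^ p * κ (x + z) (y + z)) := by
          refine setLIntegral_mono' (measurableSet_cube l) fun y hy =>
            setLIntegral_mono' (measurableSet_cube l) fun x hx => ?_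
          refine (mul_le_mul_right (hB' hi z x hx y hy) _).trans (le_of_eq ?_)
          rw [mul_left_comm]
      _ = k₁ * ∫⁻ y in cube d l, ∫⁻ x in cube d l,
            ‖v β (x + z) - v β (y + z)‖ₑ ^ p * κ (x + z) (y + z) := by
          rw [← lintegral_const_mul' _ _ hk₁t]
          refine lintegral_congr fun y => ?_
          rw [lintegral_const_mul' _ _ hk₁t]
      _ ≤ k₁ * ∫⁻ y in cube d l, k₂ * ∫⁻ x, ‖v β x - v β (y + z)‖ₑ ^ p * κ x (y + z)
            ∂gaussMeasure d := by
          refine mul_le_mul_right (lintegral_mono fun y => ?_) _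
          exact hA' z fun x => ‖v β x - v β (y + z)‖ₑ ^ p * κ x (y + z)
      _ ≤ k₁ * (k₂ * (k₂ * N ^ p)) := by
          rw [lintegral_const_mul' _ _ hk₂t]
          refine mul_le_mul_right (mul_le_mul_right ?_ _) _
          refine (hA' z fun y => ∫⁻ x, ‖v β x - v β y‖ₑ ^ p * κ x y ∂gaussMeasure d).trans ?_
          exact mul_le_mul_right h2 _
      _ = ENNReal.ofReal (B * A * A * Real.exp ((1 + η - θ) * ‖z‖ ^ 2)) * N ^ p := by
          rw [← mul_assoc, ← mul_assoc, hk₁, hk₂, ← ENNReal.ofReal_mul (by positivity),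
            ← ENNReal.ofReal_mul (by positivity)]
          congr 2
          have : (1 + η - θ) * ‖z‖ ^ 2 = -(θ * ‖z‖ ^ 2) + (1 + η) / 2 * ‖z‖ ^ 2 +
              (1 + η) / 2 * ‖z‖ ^ 2 := by ring
          rw [this, Real.exp_add, Real.exp_add]
          ring
      _ ≤ _ := by
          rw [← mul_assoc, ← ENNReal.ofReal_mul (by positivity)]
          gcongr
          linarith

/-- The translates of a function of a Gaussian Sobolev space, cut off and periodized, belong to
the periodic class, with norm bounds that grow like a Gaussian exponential. -/
theorem exists_local_bound (hd : 1 ≤ d) {s p η θ : ℝ} (hp : 1 < p) (hη : 0 < η) (hθ : θ ≤ 1 / 2)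
    (χ : smoothFn d) (hχ : HasCompactSupport (χ : E d → ℝ))
    (hχ0 : VanishesOutside (χ : E d → ℝ)) {κ : E d → E d → ℝ≥0∞}
    (hκ : ¬ IsIntegerOrder s → KernelDominates κ (Int.fract s * p) θ) :
    ∃ C : ℝ, 0 < C ∧ ∀ f : E d → ℝ, MemSob univ (gaussMeasure d) κ s p f → ∀ z : E d,
      MemPerSob d s p (periodize fun x => (χ : E d → ℝ) x * f (x + z)) ∧
      cubeSobNorm d 1 s p (periodize fun x => (χ : E d → ℝ) x * f (x + z))
        ≤ ENNReal.ofReal (C * Real.exp ((1 + η - θ) / p * ‖z‖ ^ 2)) *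
          sobNorm univ (gaussMeasure d) κ s p f ∧
      eLpNorm (fun x => f (x + z)) (ENNReal.ofReal p) (cubeMeasure d 1)
        ≤ ENNReal.ofReal (C * Real.exp ((1 + η - θ) / p * ‖z‖ ^ 2)) *
          sobNorm univ (gaussMeasure d) κ s p f := by
  have hp0 : 0 < p := by linarith
  have hp1 : 0 ≤ 1 / p := by positivity
  obtain ⟨A, hA, hχA⟩ := exists_periodize_cutoff hd (s := s) hp χ hχ hχ0
  obtain ⟨B, hB, hB'⟩ := exists_sobEnergy_translate_le (d := d) (l := 1) hp0 hη hθ one_pos hκ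
  have hBp : B ^ (1 / p) < ∞ := ENNReal.rpow_lt_top_of_nonneg hp1 hB.ne
  have hC : (A + 1) * B ^ (1 / p) + 1 < ∞ := ENNReal.add_lt_top.2
    ⟨ENNReal.mul_lt_top (ENNReal.add_lt_top.2 ⟨hA, ENNReal.one_lt_top⟩) hBp, ENNReal.one_lt_top⟩
  refine ⟨((A + 1) * B ^ (1 / p) + 1).toReal,
    ENNReal.toReal_pos (by simp) hC.ne, fun f hf z => ?_⟩
  set N := sobNorm univ (gaussMeasure d) κ s p f with hN
  have hNt : N < ∞ := sobNorm_lt_top hp0 hf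
  obtain ⟨v, hv, hvw⟩ := exists_isWeakDerivFamily hf
  have hvz := hv.translate z
  have hfin : ∀ l, 0 < l → sobEnergy (cube d l) s p (fun β x => v β (x + z)) < ∞ := by
    intro l hl
    obtain ⟨B₂, hB₂, hB₂'⟩ := exists_sobEnergy_translate_le (d := d) hp0 hη hθ hl hκ
    exact (hB₂' f v hvw z).trans_lt (ENNReal.mul_lt_top hB₂
      (ENNReal.mul_lt_top ENNReal.ofReal_lt_top (ENNReal.rpow_lt_top_of_nonneg hp0.le hNt.ne)))
  have hE : sobEnergy (cube d 1) s p (fun β x => v β (x + z)) ^ (1 / p)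
      ≤ B ^ (1 / p) * (ENNReal.ofReal (Real.exp ((1 + η - θ) / p * ‖z‖ ^ 2)) * N) := by
    refine (ENNReal.rpow_le_rpow (hB' f v hvw z) hp1).trans (le_of_eq ?_)
    rw [ENNReal.mul_rpow_of_nonneg _ _ hp1, ENNReal.mul_rpow_of_nonneg _ _ hp1,
      ← ENNReal.rpow_mul, mul_one_div_cancel hp0.ne', ENNReal.rpow_one,
      ENNReal.ofReal_rpow_of_nonneg (Real.exp_pos _).le hp1, ← Real.exp_mul]
    congr 4
    ring
  -- Used with A' = A for the norm of the periodization and with A' = 1 for the plain L_p norm.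
  have hfinal : ∀ A' : ℝ≥0∞, A' ≤ A + 1 →
      A' * sobEnergy (cube d 1) s p (fun β x => v β (x + z)) ^ (1 / p)
        ≤ ENNReal.ofReal (((A + 1) * B ^ (1 / p) + 1).toReal *
          Real.exp ((1 + η - θ) / p * ‖z‖ ^ 2)) * N := by
    intro A' hA'
    rw [ENNReal.ofReal_mul ENNReal.toReal_nonneg, ENNReal.ofReal_toReal hC.ne, mul_assoc]
    calc _ ≤ (A + 1) *
          (B ^ (1 / p) * (ENNReal.ofReal (Real.exp ((1 + η - θ) / p * ‖z‖ ^ 2)) * N)) :=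
          mul_le_mul' hA' hE
      _ ≤ _ := by
          rw [← mul_assoc, add_mul (_ * _) 1]
          exact le_self_add
  obtain ⟨h1, h2⟩ := hχA (fun x => f (x + z)) _ hvz hfin
  refine ⟨h1, h2.trans (hfinal A le_self_add), ?_⟩
  refine le_trans ?_ (hfinal 1 le_add_self)
  rw [one_mul, eLpNorm_ofReal_eq hp0]
  refine ENNReal.rpow_le_rpow ?_ hp1
  refine le_trans (le_of_eq ?_) (lpEnergy_le_sobEnergy (β := (0 : Fin d → ℕ)) (by simp))
  have h0 := hvz.isWeakDeriv 0 (by simp)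
  have hae := (isWeakDeriv_zero h0.1).ae_eq isOpen_univ h0
  rw [Measure.restrict_univ] at hae
  exact lpEnergy_congr (ae_restrict_of_ae hae)

/-! ### The tiling by half-cubes and the distribution of the budget -/

/-- The centers `k / 2` of the tiles. -/
def center (k : Fin d → ℤ) : E d := WithLp.toLp 2 fun i => (k i : ℝ) / 2

@[simp] theorem center_apply (k : Fin d → ℤ) (i : Fin d) : center k i = k i / 2 := rfl

/-- The half-open cube of side `1/2` around `center k`. -/
def tile (k : Fin d → ℤ) : Set (E d) :=
  {x | ∀ i, (k i : ℝ) / 2 - 1 / 4 ≤ x i ∧ x i < (k i : ℝ) / 2 + 1 / 4}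

theorem measurableSet_tile (k : Fin d → ℤ) : MeasurableSet (tile k) := by
  have : tile k = ⋂ i, ({x : E d | (k i : ℝ) / 2 - 1 / 4 ≤ x i} ∩
      {x : E d | x i < (k i : ℝ) / 2 + 1 / 4}) := by
    ext; simp [tile]
  rw [this]
  exact MeasurableSet.iInter fun i =>
    (measurableSet_le measurable_const (by fun_prop)).inter
      (measurableSet_lt (by fun_prop) measurable_const)

theorem mem_tile_iff {k : Fin d → ℤ} {x : E d} : x ∈ tile k ↔ ∀ i, k i = ⌊2 * x i + 1 / 2⌋ := by
  refine forall_congr' fun i => ?_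
  rw [eq_comm, Int.floor_eq_iff]
  constructor <;> rintro ⟨h1, h2⟩ <;> constructor <;> linarith

theorem pairwise_disjoint_tile : Pairwise (Function.onFun Disjoint (tile (d := d))) := by
  intro k k' hkk'
  refine Set.disjoint_left.2 fun x hx hx' => hkk' ?_
  funext i
  rw [mem_tile_iff.1 hx i, mem_tile_iff.1 hx' i]

theorem iUnion_tile : ⋃ k, tile (d := d) k = univ :=
  eq_univ_of_forall fun x => mem_iUnion.2
    ⟨fun i => ⌊2 * x i + 1 / 2⌋, mem_tile_iff.2 fun _ => rfl⟩

theorem sub_center_mem_cube {k : Fin d → ℤ} {x : E d} (hx : x ∈ tile k) :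
    x - center k ∈ cube d (1 / 2) := by
  intro i
  have := hx i
  rw [PiLp.sub_apply, center_apply, abs_le]
  constructor <;> linarith

theorem tile_eq_preimage (k : Fin d → ℤ) : tile k = (fun x => x - center k) ⁻¹' tile 0 := by
  ext x
  refine forall_congr' fun i => ?_
  simp only [PiLp.sub_apply, center_apply, Pi.zero_apply, Int.cast_zero, zero_div]
  constructor <;> rintro ⟨h1, h2⟩ <;> constructor <;> linarith

theorem lintegral_eq_tsum_tile (μ : Measure (E d)) (F : E d → ℝ≥0∞) :
    ∫⁻ x, F x ∂μ = ∑' k, ∫⁻ x in tile k, F x ∂μ := by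
  rw [← lintegral_iUnion measurableSet_tile pairwise_disjoint_tile, iUnion_tile,
    Measure.restrict_univ]

theorem volume_tile_zero_pos : 0 < volume (tile (0 : Fin d → ℤ)) := by
  refine lt_of_lt_of_le (IsOpen.measure_pos volume (isOpen_openCube (d := d) (1 / 2))
    ⟨0, fun i => by simp⟩) (measure_mono fun x hx i => ?_)
  have := abs_lt.1 (hx i)
  simp only [Pi.zero_apply, Int.cast_zero, zero_div]
  constructor <;> linarith

/-- The Bochner integral of a non-integrable function is 0, whereas the Gaussian integral formula
gives a positive value. -/
theorem integrable_exp_neg_mul_sq_norm {b : ℝ} (hb : 0 < b) :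
    Integrable fun x : E d => Real.exp (-b * ‖x‖ ^ 2) := by
  by_contra h
  have h1 := GaussianFourier.integral_rexp_neg_mul_sq_norm (V := E d) hb
  rw [integral_undef h] at h1
  have : 0 < (Real.pi / b) ^ (Module.finrank ℝ (E d) / 2 : ℝ) := by positivity
  linarith

/-- The Gaussian weights of the centers are summable. -/
theorem tsum_exp_center_lt_top {ε : ℝ} (hε : 0 < ε) :
    ∑' k : Fin d → ℤ, ENNReal.ofReal (Real.exp (-(ε * ‖center k‖ ^ 2))) < ∞ := by
  set ρ : ℝ := d * (1 / 2 / 2) with hρ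
  have hint := (integrable_exp_neg_mul_sq_norm (d := d) (half_pos hε)).lintegral_lt_top
  have hvol : ∀ k : Fin d → ℤ, volume (tile k) = volume (tile (0 : Fin d → ℤ)) := by
    intro k
    rw [tile_eq_preimage]
    simp only [sub_eq_add_neg]
    exact measure_preimage_add_right _ _ _
  -- On a tile |x|² ≤ 2|z|² + 2ρ², so a term of the series is bounded by a multiple of the integral
  -- of exp(-ε|x|²/2) over that tile.
  have h1 : ∀ k : Fin d → ℤ, ENNReal.ofReal (Real.exp (-(ε * ‖center k‖ ^ 2))) *
      volume (tile (0 : Fin d → ℤ)) ≤ ENNReal.ofReal (Real.exp (ε * ρ ^ 2)) *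
        ∫⁻ x in tile k, ENNReal.ofReal (Real.exp (-(ε / 2) * ‖x‖ ^ 2)) := by
    intro k
    rw [← lintegral_const_mul' _ _ ENNReal.ofReal_ne_top, ← hvol k, ← setLIntegral_const]
    refine setLIntegral_mono' (measurableSet_tile k) fun x hx => ?_
    rw [← ENNReal.ofReal_mul (Real.exp_pos _).le, ← Real.exp_add]
    apply ENNReal.ofReal_le_ofReal
    apply Real.exp_le_exp.2
    have h2 := norm_add_sq_le (z := center k) one_pos
      (norm_le_of_mem_cube (by norm_num) (sub_center_mem_cube hx))
    rw [sub_add_cancel, ← hρ] at h2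
    nlinarith
  have h2 : (∑' k : Fin d → ℤ, ENNReal.ofReal (Real.exp (-(ε * ‖center k‖ ^ 2)))) *
      volume (tile (0 : Fin d → ℤ)) < ∞ := by
    rw [← ENNReal.tsum_mul_right]
    refine (ENNReal.tsum_le_tsum h1).trans_lt ?_
    rw [ENNReal.tsum_mul_left, ← lintegral_eq_tsum_tile]
    exact ENNReal.mul_lt_top ENNReal.ofReal_lt_top hint
  by_contra h
  rw [not_lt, top_le_iff] at h
  rw [h, ENNReal.top_mul volume_tile_zero_pos.ne'] at h2
  exact lt_irrefl _ h2

/-- Here 1 is the relative error of the zero approximation. If m = ⌊nx⌋ ≥ 2, then nx < m + 1 ≤ 2m,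
so m may be replaced by nx/2. Otherwise nx/2 < 1 and the power is at least 1, while log n ≥ log 2
(or b = 0) takes care of the logarithm. -/
theorem rate_floor_le {C a b x : ℝ} {n : ℕ} (hC : 0 ≤ C) (ha : 0 < a) (hb : 0 ≤ b)
    (hn : 1 ≤ n) (hnb : 2 ≤ n ∨ b = 0) (hx : 0 < x) (hx1 : x ≤ 1) :
    (if 2 ≤ ⌊n * x⌋₊ then rate C a b ⌊n * x⌋₊ else 1)
      ≤ ENNReal.ofReal ((C + Real.log 2 ^ (-b)) * (x / 2) ^ (-a)) * rate 1 a b n := by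
  have hn0 : (0 : ℝ) < n := by exact_mod_cast hn
  have hlog2 : 0 < Real.log 2 := Real.log_pos (by norm_num)
  have hlogn : 0 ≤ Real.log n := Real.log_nonneg (by exact_mod_cast hn)
  have hL : 0 ≤ Real.log 2 ^ (-b) := by positivity
  have hxa : (n * x / 2) ^ (-a) = (x / 2) ^ (-a) * (n : ℝ) ^ (-a) := by
    rw [← Real.mul_rpow (by positivity) hn0.le]
    congr 1
    ring
  have hnx : (n : ℝ) * x ≤ n := mul_le_of_le_one_right hn0.le hx1
  simp only [rate]
  rw [← ENNReal.ofReal_mul (by positivity)]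
  split_ifs with h2
  · apply ENNReal.ofReal_le_ofReal
    set m := ⌊n * x⌋₊ with hm
    have hm2 : (2 : ℝ) ≤ m := by exact_mod_cast h2
    have hmle : (m : ℝ) ≤ n * x := Nat.floor_le (by positivity)
    have hlt : n * x < m + 1 := Nat.lt_floor_add_one _
    have h3 : (m : ℝ) ^ (-a) ≤ (n * x / 2) ^ (-a) :=
      Real.rpow_le_rpow_of_nonpos (by positivity) (by linarith) (by linarith)
    have h4 : Real.log m ^ b ≤ Real.log n ^ b :=
      Real.rpow_le_rpow (Real.log_nonneg (by linarith))
        (Real.log_le_log (by linarith) (by linarith)) hb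
    have h5 : 0 ≤ Real.log m ^ b := Real.rpow_nonneg (Real.log_nonneg (by linarith)) _
    calc C * (m : ℝ) ^ (-a) * Real.log m ^ b
        ≤ C * (n * x / 2) ^ (-a) * Real.log n ^ b := by gcongr
      _ ≤ (C + Real.log 2 ^ (-b)) * (n * x / 2) ^ (-a) * Real.log n ^ b := by
          have : 0 ≤ Real.log n ^ b := Real.rpow_nonneg hlogn _
          gcongr
          linarith
      _ = _ := by rw [hxa]; ring
  · rw [← ENNReal.ofReal_one]
    apply ENNReal.ofReal_le_ofReal
    have hlt : n * x < 2 := by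
      by_contra hc
      exact h2 (Nat.le_floor (by push_cast; linarith))
    have h3 : 1 ≤ (n * x / 2) ^ (-a) :=
      Real.one_le_rpow_of_pos_of_le_one_of_nonpos (by positivity) (by linarith) (by linarith)
    have h4 : 1 ≤ Real.log 2 ^ (-b) * Real.log n ^ b := by
      rcases hnb with h | h
      · rw [Real.rpow_neg hlog2.le, ← div_eq_inv_mul, one_le_div (by positivity)]
        refine Real.rpow_le_rpow hlog2.le (Real.log_le_log (by norm_num) ?_) hb
        exact_mod_cast h
      · simp [h]
    have h5 : 0 ≤ Real.log n ^ b := Real.rpow_nonneg hlogn _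
    calc (1 : ℝ) ≤ (n * x / 2) ^ (-a) * (Real.log 2 ^ (-b) * Real.log n ^ b) :=
          one_le_mul_of_one_le_of_one_le h3 h4
      _ ≤ (n * x / 2) ^ (-a) * ((C + Real.log 2 ^ (-b)) * Real.log n ^ b) := by
          gcongr
          linarith
      _ = _ := by rw [hxa]; ring

theorem rate_mul {C a b : ℝ} (hC : 0 ≤ C) (n : ℕ) :
    ENNReal.ofReal C * rate 1 a b n = rate C a b n := by
  rw [rate, rate, ← ENNReal.ofReal_mul hC]
  congr 1
  ring

/-- Distribution of a budget `n` over the tiles: local errors of Gaussian growth add up to a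
global error of the same rate. -/
theorem exists_budget (d : ℕ) {q a b C η Λ A : ℝ} (hq : 1 ≤ q) (ha : 0 < a) (hb : 0 ≤ b)
    (hC : 0 < C) (hη : 0 < η) (hΛ : q * Λ < (1 - η) / 2) (hA : 0 < A) :
    ∃ m : ℕ → (Fin d → ℤ) → ℕ, (∀ n, {k | 2 ≤ m n k}.Finite) ∧
      (∀ n (s : Finset (Fin d → ℤ)), ∑ k ∈ s, m n k ≤ n) ∧
      ∃ C' : ℝ, 0 < C' ∧ ∀ n : ℕ, 1 ≤ n → (2 ≤ n ∨ b = 0) → ∀ (g : E d → ℝ) (N : ℝ≥0∞),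
        (∀ k, eLpNorm (fun y => g (y + center k)) (ENNReal.ofReal q) (cubeMeasure d (1 / 2))
          ≤ ENNReal.ofReal (A * Real.exp (Λ * ‖center k‖ ^ 2)) *
            ((if 2 ≤ m n k then rate C a b (m n k) else 1) * N)) →
        eLpNorm g (ENNReal.ofReal q) (gaussMeasure d) ≤ rate C' a b n * N := by
  have hq0 : 0 < q := by linarith
  -- Half of the margin (1-η)/2 - qΛ pays for the uneven budget, since q a δ is that half; the other
  -- half ε remains as decay of the tile sum.
  set δ : ℝ := ((1 - η) / 2 - q * Λ) / (2 * q * a) with hδ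
  have hδ0 : 0 < δ := div_pos (by linarith) (by positivity)
  set ε : ℝ := ((1 - η) / 2 - q * Λ) / 2 with hε
  have hε0 : 0 < ε := by rw [hε]; linarith
  have hεδ : q * (Λ + a * δ) - (1 - η) / 2 = -ε := by
    rw [hδ, hε]; field_simp; ring
  set w : (Fin d → ℤ) → ℝ := fun k => Real.exp (-(δ * ‖center k‖ ^ 2)) with hw
  have hw0 : ∀ k, 0 < w k := fun k => Real.exp_pos _
  have hw1 : ∀ k, w k ≤ 1 := fun k => by
    apply Real.exp_le_one_iff.2
    have : 0 ≤ δ * ‖center k‖ ^ 2 := by positivity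
    linarith
  have hws : Summable w := by
    have := ENNReal.summable_toReal (tsum_exp_center_lt_top (d := d) hδ0).ne
    simpa only [ENNReal.toReal_ofReal (Real.exp_pos _).le] using this
  set W : ℝ := ∑' k, w k with hW
  have hW0 : 0 ≤ W := tsum_nonneg fun k => (hw0 k).le
  -- The normalization keeps the total budget below n, and c ≤ 1 keeps each share below n, as the
  -- bound on the logarithms requires.
  set c : ℝ := 1 / (W + 1) with hc
  have hc0 : 0 < c := by positivity
  have hc1 : c ≤ 1 := by
    rw [hc, div_le_one (by positivity)]; linarith
  have hcW : c * W ≤ 1 := by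
    rw [hc, one_div, inv_mul_le_iff₀ (by positivity)]; linarith
  obtain ⟨B, hB, hB'⟩ := exists_gauss_setLIntegral_le (d := d) η (1 / 2) hη (by norm_num)
  set M : ℝ := (C + Real.log 2 ^ (-b)) * (c / 2) ^ (-a) with hM
  have hM0 : 0 < M := by
    have : 0 < Real.log 2 := Real.log_pos (by norm_num)
    positivity
  have hT := tsum_exp_center_lt_top (d := d) hε0
  set T := ∑' k : Fin d → ℤ, ENNReal.ofReal (Real.exp (-(ε * ‖center k‖ ^ 2))) with hTdef
  have hBT : ENNReal.ofReal B * T + 1 < ∞ :=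
    ENNReal.add_lt_top.2 ⟨ENNReal.mul_lt_top ENNReal.ofReal_lt_top hT, ENNReal.one_lt_top⟩
  have hBTq : (ENNReal.ofReal B * T + 1) ^ (1 / q) < ∞ :=
    ENNReal.rpow_lt_top_of_nonneg (by positivity) hBT.ne
  set G : ℝ := ((ENNReal.ofReal B * T + 1) ^ (1 / q)).toReal with hG
  have hG0 : 0 < G := ENNReal.toReal_pos (by
    refine (ENNReal.rpow_pos ?_ hBT.ne).ne'
    exact lt_of_lt_of_le one_pos le_add_self) hBTq.ne
  refine ⟨fun n k => ⌊n * (c * w k)⌋₊, fun n => ?_, fun n s => ?_, G * (A * M), by positivity,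
    fun n hn hnb g N hg => ?_⟩
  · have h1 : Filter.Tendsto (fun k => (n : ℝ) * (c * w k)) Filter.cofinite (nhds 0) := by
      simpa using ((hws.mul_left c).mul_left (n : ℝ)).tendsto_cofinite_zero
    have h2 := h1.eventually (gt_mem_nhds (show (0 : ℝ) < 2 by norm_num))
    refine (Filter.eventually_cofinite.1 h2).subset fun k hk hlt => ?_
    have h3 : (2 : ℝ) ≤ ⌊n * (c * w k)⌋₊ := by exact_mod_cast hk
    have h4 : (⌊n * (c * w k)⌋₊ : ℝ) ≤ n * (c * w k) :=
      Nat.floor_le (by have := hw0 k; positivity)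
    linarith
  · have h1 : ∑ k ∈ s, (⌊n * (c * w k)⌋₊ : ℝ) ≤ n := by
      calc ∑ k ∈ s, (⌊n * (c * w k)⌋₊ : ℝ) ≤ ∑ k ∈ s, n * (c * w k) :=
            Finset.sum_le_sum fun k _ => Nat.floor_le (by have := hw0 k; positivity)
        _ = n * (c * ∑ k ∈ s, w k) := by simp only [Finset.mul_sum]
        _ ≤ n * (c * W) := by
            gcongr
            exact hws.sum_le_tsum s fun k _ => (hw0 k).le
        _ ≤ n * 1 := by gcongr
        _ = n := mul_one _
    exact_mod_cast h1
  · set R := rate 1 a b n * N with hR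
    have hexp : ∀ k : Fin d → ℤ, (c * w k / 2) ^ (-a)
        = (c / 2) ^ (-a) * Real.exp (a * δ * ‖center k‖ ^ 2) := by
      intro k
      rw [mul_div_right_comm, Real.mul_rpow (by positivity) (hw0 k).le]
      simp only [hw]
      rw [← Real.exp_mul]
      congr 2
      ring
    have hloc : ∀ k, eLpNorm (fun y => g (y + center k)) (ENNReal.ofReal q) (cubeMeasure d (1 / 2))
        ≤ ENNReal.ofReal (A * M * Real.exp ((Λ + a * δ) * ‖center k‖ ^ 2)) * R := by
      intro k
      refine (hg k).trans ?_
      have h1 := rate_floor_le (C := C) hC.le ha hb hn hnb (x := c * w k) (mul_pos hc0 (hw0 k))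
        (mul_le_one₀ hc1 (hw0 k).le (hw1 k))
      calc _ ≤ ENNReal.ofReal (A * Real.exp (Λ * ‖center k‖ ^ 2)) *
            ((ENNReal.ofReal ((C + Real.log 2 ^ (-b)) * (c * w k / 2) ^ (-a)) * rate 1 a b n) * N) :=
            mul_le_mul_right (mul_le_mul_left h1 _) _
        _ = _ := by
            rw [hR, mul_assoc (ENNReal.ofReal _) (rate 1 a b n), ← mul_assoc,
              ← ENNReal.ofReal_mul (by positivity), hexp]
            congr 2
            rw [hM, add_mul Λ, Real.exp_add]
            ring
    -- The Gaussian mass exp(-(1-η)/2·|z|²) multiplied by the q-th power of the local error leaves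
    -- exactly exp(-ε|z|²).
    have htile : ∀ k, ∫⁻ x in tile k, ‖g x‖ₑ ^ q ∂gaussMeasure d
        ≤ ENNReal.ofReal B * ENNReal.ofReal (Real.exp (-(ε * ‖center k‖ ^ 2))) *
          (ENNReal.ofReal (A * M) * R) ^ q := by
      intro k
      refine (hB' (center k) (tile k) (measurableSet_tile k) (fun x hx => sub_center_mem_cube hx)
        fun x => ‖g x‖ₑ ^ q).trans ?_
      rw [← eLpNorm_ofReal_rpow hq0 (fun y => g (y + center k))]
      refine (mul_le_mul_right (ENNReal.rpow_le_rpow (hloc k) hq0.le) _).trans (le_of_eq ?_)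
      rw [ENNReal.ofReal_mul (by positivity : 0 ≤ A * M), ENNReal.mul_rpow_of_nonneg _ R hq0.le,
        ENNReal.mul_rpow_of_nonneg _ (ENNReal.ofReal (Real.exp _)) hq0.le,
        ENNReal.ofReal_rpow_of_nonneg (Real.exp_pos _).le hq0.le, ← Real.exp_mul,
        ENNReal.mul_rpow_of_nonneg _ R hq0.le, ENNReal.ofReal_mul hB.le]
      have h3 : ENNReal.ofReal (Real.exp (-(ε * ‖center k‖ ^ 2)))
          = ENNReal.ofReal (Real.exp (-((1 - η) / 2 * ‖center k‖ ^ 2))) *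
            ENNReal.ofReal (Real.exp ((Λ + a * δ) * ‖center k‖ ^ 2 * q)) := by
        rw [← ENNReal.ofReal_mul (Real.exp_pos _).le, ← Real.exp_add]
        congr 2
        linear_combination (-‖center k‖ ^ 2) * hεδ
      rw [h3]
      ring
    rw [eLpNorm_ofReal_eq hq0]
    calc (∫⁻ x, ‖g x‖ₑ ^ q ∂gaussMeasure d) ^ (1 / q)
        ≤ ((ENNReal.ofReal B * T + 1) * (ENNReal.ofReal (A * M) * R) ^ q) ^ (1 / q) := by
          refine ENNReal.rpow_le_rpow ?_ (by positivity)
          rw [lintegral_eq_tsum_tile]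
          refine (ENNReal.tsum_le_tsum htile).trans ?_
          rw [ENNReal.tsum_mul_right, ENNReal.tsum_mul_left]
          exact mul_le_mul_left le_self_add _
      _ = ENNReal.ofReal G * (ENNReal.ofReal (A * M) * R) := by
          rw [ENNReal.mul_rpow_of_nonneg _ _ (by positivity : 0 ≤ 1 / q), ← ENNReal.rpow_mul,
            mul_one_div_cancel hq0.ne', ENNReal.rpow_one, hG, ENNReal.ofReal_toReal hBTq.ne]
      _ = rate (G * (A * M)) a b n * N := by
          rw [hR, ← mul_assoc, ← mul_assoc, ← ENNReal.ofReal_mul hG0.le, rate_mul (by positivity)]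

/-! ### Patching local approximations -/

/-- The cut off and periodized translate of `f` belonging to the `k`-th tile. -/
def localized (χ : smoothFn d) (f : E d → ℝ) (k : Fin d → ℤ) : E d → ℝ :=
  periodize fun x => (χ : E d → ℝ) x * f (x + center k)

/-- The function that equals `u k (· - center k)` on the tiles `k ∈ s` and `0` elsewhere. -/
def patch (s : Finset (Fin d → ℤ)) (u : (Fin d → ℤ) → E d → ℝ) (x : E d) : ℝ :=
  ∑ k ∈ s, (tile k).indicator (fun x => u k (x - center k)) x

theorem patch_of_mem_tile {s : Finset (Fin d → ℤ)} {u : (Fin d → ℤ) → E d → ℝ}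
    {k : Fin d → ℤ} {x : E d} (hx : x ∈ tile k) (hk : k ∈ s) :
    patch s u x = u k (x - center k) := by
  rw [patch, Finset.sum_eq_single_of_mem k hk, indicator_of_mem hx]
  intro k' _ hk'
  exact indicator_of_notMem (fun h => Set.disjoint_left.1 (pairwise_disjoint_tile hk') h hx) _

theorem patch_of_notMem {s : Finset (Fin d → ℤ)} {u : (Fin d → ℤ) → E d → ℝ}
    {k : Fin d → ℤ} {x : E d} (hx : x ∈ tile k) (hk : k ∉ s) : patch s u x = 0 := by
  refine Finset.sum_eq_zero fun k' hk' => ?_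
  have hne : k' ≠ k := fun h => hk (h ▸ hk')
  exact indicator_of_notMem (fun h => Set.disjoint_left.1 (pairwise_disjoint_tile hne) h hx) _

/-- The closed cube differs from the half-open tile only on its faces, and the frontier of a convex
set is null. -/
theorem ae_add_center_mem_tile :
    ∀ᵐ y ∂cubeMeasure d (1 / 2), y ∈ cube d (1 / 2) ∧ ∀ k, y + center k ∈ tile k := by
  have h1 : ∀ᵐ y ∂cubeMeasure d (1 / 2), y ∈ cube d (1 / 2) :=
    ae_restrict_mem (measurableSet_cube _)
  have h2 : ∀ᵐ y ∂cubeMeasure d (1 / 2), y ∈ interior (cube d (1 / 2)) := by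
    rw [← restrict_interior_cube]
    exact ae_restrict_mem isOpen_interior.measurableSet
  -- A point with a coordinate of modulus 1/4 is not interior: scaling it by 1 + ε/2 leaves the
  -- cube.
  have h3 : interior (cube d (1 / 2)) ⊆ {y : E d | ∀ i, |y i| < 1 / 4} := by
    intro y hy i
    have hy' : y ∈ cube d (1 / 2) := interior_subset hy
    refine lt_of_le_of_ne (by have := hy' i; linarith) fun heq => ?_
    have hcont : ContinuousAt (fun t : ℝ => t • y) 1 := by fun_prop
    have hmem : interior (cube d (1 / 2)) ∈ nhds ((fun t : ℝ => t • y) 1) := by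
      simpa using isOpen_interior.mem_nhds hy
    have hev := hcont hmem
    obtain ⟨ε, hε, hball⟩ := Metric.mem_nhds_iff.1 hev
    have hε2 : 0 < 1 + ε / 2 := by linarith
    have h4 : (1 + ε / 2) • y ∈ cube d (1 / 2) :=
      interior_subset (hball (a := 1 + ε / 2) (by
        rw [Metric.mem_ball, Real.dist_eq, add_sub_cancel_left, abs_of_pos (half_pos hε)]
        linarith))
    have h5 := h4 i
    rw [PiLp.smul_apply, smul_eq_mul, abs_mul, heq, abs_of_pos hε2] at h5
    linarith
  filter_upwards [h1, h2] with y hy1 hy2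
  refine ⟨hy1, fun k i => ?_⟩
  have := abs_lt.1 (h3 hy2 i)
  rw [PiLp.add_apply, center_apply]
  constructor <;> linarith

theorem cubeMeasure_half_le : cubeMeasure d (1 / 2) ≤ cubeMeasure d 1 :=
  Measure.restrict_mono (fun x hx i => (hx i).trans (by norm_num)) le_rfl

theorem vanishesOutside_mul {χ : E d → ℝ} (hχ : VanishesOutside χ) (f : E d → ℝ) :
    VanishesOutside fun x => χ x * f x := fun x hx => by simp [hχ x hx]

/-- The kernels for which the approximation results are proved. -/
def IsAdmissibleKernel (d : ℕ) (p q s : ℝ) (κ : E d → E d → ℝ≥0∞) : Prop :=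
  κ = ouKernel d (p * Int.fract s) ∨
    (q < p / 2 ∧ κ = gagliardoKernel d (Int.fract s * p))

/-- Local bounds whose growth is compatible with the Gaussian weight. -/
theorem exists_uniform_local_bound (hd : 1 ≤ d) {p q s : ℝ} (hq : 1 ≤ q) (hqp : q < p)
    (χ : smoothFn d) (hχ : HasCompactSupport (χ : E d → ℝ))
    (hχ0 : VanishesOutside (χ : E d → ℝ)) :
    ∃ η Λ A : ℝ, 0 < η ∧ q * Λ < (1 - η) / 2 ∧ 0 < A ∧
      ∀ κ, IsAdmissibleKernel d p q s κ → ∀ f : E d → ℝ, MemSob univ (gaussMeasure d) κ s p f →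
        ∀ k, MemPerSob d s p (localized χ f k) ∧
          cubeSobNorm d 1 s p (localized χ f k)
            ≤ ENNReal.ofReal (A * Real.exp (Λ * ‖center k‖ ^ 2)) *
              sobNorm univ (gaussMeasure d) κ s p f ∧
          eLpNorm (fun x => f (x + center k)) (ENNReal.ofReal p) (cubeMeasure d 1)
            ≤ ENNReal.ofReal (A * Real.exp (Λ * ‖center k‖ ^ 2)) *
              sobNorm univ (gaussMeasure d) κ s p f := by
  have hp : 1 < p := by linarith
  have hp0 : 0 < p := by linarith
  have hσ : 0 ≤ Int.fract s * p := mul_nonneg (Int.fract_nonneg s) hp0.le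
  -- Both kernels are treated with θ = 0, so that one exponent Λ serves both; for the
  -- Ornstein-Uhlenbeck kernel the gain is given away. Then qΛ = (1/2 - η)(1 + η) = (1-η)/2 - η².
  by_cases hcase : q < p / 2
  · set η : ℝ := 1 / 2 - q / p with hη
    have hη0 : 0 < η := by
      rw [hη, sub_pos, div_lt_iff₀ hp0]; linarith
    obtain ⟨A, hA, hA'⟩ := exists_local_bound hd hp hη0 (θ := 0) (by norm_num) χ hχ hχ0
      (s := s) (κ := ouKernel d (p * Int.fract s)) (fun _ => by
        have := kernelDominates_ouKernel hd hσ (η := 1 / 2) (by norm_num) le_rfl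
        rw [sub_self] at this
        rwa [mul_comm p])
    obtain ⟨B, hB, hB'⟩ := exists_local_bound hd hp hη0 (θ := 0) (by norm_num) χ hχ hχ0
      (s := s) (κ := gagliardoKernel d (Int.fract s * p))
      (fun _ => kernelDominates_gagliardoKernel _)
    refine ⟨η, (1 + η - 0) / p, A + B, hη0, ?_, by positivity, ?_⟩
    · have e : q * ((1 + η - 0) / p) = q / p * (1 + η) := by ring
      have hqp0 : 0 < q / p := by positivity
      have : q / p = 1 / 2 - η := by rw [hη]; ring
      rw [e, this]
      nlinarith
    · have hmono : ∀ D, D ≤ A + B → ∀ x : ℝ, ENNReal.ofReal (D * Real.exp x)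
          ≤ ENNReal.ofReal ((A + B) * Real.exp x) := fun D hD x =>
        ENNReal.ofReal_le_ofReal (mul_le_mul_of_nonneg_right hD (Real.exp_pos x).le)
      rintro κ (rfl | ⟨-, rfl⟩) f hf k
      · obtain ⟨h1, h2, h3⟩ := hA' f hf (center k)
        exact ⟨h1, h2.trans (mul_le_mul_left (hmono A (by linarith) _) _),
          h3.trans (mul_le_mul_left (hmono A (by linarith) _) _)⟩
      · obtain ⟨h1, h2, h3⟩ := hB' f hf (center k)
        exact ⟨h1, h2.trans (mul_le_mul_left (hmono B (by linarith) _) _),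
          h3.trans (mul_le_mul_left (hmono B (by linarith) _) _)⟩
  -- Only the Ornstein-Uhlenbeck kernel is left, with gain θ = 1/2 - η. The divisor 5 yields qΛ = (1
  -- - 5η)(1/2 + 2η) = (1-η)/2 - 10η².
  · set η : ℝ := (1 - q / p) / 5 with hη
    have hqp1 : q / p < 1 := (div_lt_one hp0).2 hqp
    have hqp0 : 0 < q / p := by positivity
    have hη0 : 0 < η := by rw [hη]; linarith
    obtain ⟨A, hA, hA'⟩ := exists_local_bound hd hp hη0 (θ := 1 / 2 - η) (by linarith) χ hχ hχ0
      (s := s) (κ := ouKernel d (p * Int.fract s)) (fun _ => by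
        have := kernelDominates_ouKernel hd hσ hη0 (by rw [hη]; linarith)
        rwa [mul_comm p])
    refine ⟨η, (1 + η - (1 / 2 - η)) / p, A, hη0, ?_, hA, ?_⟩
    · have e : q * ((1 + η - (1 / 2 - η)) / p) = q / p * (1 / 2 + 2 * η) := by ring
      have : q / p = 1 - 5 * η := by rw [hη]; ring
      rw [e, this]
      nlinarith
    · rintro κ (rfl | ⟨h, -⟩) f hf k
      · exact hA' f hf (center k)
      · exact absurd h hcase

/-- Good local approximations yield a good global approximation. -/
theorem exists_patching (hd : 1 ≤ d) {p q a b s C : ℝ} (hq : 1 ≤ q) (hqp : q < p)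
    (ha : 0 < a) (hb : 0 ≤ b) (hC : 0 < C) (χ : smoothFn d)
    (hχ : HasCompactSupport (χ : E d → ℝ)) (hχ0 : VanishesOutside (χ : E d → ℝ))
    (hχ1 : ∀ x ∈ cube d (1 / 2), (χ : E d → ℝ) x = 1) :
    ∃ (t : ℕ → Finset (Fin d → ℤ)) (m : ℕ → (Fin d → ℤ) → ℕ), (∀ n, ∀ k ∈ t n, 2 ≤ m n k) ∧
      (∀ n, ∑ k ∈ t n, m n k ≤ n) ∧
      ∃ C' : ℝ, 0 < C' ∧ ∀ κ, IsAdmissibleKernel d p q s κ →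
        ∀ f : E d → ℝ, MemSob univ (gaussMeasure d) κ s p f →
          (∀ k, MemPerSob d s p (localized χ f k)) ∧
          ∀ n : ℕ, 1 ≤ n → (2 ≤ n ∨ b = 0) → ∀ u : (Fin d → ℤ) → E d → ℝ,
            (∀ k ∈ t n, eLpNorm (localized χ f k - u k) (ENNReal.ofReal q) (cubeMeasure d 1)
              ≤ rate C a b (m n k) * cubeSobNorm d 1 s p (localized χ f k)) →
            eLpNorm (f - patch (t n) u) (ENNReal.ofReal q) (gaussMeasure d)
              ≤ rate C' a b n * sobNorm univ (gaussMeasure d) κ s p f := by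
  have hq0 : 0 < q := by linarith
  have hp0 : 0 < p := by linarith
  obtain ⟨η, Λ, A, hη, hΛ, hA, hloc⟩ := exists_uniform_local_bound hd (s := s) hq hqp χ hχ hχ0
  -- The Hölder constant from L_p to L_q on the unit cube, needed on tiles that receive no budget.
  set V : ℝ≥0∞ := cubeMeasure d 1 univ ^ (1 / q - 1 / p) with hV
  have hVt : V < ∞ := by
    refine ENNReal.rpow_lt_top_of_nonneg ?_ ?_
    · rw [sub_nonneg]
      exact one_div_le_one_div_of_le hq0 hqp.le
    · rw [Measure.restrict_apply_univ]
      exact (volume_cube_lt_top 1).ne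
  have hV0 : 0 ≤ V.toReal := ENNReal.toReal_nonneg
  obtain ⟨m, hfin, hsum, C', hC', hglob⟩ := exists_budget d hq ha hb hC hη hΛ
    (A := A * (1 + V.toReal)) (by positivity)
  refine ⟨fun n => (hfin n).toFinset, m, fun n k hk => by simpa using hk, fun n => hsum n _,
    C', hC', fun κ hκ f hf => ⟨fun k => (hloc κ hκ f hf k).1, fun n hn hnb u hu => ?_⟩⟩
  refine hglob n hn hnb _ _ fun k => ?_
  obtain ⟨-, h2, h3⟩ := hloc κ hκ f hf k
  set N := sobNorm univ (gaussMeasure d) κ s p f with hN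
  have hexp := Real.exp_pos (Λ * ‖center k‖ ^ 2)
  split_ifs with hk
  · have hk' : k ∈ (hfin n).toFinset := by simpa using hk
    calc eLpNorm (fun y => (f - patch (hfin n).toFinset u) (y + center k)) (ENNReal.ofReal q)
          (cubeMeasure d (1 / 2))
        = eLpNorm (localized χ f k - u k) (ENNReal.ofReal q) (cubeMeasure d (1 / 2)) := by
          refine eLpNorm_congr_ae ?_
          filter_upwards [ae_add_center_mem_tile] with y hy
          have hy1 : y ∈ unitCube d := fun i => (hy.1 i).trans (by norm_num)
          simp only [Pi.sub_apply]
          rw [patch_of_mem_tile (hy.2 k) hk', add_sub_cancel_right, localized,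
            periodize_eq_self (vanishesOutside_mul hχ0 _) hy1, hχ1 y hy.1, one_mul]
      _ ≤ eLpNorm (localized χ f k - u k) (ENNReal.ofReal q) (cubeMeasure d 1) :=
          eLpNorm_mono_measure _ cubeMeasure_half_le
      _ ≤ rate C a b (m n k) *
          (ENNReal.ofReal (A * Real.exp (Λ * ‖center k‖ ^ 2)) * N) :=
          (hu k hk').trans (mul_le_mul_right h2 _)
      _ = ENNReal.ofReal (A * Real.exp (Λ * ‖center k‖ ^ 2)) * (rate C a b (m n k) * N) :=
          mul_left_comm _ _ _
      _ ≤ _ := by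
          refine mul_le_mul_left (ENNReal.ofReal_le_ofReal ?_) _
          refine mul_le_mul_of_nonneg_right ?_ hexp.le
          nlinarith
  · have hk' : k ∉ (hfin n).toFinset := by simpa using hk
    have hfm : AEStronglyMeasurable (fun x => f (x + center k)) (cubeMeasure d 1) := by
      have h4 := (hf.1 0 (mem_multiLE.2 (by simp))).1.choose_spec.1
      rw [interior_univ, locallyIntegrableOn_univ] at h4
      exact (locallyIntegrable_comp_add_right h4 (center k)).aestronglyMeasurable.restrict
    calc eLpNorm (fun y => (f - patch (hfin n).toFinset u) (y + center k)) (ENNReal.ofReal q)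
          (cubeMeasure d (1 / 2))
        = eLpNorm (fun y => f (y + center k)) (ENNReal.ofReal q) (cubeMeasure d (1 / 2)) := by
          refine eLpNorm_congr_ae ?_
          filter_upwards [ae_add_center_mem_tile] with y hy
          simp only [Pi.sub_apply]
          rw [patch_of_notMem (hy.2 k) hk', sub_zero]
      _ ≤ eLpNorm (fun y => f (y + center k)) (ENNReal.ofReal q) (cubeMeasure d 1) :=
          eLpNorm_mono_measure _ cubeMeasure_half_le
      _ ≤ eLpNorm (fun y => f (y + center k)) (ENNReal.ofReal p) (cubeMeasure d 1) * V := by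
          have := eLpNorm_le_eLpNorm_mul_rpow_measure_univ
            (ENNReal.ofReal_le_ofReal hqp.le) hfm
          rwa [ENNReal.toReal_ofReal hq0.le, ENNReal.toReal_ofReal hp0.le] at this
      _ ≤ ENNReal.ofReal (A * Real.exp (Λ * ‖center k‖ ^ 2)) * N * V := mul_le_mul_left h3 _
      _ = ENNReal.ofReal (A * Real.exp (Λ * ‖center k‖ ^ 2) * V.toReal) * (1 * N) := by
          rw [ENNReal.ofReal_mul (by positivity : 0 ≤ A * Real.exp (Λ * ‖center k‖ ^ 2)),
            ENNReal.ofReal_toReal hVt.ne, one_mul]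
          ring
      _ ≤ _ := by
          refine mul_le_mul_left (ENNReal.ofReal_le_ofReal ?_) _
          have : 0 < A * Real.exp (Λ * ‖center k‖ ^ 2) := by positivity
          linarith

/-! ### Weighted composition operators -/

/-- The weighted composition `f ↦ c · (f ∘ T)` acts from `L_q(μ)` to `L_q(ν)`. -/
structure IsTransfer (c : E d → ℝ) (T : E d → E d) (q : ℝ) (μ ν : Measure (E d)) : Prop where
  measurable_weight : Measurable c
  measurable_map : Measurable T
  exists_lintegral_le : ∃ K : ℝ≥0∞, K ≠ ∞ ∧ ∀ F : E d → ℝ≥0∞, Measurable F →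
    ∫⁻ x, ‖c x‖ₑ ^ q * F (T x) ∂ν ≤ K * ∫⁻ x, F x ∂μ

namespace IsTransfer

variable {c : E d → ℝ} {T : E d → E d} {q : ℝ} {μ ν : Measure (E d)}

/-- The map T alone need not pull null sets back to null sets. Testing the integral bound with the
indicator of a measurable null set containing {f ≠ g} shows that ν-almost everywhere either c
vanishes or T x avoids this set, so the operator is well defined on classes. -/
theorem ae_eq (h : IsTransfer c T q μ ν) (hq : 0 < q) {f g : E d → ℝ} (hfg : f =ᵐ[μ] g) :
    (fun x => c x * f (T x)) =ᵐ[ν] fun x => c x * g (T x) := by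
  obtain ⟨K, -, hK⟩ := h.exists_lintegral_le
  set N := toMeasurable μ {x | f x ≠ g x} with hN
  have hNm : MeasurableSet N := measurableSet_toMeasurable _ _
  have hN0 : μ N = 0 := by rw [hN, measure_toMeasurable]; exact hfg
  have hF : Measurable (N.indicator fun _ => (1 : ℝ≥0∞)) := measurable_const.indicator hNm
  have h0 : ∫⁻ x, ‖c x‖ₑ ^ q * N.indicator (fun _ => (1 : ℝ≥0∞)) (T x) ∂ν = 0 := by
    refine le_antisymm ((hK _ hF).trans ?_) bot_le
    rw [lintegral_indicator_const hNm, hN0, mul_zero, mul_zero]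
  have h1 := (lintegral_eq_zero_iff
    ((h.measurable_weight.enorm.pow_const q).mul (hF.comp h.measurable_map))).1 h0
  filter_upwards [h1] with x hx
  rcases mul_eq_zero.1 hx with hx | hx
  · rw [ENNReal.rpow_eq_zero_iff_of_pos hq, enorm_eq_zero] at hx
    simp [hx]
  · have hx' : T x ∉ N := fun hmem => by simp [hmem] at hx
    have : f (T x) = g (T x) := by
      by_contra hne
      exact hx' (subset_toMeasurable _ _ hne)
    rw [this]

theorem aestronglyMeasurable (h : IsTransfer c T q μ ν) (hq : 0 < q) {f : E d → ℝ}
    (hf : AEStronglyMeasurable f μ) : AEStronglyMeasurable (fun x => c x * f (T x)) ν := by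
  refine AEStronglyMeasurable.congr ?_ (h.ae_eq hq hf.ae_eq_mk).symm
  exact (h.measurable_weight.mul
    (hf.stronglyMeasurable_mk.measurable.comp h.measurable_map)).aestronglyMeasurable

theorem exists_eLpNorm_le (h : IsTransfer c T q μ ν) (hq : 0 < q) :
    ∃ K : ℝ≥0∞, K ≠ ∞ ∧ ∀ f : E d → ℝ, AEStronglyMeasurable f μ →
      eLpNorm (fun x => c x * f (T x)) (ENNReal.ofReal q) ν
        ≤ K * eLpNorm f (ENNReal.ofReal q) μ := by
  obtain ⟨K, hKt, hK⟩ := h.exists_lintegral_le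
  refine ⟨K ^ (1 / q), ENNReal.rpow_ne_top_of_nonneg (by positivity) hKt, fun f hf => ?_⟩
  rw [eLpNorm_congr_ae (h.ae_eq hq hf.ae_eq_mk), eLpNorm_congr_ae hf.ae_eq_mk]
  set g := hf.mk f with hg
  have hgm : Measurable g := hf.stronglyMeasurable_mk.measurable
  rw [← ENNReal.rpow_le_rpow_iff hq, ENNReal.mul_rpow_of_nonneg _ _ hq.le, ← ENNReal.rpow_mul,
    one_div_mul_cancel hq.ne', ENNReal.rpow_one, eLpNorm_ofReal_rpow hq, eLpNorm_ofReal_rpow hq]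
  refine le_trans (le_of_eq (lintegral_congr fun x => ?_))
    (hK (fun x => ‖g x‖ₑ ^ q) (hgm.enorm.pow_const q))
  rw [enorm_mul, ENNReal.mul_rpow_of_nonneg _ _ hq.le]

theorem memLp (h : IsTransfer c T q μ ν) (hq : 0 < q) {f : E d → ℝ}
    (hf : MemLp f (ENNReal.ofReal q) μ) :
    MemLp (fun x => c x * f (T x)) (ENNReal.ofReal q) ν := by
  obtain ⟨K, hKt, hK⟩ := h.exists_eLpNorm_le hq
  exact ⟨h.aestronglyMeasurable hq hf.1,
    (hK f hf.1).trans_lt (ENNReal.mul_lt_top hKt.lt_top hf.2)⟩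

/-- The weighted composition as a linear map. -/
def op (h : IsTransfer c T q μ ν) (hq : 0 < q) : LpSpace q μ →ₗ[ℝ] LpSpace q ν where
  toFun f := (h.memLp hq (Lp.memLp f)).toLp _
  map_add' f g := by
    rw [← MemLp.toLp_add]
    refine MemLp.toLp_congr _ _ ((h.ae_eq hq (Lp.coeFn_add f g)).trans ?_)
    exact Filter.Eventually.of_forall fun x => by simp [mul_add]
  map_smul' r f := by
    rw [RingHom.id_apply, ← MemLp.toLp_const_smul]
    refine MemLp.toLp_congr _ _ ((h.ae_eq hq (Lp.coeFn_smul r f)).trans ?_)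
    exact Filter.Eventually.of_forall fun x => by simp [mul_left_comm]

theorem coeFn_op (h : IsTransfer c T q μ ν) (hq : 0 < q) (f : LpSpace q μ) :
    h.op hq f =ᵐ[ν] fun x => c x * f (T x) :=
  MemLp.coeFn_toLp (h.memLp hq (Lp.memLp f))

theorem exists_norm_op_le (h : IsTransfer c T q μ ν) (hq : 0 < q) :
    ∃ K : ℝ, 0 ≤ K ∧ ∀ f, ‖h.op hq f‖ ≤ K * ‖f‖ := by
  obtain ⟨K, hKt, hK⟩ := h.exists_eLpNorm_le hq
  refine ⟨K.toReal, ENNReal.toReal_nonneg, fun f => ?_⟩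
  rw [Lp.norm_def, Lp.norm_def, ← ENNReal.toReal_mul, eLpNorm_congr_ae (h.coeFn_op hq f)]
  exact ENNReal.toReal_mono (ENNReal.mul_ne_top hKt (Lp.eLpNorm_ne_top f))
    (hK f (Lp.aestronglyMeasurable f))

end IsTransfer

/-- Only boundedness for each single center is needed here, so the crude choice η = 1 in the
comparison of measures suffices. -/
theorem isTransfer_restriction {q : ℝ} (hq : 0 < q) {χ : E d → ℝ} (hχ : Continuous χ) {M : ℝ}
    (hM : ∀ x, |χ x| ≤ M) (z : E d) :
    IsTransfer χ (fun x => x + z) q (gaussMeasure d) (cubeMeasure d 1) := by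
  obtain ⟨C, hC, hC'⟩ := exists_setLIntegral_cube_le (d := d) 1 1 one_pos one_pos
  refine ⟨hχ.measurable, measurable_id.add_const z,
    ENNReal.ofReal M ^ q * ENNReal.ofReal (C * Real.exp ((1 + 1) / 2 * ‖z‖ ^ 2)),
    ENNReal.mul_ne_top (ENNReal.rpow_ne_top_of_nonneg hq.le ENNReal.ofReal_ne_top)
      ENNReal.ofReal_ne_top, fun F hF => ?_⟩
  calc ∫⁻ x in cube d 1, ‖χ x‖ₑ ^ q * F (x + z)
      ≤ ∫⁻ x in cube d 1, ENNReal.ofReal M ^ q * F (x + z) := by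
        refine lintegral_mono fun x => mul_le_mul_left (ENNReal.rpow_le_rpow ?_ hq.le) _
        rw [Real.enorm_eq_ofReal_abs]
        exact ENNReal.ofReal_le_ofReal (hM x)
    _ = ENNReal.ofReal M ^ q * ∫⁻ x in cube d 1, F (x + z) :=
        lintegral_const_mul _ (hF.comp (measurable_id.add_const z))
    _ ≤ _ := by rw [mul_assoc]; exact mul_le_mul_right (hC' z F) _

theorem isTransfer_extension {q : ℝ} (hq : 0 < q) (k : Fin d → ℤ) :
    IsTransfer ((tile k).indicator 1) (fun x => x - center k) q (cubeMeasure d 1)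
      (gaussMeasure d) := by
  obtain ⟨C, hC, hC'⟩ := exists_gauss_setLIntegral_le (d := d) 1 1 one_pos one_pos
  refine ⟨measurable_one.indicator (measurableSet_tile k), measurable_id.sub_const _,
    ENNReal.ofReal (C * Real.exp (-((1 - 1) / 2 * ‖center k‖ ^ 2))), ENNReal.ofReal_ne_top,
    fun F hF => ?_⟩
  refine le_trans (le_of_eq ?_) ((hC' (center k) (tile k) (measurableSet_tile k) (fun x hx i =>
    (sub_center_mem_cube hx i).trans (by norm_num)) fun x => F (x - center k)).trans
    (le_of_eq ?_))
  · rw [← lintegral_indicator (measurableSet_tile k)]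
    refine lintegral_congr fun x => ?_
    by_cases hx : x ∈ tile k <;> simp [hx, hq]
  · simp

/-! ### Linear and sampling operators -/

theorem localized_ae_eq {χ : smoothFn d} (hχ0 : VanishesOutside (χ : E d → ℝ)) (f : E d → ℝ)
    (k : Fin d → ℤ) :
    (fun x => (χ : E d → ℝ) x * f (x + center k)) =ᵐ[cubeMeasure d 1] localized χ f k := by
  filter_upwards [ae_restrict_mem (measurableSet_cube 1)] with x hx
  exact (periodize_eq_self (vanishesOutside_mul hχ0 fun x => f (x + center k)) hx).symm

theorem IsBddOp.of_sum_comp {ι : Type*} {q : ℝ} {μ ν : Measure (E d)} {t : Finset ι}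
    {R : ι → LpSpace q μ →ₗ[ℝ] LpSpace q ν} {L : ι → LpSpace q ν →ₗ[ℝ] LpSpace q ν}
    {S : ι → LpSpace q ν →ₗ[ℝ] LpSpace q μ} (hq : 1 ≤ q)
    (hR : ∀ k ∈ t, ∃ K : ℝ, 0 ≤ K ∧ ∀ f, ‖R k f‖ ≤ K * ‖f‖) (hL : ∀ k ∈ t, IsBddOp (L k))
    (hS : ∀ k ∈ t, ∃ K : ℝ, 0 ≤ K ∧ ∀ f, ‖S k f‖ ≤ K * ‖f‖) :
    IsBddOp (∑ k ∈ t, S k ∘ₗ L k ∘ₗ R k) := by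
  have : Fact (1 ≤ ENNReal.ofReal q) := ⟨by simpa using hq⟩
  have h : ∀ k ∈ t, ∃ K : ℝ, ∀ f, ‖S k (L k (R k f))‖ ≤ K * ‖f‖ := by
    intro k hk
    obtain ⟨K₁, hK₁, h₁⟩ := hR k hk
    obtain ⟨K₂, h₂⟩ := hL k hk
    obtain ⟨K₃, hK₃, h₃⟩ := hS k hk
    refine ⟨K₃ * (|K₂| * K₁), fun f => (h₃ _).trans ?_⟩
    rw [mul_assoc, mul_assoc]
    refine mul_le_mul_of_nonneg_left ((h₂ _).trans ?_) hK₃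
    exact mul_le_mul (le_abs_self _) (h₁ f) (norm_nonneg _) (abs_nonneg _)
  choose! K hK using h
  refine ⟨∑ k ∈ t, K k, fun f => ?_⟩
  rw [LinearMap.sum_apply, Finset.sum_mul]
  exact (norm_sum_le _ _).trans (Finset.sum_le_sum fun k hk => hK k hk f)

/-- The operator is the finite sum of Sₖ A_{m(n,k)} Rₖ over the tiles with budget at least 2, where
Rₖ cuts off the translate and Sₖ transplants to the tile. Its rank is at most the total budget.
Periodization is invisible to Rₖ, because elements of L_q of the unit cube only see values there. -/
theorem exists_linear_operators (hd : 1 ≤ d) {p q a b s C : ℝ} (hq : 1 ≤ q) (hqp : q < p)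
    (ha : 0 < a) (hb : 0 ≤ b) (hC : 0 < C) :
    ∃ C' : ℝ, 0 < C' ∧
      ∀ A : ℕ → (LpSpace q (cubeMeasure d 1) →ₗ[ℝ] LpSpace q (cubeMeasure d 1)),
        (∀ m : ℕ, 2 ≤ m → (A m).rank ≤ m ∧
          ∀ (u : LpSpace q (cubeMeasure d 1)) (g : E d → ℝ),
            MemPerSob d s p g → u =ᵐ[cubeMeasure d 1] g →
            ‖u - A m u‖ₑ ≤ rate C a b m * cubeSobNorm d 1 s p g) →
        ∃ B : ℕ → (LpSpace q (gaussMeasure d) →ₗ[ℝ] LpSpace q (gaussMeasure d)),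
          (∀ n : ℕ, (B n).rank ≤ n) ∧
          (∀ n : ℕ, 1 ≤ n → (2 ≤ n ∨ b = 0) → ∀ κ, IsAdmissibleKernel d p q s κ →
            ∀ f : LpSpace q (gaussMeasure d), MemSob univ (gaussMeasure d) κ s p f →
              ‖f - B n f‖ₑ ≤ rate C' a b n * sobNorm univ (gaussMeasure d) κ s p f) ∧
          ((∀ m : ℕ, 2 ≤ m → IsBddOp (A m)) → ∀ n : ℕ, IsBddOp (B n)) := by
  have hq0 : 0 < q := by linarith
  obtain ⟨χ, hχ, hχ0, hχ1⟩ := exists_cutoff d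
  obtain ⟨t, m, htm, hsum, C', hC', hmain⟩ :=
    exists_patching hd (s := s) hq hqp ha hb hC χ hχ hχ0 hχ1
  obtain ⟨M, hM, -⟩ := exists_bound_lipschitz hχ
  have hR := fun k : Fin d → ℤ => isTransfer_restriction hq0 (smoothFn_continuous χ) hM (center k)
  have hS := fun k : Fin d → ℤ => isTransfer_extension hq0 k
  refine ⟨C', hC', fun A hA => ⟨fun n => ∑ k ∈ t n,
    (hS k).op hq0 ∘ₗ A (m n k) ∘ₗ (hR k).op hq0, fun n => ?_, fun n hn hnb κ hκ f hf => ?_,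
    fun hbdd n => ?_⟩⟩
  · refine (LinearMap.rank_finsetSum_le _ _).trans ?_
    calc ∑ k ∈ t n, ((hS k).op hq0 ∘ₗ A (m n k) ∘ₗ (hR k).op hq0).rank
        ≤ ∑ k ∈ t n, (m n k : Cardinal) := Finset.sum_le_sum fun k hk =>
          (LinearMap.rank_comp_le_right _ _).trans
            ((LinearMap.rank_comp_le_left _ _).trans (hA _ (htm n k hk)).1)
      _ = ((∑ k ∈ t n, m n k : ℕ) : Cardinal) := by push_cast; rfl
      _ ≤ n := by exact_mod_cast hsum n
  · obtain ⟨hper, hest⟩ := hmain κ hκ f hf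
    have hRk : ∀ k, (hR k).op hq0 f =ᵐ[cubeMeasure d 1] localized χ f k := fun k =>
      ((hR k).coeFn_op hq0 f).trans (localized_ae_eq hχ0 _ k)
    have h := hest n hn hnb (fun k => A (m n k) ((hR k).op hq0 f)) fun k hk => by
      have h1 := (hA _ (htm n k hk)).2 _ _ (hper k) (hRk k)
      rw [Lp.enorm_def] at h1
      refine le_trans (le_of_eq (eLpNorm_congr_ae ?_)) h1
      exact ((hRk k).symm.sub (Filter.EventuallyEq.refl _ _)).trans (Lp.coeFn_sub _ _).symm
    rw [Lp.enorm_def]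
    refine le_trans (le_of_eq (eLpNorm_congr_ae ?_)) h
    refine (Lp.coeFn_sub _ _).trans ((Filter.EventuallyEq.refl _ _).sub ?_)
    rw [LinearMap.sum_apply]
    refine (Lp.coeFn_finsetSum _ _).trans ?_
    have hall : ∀ᵐ x ∂gaussMeasure d, ∀ k, (hS k).op hq0 (A (m n k) ((hR k).op hq0 f)) x
        = (tile k).indicator 1 x * A (m n k) ((hR k).op hq0 f) (x - center k) :=
      ae_all_iff.2 fun k => (hS k).coeFn_op hq0 _
    filter_upwards [hall] with x hx
    rw [Finset.sum_apply]
    refine Finset.sum_congr rfl fun k _ => (hx k).trans ?_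
    by_cases hxk : x ∈ tile k <;> simp [hxk]
  · exact IsBddOp.of_sum_comp hq (fun k _ => (hR k).exists_norm_op_le hq0)
      (fun k hk => hbdd _ (htm n k hk)) fun k _ => (hS k).exists_norm_op_le hq0

/-- Unused sample slots are filled with the point 0 and the function 0, so a sum with fewer than n
terms becomes one with exactly n. -/
theorem exists_sampleOp_eq {ι : Type*} [Fintype ι] {n : ℕ} (hn : Fintype.card ι ≤ n)
    (y : ι → E d) (ψ : ι → E d → ℝ) {r : ℝ≥0∞} {μ : Measure (E d)} (hψ : ∀ i, MemLp (ψ i) r μ) :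
    ∃ (x : Fin n → E d) (φ : Fin n → E d → ℝ), (∀ j, MemLp (φ j) r μ) ∧
      ∀ f z, sampleOp x φ f z = ∑ i, f (y i) * ψ i z := by
  obtain ⟨e⟩ : Nonempty (ι ↪ Fin n) :=
    Function.Embedding.nonempty_of_card_le (by simpa using hn)
  refine ⟨Function.extend e y 0, Function.extend e ψ 0, fun j => ?_, fun f z => ?_⟩
  · by_cases hj : ∃ i, e i = j
    · obtain ⟨i, rfl⟩ := hj
      rw [e.injective.extend_apply]
      exact hψ i
    · rw [Function.extend_apply' _ _ _ hj]
      exact MemLp.zero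
  · refine (Fintype.sum_of_injective e e.injective _ _ (fun j hj => ?_) fun i => ?_).symm
    · rw [Function.extend_apply' ψ _ _ hj]
      simp
    · rw [e.injective.extend_apply, e.injective.extend_apply]

/-- At a sample point ξ of the unit cube the localized function equals χ(ξ) f(ξ + z), so one local
sample costs one value of f. The number χ(ξ) and the indicator of the tile are absorbed into the
coefficient function. -/
theorem exists_sampling_operators (hd : 1 ≤ d) {p q a b s C : ℝ} (hq : 1 ≤ q) (hqp : q < p)
    (ha : 0 < a) (hb : 0 ≤ b) (hC : 0 < C) :
    ∃ C' : ℝ, 0 < C' ∧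
      ∀ (X : (m : ℕ) → Fin m → E d) (Φ : (m : ℕ) → Fin m → E d → ℝ),
        (∀ m : ℕ, 2 ≤ m →
          (∀ i, X m i ∈ unitCube d) ∧
          (∀ i, MemLp (Φ m i) (ENNReal.ofReal q) (cubeMeasure d 1)) ∧
          ∀ g : E d → ℝ, Continuous g → MemPerSob d s p g →
            eLpNorm (g - sampleOp (X m) (Φ m) g) (ENNReal.ofReal q) (cubeMeasure d 1)
              ≤ rate C a b m * cubeSobNorm d 1 s p g) →
        ∀ n : ℕ, 1 ≤ n → (2 ≤ n ∨ b = 0) →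
          ∃ (x : Fin n → E d) (φ : Fin n → E d → ℝ),
            (∀ i, MemLp (φ i) (ENNReal.ofReal q) (gaussMeasure d)) ∧
            ∀ κ, IsAdmissibleKernel d p q s κ →
              ∀ f : E d → ℝ, Continuous f → MemSob univ (gaussMeasure d) κ s p f →
                eLpNorm (f - sampleOp x φ f) (ENNReal.ofReal q) (gaussMeasure d)
                  ≤ rate C' a b n * sobNorm univ (gaussMeasure d) κ s p f := by
  have hq0 : 0 < q := by linarith
  obtain ⟨χ, hχ, hχ0, hχ1⟩ := exists_cutoff d
  obtain ⟨t, m, htm, hsum, C', hC', hmain⟩ :=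
    exists_patching hd (s := s) hq hqp ha hb hC χ hχ hχ0 hχ1
  refine ⟨C', hC', fun X Φ hXΦ n hn hnb => ?_⟩
  have hψ : ∀ i : Σ k : t n, Fin (m n k), MemLp (fun x => (χ : E d → ℝ) (X _ i.2) *
      ((tile i.1.1).indicator 1 x * Φ _ i.2 (x - center i.1.1))) (ENNReal.ofReal q)
      (gaussMeasure d) := fun i =>
    ((isTransfer_extension hq0 i.1.1).memLp hq0
      ((hXΦ _ (htm n _ i.1.2)).2.1 i.2)).const_mul _
  have hcard : Fintype.card (Σ k : t n, Fin (m n k)) ≤ n := by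
    rw [Fintype.card_sigma]
    simp only [Fintype.card_fin]
    exact le_of_eq_of_le (Finset.sum_coe_sort (t n) (m n)) (hsum n)
  obtain ⟨x, φ, hφ, hxφ⟩ := exists_sampleOp_eq hcard
    (fun i : Σ k : t n, Fin (m n k) => X _ i.2 + center i.1.1) _ hψ
  refine ⟨x, φ, hφ, fun κ hκ f hf hfm => ?_⟩
  obtain ⟨hper, hest⟩ := hmain κ hκ f hfm
  have hcont : ∀ k, Continuous (localized χ f k) := fun k =>
    continuous_periodize (vanishesOutside_mul hχ0 _)
      ((smoothFn_continuous χ).mul (hf.comp (continuous_add_const _)))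
  have h := hest n hn hnb (fun k => sampleOp (X (m n k)) (Φ (m n k)) (localized χ f k))
    fun k hk => (hXΦ _ (htm n k hk)).2.2 _ (hcont k) (hper k)
  have heq : sampleOp x φ f = patch (t n)
      fun k => sampleOp (X (m n k)) (Φ (m n k)) (localized χ f k) := by
    funext z
    rw [hxφ, Fintype.sum_sigma, patch, ← Finset.sum_coe_sort (t n)]
    refine Finset.sum_congr rfl fun k _ => ?_
    by_cases hz : z ∈ tile k.1
    · rw [indicator_of_mem hz, sampleOp]
      refine Finset.sum_congr rfl fun i _ => ?_
      have : localized χ f k.1 (X _ i) = (χ : E d → ℝ) (X _ i) * f (X _ i + center k.1) :=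
        periodize_eq_self (vanishesOutside_mul hχ0 fun x => f (x + center k.1))
          ((hXΦ _ (htm n _ k.2)).1 i)
      rw [this]
      simp only [indicator_of_mem hz, Pi.one_apply, one_mul]
      ring
    · simp [indicator_of_notMem hz]
  rw [heq]
  exact h

end GaussSob

end

theorem mainTheorem5 (d : ℕ) (hd : 1 ≤ d) (p q a b s C : ℝ) (hq : 1 ≤ q) (hqp : q < p)
    (ha : 0 < a) (hb : 0 ≤ b) (hs : 0 < s) (hC : 0 < C) :
    -- linear operators
    (∃ C' : ℝ, 0 < C' ∧
      ∀ A : ℕ → (GaussSob.LpSpace q (GaussSob.cubeMeasure d 1) →ₗ[ℝ]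
          GaussSob.LpSpace q (GaussSob.cubeMeasure d 1)),
        (∀ m : ℕ, 2 ≤ m → (A m).rank ≤ m ∧
          ∀ (u : GaussSob.LpSpace q (GaussSob.cubeMeasure d 1)) (g : GaussSob.E d → ℝ),
            GaussSob.MemPerSob d s p g → u =ᵐ[GaussSob.cubeMeasure d 1] g →
            ‖u - A m u‖ₑ ≤ GaussSob.rate C a b m * GaussSob.cubeSobNorm d 1 s p g) →
        ∃ B : ℕ → (GaussSob.LpSpace q (GaussSob.gaussMeasure d) →ₗ[ℝ]
            GaussSob.LpSpace q (GaussSob.gaussMeasure d)),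
          (∀ n : ℕ, 1 ≤ n → (2 ≤ n ∨ b = 0) →
            (B n).rank ≤ n ∧
            (∀ f : GaussSob.LpSpace q (GaussSob.gaussMeasure d), GaussSob.MemGaussSob d s p f →
              ‖f - B n f‖ₑ ≤ GaussSob.rate C' a b n * GaussSob.gaussSobNorm d s p f) ∧
            (q < p / 2 →
              ∀ f : GaussSob.LpSpace q (GaussSob.gaussMeasure d), GaussSob.MemGaussSobG d s p f →
                ‖f - B n f‖ₑ ≤ GaussSob.rate C' a b n * GaussSob.gaussSobNormG d s p f)) ∧
          ((∀ m : ℕ, 2 ≤ m → GaussSob.IsBddOp (A m)) → ∀ n : ℕ, GaussSob.IsBddOp (B n))) ∧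
    -- sampling operators
    ((d : ℝ) / p < s → ∃ C' : ℝ, 0 < C' ∧
      ∀ (X : (m : ℕ) → Fin m → GaussSob.E d) (Φ : (m : ℕ) → Fin m → GaussSob.E d → ℝ),
        (∀ m : ℕ, 2 ≤ m →
          (∀ i, X m i ∈ GaussSob.unitCube d) ∧
          (∀ i, MemLp (Φ m i) (ENNReal.ofReal q) (GaussSob.cubeMeasure d 1)) ∧
          ∀ g : GaussSob.E d → ℝ, Continuous g → GaussSob.MemPerSob d s p g →
            eLpNorm (g - GaussSob.sampleOp (X m) (Φ m) g) (ENNReal.ofReal q)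
                (GaussSob.cubeMeasure d 1)
              ≤ GaussSob.rate C a b m * GaussSob.cubeSobNorm d 1 s p g) →
        ∀ n : ℕ, 1 ≤ n → (2 ≤ n ∨ b = 0) →
          ∃ (x : Fin n → GaussSob.E d) (φ : Fin n → GaussSob.E d → ℝ),
            (∀ i, MemLp (φ i) (ENNReal.ofReal q) (GaussSob.gaussMeasure d)) ∧
            (∀ f : GaussSob.E d → ℝ, Continuous f → GaussSob.MemGaussSob d s p f →
              eLpNorm (f - GaussSob.sampleOp x φ f) (ENNReal.ofReal q) (GaussSob.gaussMeasure d)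
                ≤ GaussSob.rate C' a b n * GaussSob.gaussSobNorm d s p f) ∧
            (q < p / 2 →
              ∀ f : GaussSob.E d → ℝ, Continuous f → GaussSob.MemGaussSobG d s p f →
                eLpNorm (f - GaussSob.sampleOp x φ f) (ENNReal.ofReal q)
                    (GaussSob.gaussMeasure d)
                  ≤ GaussSob.rate C' a b n * GaussSob.gaussSobNormG d s p f)) := by
  refine ⟨?_, fun _ => ?_⟩
  · obtain ⟨C', hC', h⟩ := GaussSob.exists_linear_operators hd (s := s) hq hqp ha hb hC
    refine ⟨C', hC', fun A hA => ?_⟩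
    obtain ⟨B, hrank, hB, hbdd⟩ := h A hA
    exact ⟨B, fun n hn hnb => ⟨hrank n, fun f hf => hB n hn hnb _ (Or.inl rfl) f hf,
      fun hqp2 f hf => hB n hn hnb _ (Or.inr ⟨hqp2, rfl⟩) f hf⟩, hbdd⟩
  · obtain ⟨C', hC', h⟩ := GaussSob.exists_sampling_operators hd (s := s) hq hqp ha hb hC
    refine ⟨C', hC', fun X Φ hXΦ n hn hnb => ?_⟩
    obtain ⟨x, φ, hφ, hest⟩ := h X Φ hXΦ n hn hnb
    exact ⟨x, φ, hφ, fun f hf hfm => hest _ (Or.inl rfl) f hf hfm,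
      fun hqp2 f hf hfm => hest _ (Or.inr ⟨hqp2, rfl⟩) f hf hfm⟩
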